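/- Let $G=\mathrm{Sp}(1)^3\cong \mathrm{SU}(2)^3$, let $H\cong \mathrm{Sp}(1)$ be the diagonal subgroup, and identify $G/H$ with $S^3\times S^3$ by $(q_1,q_2,q_3)H\mapsto (q_1q_3^{-1},q_2q_3^{-1})$, so that $G$ acts by $(q_1,q_2,q_3)\cdot(x,y)=(q_1xq_3^{-1},q_2yq_3^{-1})$; $G$ acts on $J\times G/H$ through the second factor. A nearly parallel $G_2$-structure (NP-structure) on a $7$-manifold is a smooth positive $3$-form $\varphi$ with $d\varphi=\lambda *_\varphi\varphi$ for a constant $\lambda\neq0$, where $*_\varphi$ is the Hodge star of the metric $g_\varphi$ and the orientation determined by $\varphi$. Along $\gamma(t)=(t,eH)$ let $e_1=\gamma'(t)$, let $e_2,e_3,e_4$ be the values of the vector fields induced by $(x,-2x,x)\in\mathfrak{sp}(1)^3$ and $e_5,e_6,e_7$ those of the vector fields induced by $(-2x,x,x)$, for $x=i,j,k$ respectively. A $G$-invariant $3$-form $\varphi$ on $J\times G/H$ is determined by its coefficients $f_0=\varphi(e_1,e_2,e_5)$, $f_1=\varphi(e_2,e_3,e_4)$, $f_2=\varphi(e_5,e_6,e_7)$,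 $f_3=\varphi(e_2,e_3,e_7)$, $f_4=\varphi(e_2,e_6,e_7)$ as functions of $t$. The standard NP-structure of the round sphere $S^7$ ($\lambda=4$) has coefficients $$F(t)=\left(-9\sin t\cos t,\ 27\sin^4t,\ 27\cos^4t,\ -27\sin^2t\cos^2t,\ -27\sin^2t\cos^2t\right).$$ **Proposition.** There exist an open interval $J\ni\pi/4$, a connected open set $B\subset\mathbb R^2$ containing $0$, and $G$-invariant NP-structures $\varphi_s$ ($s\in B$) on $J\times G/H$, all with $\lambda=4$ and with $g_{\varphi_s}(\gamma',\gamma')=1$, whose coefficients $f^{(s)}(t)\in\mathbb R^5$ depend continuously on $(s,t)\in B\times J$, such that 1. $f^{(0)}=F$ on $J$, that is, $\varphi_0$ is the round-sphere solution; 2. the initial data $s\mapsto f^{(s)}(\pi/4)$ form an injective smooth immersion $B\to\mathbb R^5$ that is transverse to the round-sphere solution, that is, $F'(\pi/4)$ is not tangent to its image at $s=0$; 3. there is a nonempty open set $U\subset B$ such that for $s\in U$ the structures $\varphi_s$ are not locally homogeneous on $J\times G/H$ (their local automorphisms do not act transitively) and are mutually non-equivalent, even locally: for $s\neq s'$ in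 $U$ there is no diffeomorphism $\psi$ between nonempty open subsets of $J\times G/H$ with $\psi^*\varphi_{s'}=\varphi_s$. In particular, there is a two-dimensional family of mutually non-equivalent and not locally homogeneous $G$-invariant NP-structures on $J\times G/H$. -/

import Mathlib

open Set Topology
open scoped Manifold ContDiff Quaternion

noncomputable section

/-! Differential forms on a boundaryless manifold `M` modelled on `E`. -/

section Forms

variable {E : Type*} [NormedAddCommGroup E] [NormedSpace ℝ E] {H : Type*} [TopologicalSpace H]
  (I : ModelWithCorners ℝ E H) {M : Type*} [TopologicalSpace M] [ChartedSpace H M]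

/-- A (not necessarily smooth) differential `k`-form on `M`. -/
abbrev DForm (I : ModelWithCorners ℝ E H) (M : Type*) [TopologicalSpace M] [ChartedSpace H M]
    (k : ℕ) : Type _ :=
  ∀ x : M, (TangentSpace I x) [⋀^Fin k]→L[ℝ] ℝ

/-- The pull-back of a form by a map `ψ : M → M`. -/
def DForm.pullback {k : ℕ} (ψ : M → M) (α : DForm I M k) : DForm I M k := fun x =>
  (α (ψ x)).compContinuousLinearMap (mfderiv I I ψ x)

/-- The form `α` written in the preferred chart around `x₀`: the pull-back of `α` by the inverse
chart, a form on the target of the chart (an open set of `E`). -/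
def DForm.inChart {k : ℕ} (α : DForm I M k) (x₀ : M) : E → E [⋀^Fin k]→L[ℝ] ℝ := fun y =>
  (α ((extChartAt I x₀).symm y)).compContinuousLinearMap
    (mfderiv 𝓘(ℝ, E) I (extChartAt I x₀).symm y)

/-- `α` is smooth on the open set `X`. -/
def DForm.SmoothOn {k : ℕ} (α : DForm I M k) (X : Set M) : Prop :=
  ∀ x₀ ∈ X, ContDiffOn ℝ ∞ (DForm.inChart I α x₀)
    ((extChartAt I x₀).target ∩ (extChartAt I x₀).symm ⁻¹' X)

/-- The exterior derivative, computed at `x` in the preferred chart around `x`. -/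
def DForm.d {k : ℕ} (α : DForm I M k) : DForm I M (k + 1) := fun x =>
  (extDeriv (DForm.inChart I α x) (extChartAt I x x)).compContinuousLinearMap
    (mfderiv I 𝓘(ℝ, E) (extChartAt I x) x)

/-- `ψ` is a diffeomorphism between two open subsets of `X` that carries `α` to `β`
(that is, `ψ^* β = α`). -/
structure IsLocalIso {k : ℕ} (α β : DForm I M k) (X : Set M) (ψ : OpenPartialHomeomorph M M) :
    Prop where
  source_subset : ψ.source ⊆ X
  target_subset : ψ.target ⊆ X
  smooth : ContMDiffOn I I ∞ ψ ψ.source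
  smooth_symm : ContMDiffOn I I ∞ ψ.symm ψ.target
  pullback_eq : ∀ x ∈ ψ.source, DForm.pullback I ψ β x = α x

/-- `α` and `β` are locally equivalent on `X`: some nonempty open subsets of `X` are
identified by a diffeomorphism carrying `α` to `β`. -/
def LocallyEquivalent {k : ℕ} (α β : DForm I M k) (X : Set M) : Prop :=
  ∃ ψ : OpenPartialHomeomorph M M, ψ.source.Nonempty ∧ IsLocalIso I α β X ψ

/-- `(X, α)` is locally homogeneous: the local automorphisms act transitively on `X`. -/
def LocallyHomogeneous {k : ℕ} (α : DForm I M k) (X : Set M) : Prop :=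
  ∀ p ∈ X, ∀ q ∈ X, ∃ ψ : OpenPartialHomeomorph M M,
    IsLocalIso I α α X ψ ∧ p ∈ ψ.source ∧ ψ p = q

end Forms

/-! Linear algebra of `G₂`-structures. -/

/-- `e^{pqr} = e^p ∧ e^q ∧ e^r` on `ℝ⁷`. -/
def wedge3 (p q r : Fin 7) (u v w : Fin 7 → ℝ) : ℝ :=
  Matrix.det !![u p, u q, u r; v p, v q, v r; w p, w q, w r]

/-- The model `3`-form on `ℝ⁷`, whose stabilizer in `GL(7, ℝ)` is `G₂ ⊆ SO(7)`:
`e^{123} + e^{145} + e^{167} + e^{246} - e^{257} - e^{347} - e^{356}` (indices shifted by one). -/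
def phi0 (u v w : Fin 7 → ℝ) : ℝ :=
  wedge3 0 1 2 u v w + wedge3 0 3 4 u v w + wedge3 0 5 6 u v w + wedge3 1 3 5 u v w
    - wedge3 1 4 6 u v w - wedge3 2 3 6 u v w - wedge3 2 4 5 u v w

section Linear

variable {V : Type*} [AddCommGroup V] [Module ℝ V] [TopologicalSpace V]

/-- `b` is a frame adapted to the `3`-form `φ`: in this frame `φ` is the model form. Such a frame
exists exactly when `φ` lies in the open orbit `Λ³₊`. Any two adapted frames differ by an element
of `G₂ ⊆ SO(7)`; the metric `g_φ` and the orientation of `φ` are the ones for which the adapted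
frames are orthonormal and positively oriented. -/
def IsAdapted (φ : V [⋀^Fin 3]→L[ℝ] ℝ) (b : Module.Basis (Fin 7) ℝ V) : Prop :=
  ∀ u v w : V, φ ![u, v, w] = phi0 (b.equivFun u) (b.equivFun v) (b.equivFun w)

/-- The metric in which the frame `b` is orthonormal; it is `g_φ` when `b` is adapted to `φ`. -/
def frameMetric (b : Module.Basis (Fin 7) ℝ V) (u v : V) : ℝ :=
  ∑ i : Fin 7, b.equivFun u i * b.equivFun v i

/-- The Hodge star `*α` of a `3`-form `α`, for the metric and orientation in which the
frame `b` is orthonormal and positively oriented; `b.det` is the volume form. -/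
def hodgeStar (b : Module.Basis (Fin 7) ℝ V) (α : V [⋀^Fin 3]→L[ℝ] ℝ) (w : Fin 4 → V) : ℝ :=
  (1 / 6 : ℝ) * ∑ i : Fin 7, ∑ j : Fin 7, ∑ k : Fin 7,
    α ![b i, b j, b k] * b.det ![b i, b j, b k, w 0, w 1, w 2, w 3]

end Linear

/-- `φ` is a nearly parallel `G₂`-structure on the open set `X` with constant `l`: a smooth positive
`3`-form with `dφ = l *_φ φ`, where `l ≠ 0`. -/
structure IsNearlyParallel {E : Type*} [NormedAddCommGroup E] [NormedSpace ℝ E] {H : Type*}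
    [TopologicalSpace H] (I : ModelWithCorners ℝ E H) {M : Type*} [TopologicalSpace M]
    [ChartedSpace H M] (l : ℝ) (φ : DForm I M 3) (X : Set M) : Prop where
  ne_zero : l ≠ 0
  smooth : DForm.SmoothOn I φ X
  d_eq : ∀ x ∈ X, ∃ b : Module.Basis (Fin 7) ℝ (TangentSpace I x),
    IsAdapted (φ x) b ∧ ∀ w : Fin 4 → TangentSpace I x,
      DForm.d I φ x w = l * hodgeStar b (φ x) w

/-! The manifold `ℝ × G/H` for `G = Sp(1)³` and `H` the diagonal. -/

instance factFinrankQuaternion : Fact (Module.finrank ℝ ℍ[ℝ] = 3 + 1) :=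
  ⟨Quaternion.finrank_eq_four⟩

/-- The group `Sp(1) ≅ SU(2)` of unit quaternions, also the manifold `S³`. -/
abbrev Sp1 : Type := Metric.sphere (0 : ℍ[ℝ]) 1

/-- The group `G = Sp(1)³`. -/
abbrev GG : Type := Sp1 × Sp1 × Sp1

/-- The principal orbit `G/H ≅ S³ × S³`, on which `G` acts through
`(q₁, q₂, q₃) · (x, y) = (q₁ x q₃⁻¹, q₂ y q₃⁻¹)`. -/
abbrev Orbit : Type := Sp1 × Sp1

/-- The action of `G` on `G/H ≅ S³ × S³`. -/
def orbitAct (q : GG) (y : Orbit) : Orbit := (q.1 * y.1 * q.2.2⁻¹, q.2.1 * y.2 * q.2.2⁻¹)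

theorem orbitAct_one (y : Orbit) : orbitAct 1 y = y := by simp [orbitAct]

theorem orbitAct_mul (q q' : GG) (y : Orbit) :
    orbitAct (q * q') y = orbitAct q (orbitAct q' y) := by
  simp [orbitAct, mul_assoc]

/-- The action is transitive. -/
theorem orbitAct_transitive (y : Orbit) : ∃ q : GG, orbitAct q 1 = y :=
  ⟨(y.1, y.2, 1), by simp [orbitAct]⟩

/-- The isotropy group of the base point is the diagonal `H = Sp(1)`. -/
theorem orbitAct_stabilizer (q : GG) : orbitAct q 1 = 1 ↔ q.1 = q.2.1 ∧ q.2.1 = q.2.2 := by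
  simp only [orbitAct, Prod.fst_one, Prod.snd_one, mul_one, Prod.ext_iff, mul_inv_eq_one]
  exact ⟨fun h => ⟨h.1.trans h.2.symm, h.2⟩, fun h => ⟨h.1.trans h.2, h.2⟩⟩

/-- The `7`-manifold `ℝ × G/H`. -/
abbrev Tube : Type := ℝ × Orbit

/-- The model with corners (without boundary) of `ℝ × S³ × S³`. -/
abbrev tubeModel := 𝓘(ℝ, ℝ).prod ((𝓡 3).prod (𝓡 3))

/-- `3`-forms on `ℝ × G/H`. -/
abbrev TubeForm : Type := DForm tubeModel Tube 3

/-- The open subset `J × G/H`. -/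
def tubeOver (J : Set ℝ) : Set Tube := J ×ˢ univ

/-- `G` acts on `ℝ × G/H` on the second factor. -/
def tubeAct (q : GG) (p : Tube) : Tube := (p.1, orbitAct q p.2)

/-- `φ` is `G`-invariant on `J × G/H`. -/
def IsGInvariant (φ : TubeForm) (J : Set ℝ) : Prop :=
  ∀ q : GG, ∀ p ∈ tubeOver J, DForm.pullback tubeModel (tubeAct q) φ p = φ p

/-- `exp : sp(1) → Sp(1)`; `sp(1)` is the space of imaginary quaternions (the real part of the
argument is dropped). -/
def expSp1 (x : ℍ[ℝ]) : Sp1 :=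
  ⟨NormedSpace.exp x.im, by simp [Quaternion.norm_exp]⟩

/-- The value at `p` of the vector field on `ℝ × G/H` induced by `X ∈ sp(1)³`, that is
`d/ds exp(sX) · p` at `s = 0`. -/
def inducedVector (X : ℍ[ℝ] × ℍ[ℝ] × ℍ[ℝ]) (p : Tube) : TangentSpace tubeModel p :=
  (mfderiv 𝓘(ℝ, ℝ) tubeModel
    (fun s : ℝ => tubeAct (expSp1 (s • X.1), expSp1 (s • X.2.1), expSp1 (s • X.2.2)) p) 0
    (1 : ℝ) :)

/-- The basis `i, j, k` of `sp(1)`. -/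
def sp1Basis : Fin 3 → ℍ[ℝ] := ![⟨0, 1, 0, 0⟩, ⟨0, 0, 1, 0⟩, ⟨0, 0, 0, 1⟩]

/-- The point `γ(t) = (t, eH)`. -/
def gammaCurve (t : ℝ) : Tube := (t, 1)

/-- `e₁ = γ'(t)`. -/
def frameT (t : ℝ) : TangentSpace tubeModel (gammaCurve t) :=
  (mfderiv 𝓘(ℝ, ℝ) tubeModel gammaCurve t (1 : ℝ) :)

/-- `t` is the arc length along `γ`: `g_φ(γ'(t), γ'(t)) = 1` for `t ∈ J`. -/
def IsArcLength (φ : TubeForm) (J : Set ℝ) : Prop :=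
  ∀ t ∈ J, ∃ b : Module.Basis (Fin 7) ℝ (TangentSpace tubeModel (gammaCurve t)),
    IsAdapted (φ (gammaCurve t)) b ∧ frameMetric b (frameT t) (frameT t) = 1

/-- `e₂, e₃, e₄` at `γ(t)`: the vectors induced by `(x, -2x, x)`, `x = i, j, k`. -/
def framePlus (t : ℝ) (n : Fin 3) : TangentSpace tubeModel (gammaCurve t) :=
  inducedVector (sp1Basis n, (-2 : ℝ) • sp1Basis n, sp1Basis n) (gammaCurve t)

/-- `e₅, e₆, e₇` at `γ(t)`: the vectors induced by `(-2x, x, x)`, `x = i, j, k`. -/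
def frameMinus (t : ℝ) (n : Fin 3) : TangentSpace tubeModel (gammaCurve t) :=
  inducedVector ((-2 : ℝ) • sp1Basis n, sp1Basis n, sp1Basis n) (gammaCurve t)

/-- The coefficients `(f₀, …, f₄)` at `γ(t)` of an invariant `3`-form
`φ = f₀ (e^{125} + e^{136} + e^{147}) + f₁ e^{234} + f₂ e^{567} + f₃ (e^{237} - e^{246} + e^{345})
  + f₄ (e^{267} - e^{357} + e^{456})`. -/
def coeffs (φ : TubeForm) (t : ℝ) : Fin 5 → ℝ :=
  ![φ (gammaCurve t) ![frameT t, framePlus t 0, frameMinus t 0],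
    φ (gammaCurve t) ![framePlus t 0, framePlus t 1, framePlus t 2],
    φ (gammaCurve t) ![frameMinus t 0, frameMinus t 1, frameMinus t 2],
    φ (gammaCurve t) ![framePlus t 0, framePlus t 1, frameMinus t 2],
    φ (gammaCurve t) ![framePlus t 0, frameMinus t 1, frameMinus t 2]]

/-- The coefficients of the standard nearly parallel structure of the round sphere `S⁷`, along
`γ(t) = (cos t, sin t)`; the constant is `4`. -/
def roundCoeffs (t : ℝ) : Fin 5 → ℝ :=
  ![-9 * Real.sin t * Real.cos t, 27 * Real.sin t ^ 4, 27 * Real.cos t ^ 4,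
    -27 * Real.sin t ^ 2 * Real.cos t ^ 2, -27 * Real.sin t ^ 2 * Real.cos t ^ 2]

end

/-! Reduction to an ODE. Let x_k and y_k be the left-invariant coframes of the two spheres. For
complex functions ξ, η of t put z_k = ξ x_k + η y_k and D = Im(ξ̄η). When D ≠ 0, the form D dt∧Σ
x_k∧y_k + Re(z_1∧z_2∧z_3) is the G₂ model form in the coframe (dt, Re z_k, Im z_k). Its coefficients
are D and the real parts of ξ³, ξ²η, ξη², η³ (`phi0_adaptedCoord`). By the Maurer–Cartan equations,
dφ = 4*φ amounts to four differential equations for these real parts and the algebraic constraint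
Re(ξ²η + ξη²) = 2D². Write τ = η/ξ = x + iy and Z = ξ³. The constraint says Zτ(1+τ) = 2D²(1 − ip)
with p real, and |Z|² = (D/y)³ then determines D. So every trajectory of one explicit vector field
on the half space {(p, x, y) : y > 0} gives an invariant nearly parallel structure with arc length t
(`hasDerivAt_stateCoeffs`, `stateCoeffs_constraint`, `IsSolution.isNearlyParallel`).

The family. Geometrically 6p is the trace of the shape operator of the orbits. The metric is
Einstein with Ric = 6, so the traced Riccati equation gives p' < 0, and a trajectory meets p = 0 at
most once. The round sphere is (cot 2t, 0, tan t) and passes through (0, 0, 1) at t = π/4. Starting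
at (0, s₁, 1 + s₂) at time π/4 therefore gives a two-parameter family through the round solution in
which time translation is already used up. Immersion and transversality are read off from explicit
coefficients (`initialInverse_initialCoeffs`, `transverse_initialCoeffs`).

Rigidity. A local equivalence ψ preserves φ. Its differential lies in G₂ ⊆ SO(7)
(`transpose_mul_self_eq_one_of_phi0`), so ψ is an isometry and preserves |Rm|²
(`IsFrameMap.curvatureSq_eq`), which on an orbit is a function I(p, x, y). Near (0, e, 1) with e >
0, I is strictly decreasing along trajectories. Hence ψ preserves the foliation by orbits and sends
∂_t to ∂_t, so it also preserves the trace and the norm of the shape operator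
(`stateInvariants_eq`). The three resulting functions (p, M, I), with M = `shapeRatio`, have
invertible differential at (0, e, 1) (`jacobian_pos`), so ψ preserves the state. Two trajectories
that share a state differ by a time translation, which must be trivial since both have p = 0 at π/4
(`IsSolution.eq_of_meet`). Thus different members are not equivalent even locally, and no local
automorphism moves one orbit to another.

All computations of d, brackets and curvature are done in the flat space ℝ × ℍ × ℍ; inclusion and
radial projection transport them to and from the tube. -/

noncomputable section

/-! ### The group `G₂` preserves the standard metric -/

section GTwo

open Matrix

/-- The matrix of the `2`-form `ι_u φ₀`. -/
def contractPhi0 (u : Fin 7 → ℝ) : Matrix (Fin 7) (Fin 7) ℝ :=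
  !![0, u 2, -u 1, u 4, -u 3, u 6, -u 5;
     -u 2, 0, u 0, u 5, -u 6, -u 3, u 4;
     u 1, -u 0, 0, -u 6, -u 5, u 4, u 3;
     -u 4, -u 5, u 6, 0, u 0, u 1, -u 2;
     u 3, u 6, u 5, -u 0, 0, -u 2, -u 1;
     -u 6, u 3, -u 4, -u 1, u 2, 0, u 0;
     u 5, -u 4, -u 3, u 2, u 1, -u 0, 0]

theorem phi0_eq_contractPhi0 (u v w : Fin 7 → ℝ) :
    phi0 u v w = v ⬝ᵥ (contractPhi0 u *ᵥ w) := by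
  simp [phi0, wedge3, contractPhi0, Matrix.det_fin_three, dotProduct, Matrix.mulVec,
    Fin.sum_univ_succ]
  ring

/-- The octonionic identity u × (u × v) = ⟨u, v⟩u − |u|²v: on the complement of a unit vector u the
cross product with u is a complex structure. -/
theorem contractPhi0_mul_self (u : Fin 7 → ℝ) :
    contractPhi0 u * contractPhi0 u = vecMulVec u u - (u ⬝ᵥ u) • (1 : Matrix (Fin 7) (Fin 7) ℝ) := by
  ext i j
  fin_cases i <;> fin_cases j <;>
    simp [contractPhi0, Matrix.mul_apply, Fin.sum_univ_succ, dotProduct, vecMulVec] <;> ring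

theorem contractPhi0_transpose (u : Fin 7 → ℝ) : (contractPhi0 u)ᵀ = -contractPhi0 u := by
  ext i j
  fin_cases i <;> fin_cases j <;> simp [contractPhi0]

theorem contractPhi0_mulVec_self (u : Fin 7 → ℝ) : contractPhi0 u *ᵥ u = 0 := by
  ext i
  fin_cases i <;> simp [contractPhi0, Matrix.mulVec, dotProduct, Fin.sum_univ_succ] <;> ring

theorem det_smul_one_add_vecMulVec {l m : ℝ} {u : Fin 7 → ℝ} (hl : l ≠ 0) (hu : u ⬝ᵥ u = 1) :
    (l • (1 : Matrix (Fin 7) (Fin 7) ℝ) + m • vecMulVec u u).det = l ^ 6 * (l + m) := by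
  have h : l • (1 : Matrix (Fin 7) (Fin 7) ℝ) + m • vecMulVec u u
      = l • (1 + replicateCol Unit ((m / l) • u) * replicateRow Unit u) := by
    ext i j
    simp [vecMulVec, Matrix.mul_apply, Matrix.replicateCol, Matrix.replicateRow]
    field_simp
  rw [h, Matrix.det_smul, Matrix.det_one_add_replicateCol_mul_replicateRow]
  simp [dotProduct_smul, hu]
  field_simp

/-- With K_u the matrix of ι_u φ₀, invariance reads Aᵀ K_{Au} A = K_u. The quadratic identity for K
then constrains S = AᵀA. Taking determinants at an eigenvector of S ties each eigenvalue to det S,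
and multiplying over the eigenvalues gives det S = 1. -/
theorem transpose_mul_self_eq_one_of_phi0 (A : Matrix (Fin 7) (Fin 7) ℝ)
    (hA : ∀ u v w, phi0 (A *ᵥ u) (A *ᵥ v) (A *ᵥ w) = phi0 u v w) : Aᵀ * A = 1 := by
  have hK : ∀ u, Aᵀ * contractPhi0 (A *ᵥ u) * A = contractPhi0 u := by
    intro u
    ext i j
    have h := hA u (Pi.single i 1) (Pi.single j 1)
    rw [phi0_eq_contractPhi0, phi0_eq_contractPhi0, Matrix.mulVec_mulVec, dotProduct_mulVec,
      vecMul_mulVec, ← dotProduct_mulVec] at h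
    simpa [Matrix.mul_assoc] using h
  -- If A v = 0, then K_v = 0; but K_v² has trace −6|v|².
  have hdet : A.det ≠ 0 := by
    intro h0
    obtain ⟨v, hv, hv0⟩ := Matrix.exists_mulVec_eq_zero_iff.2 h0
    have h1 := hK v
    rw [hv0] at h1
    have h2 : contractPhi0 v = 0 := by
      rw [← h1]
      have : contractPhi0 0 = 0 := by
        ext i j
        fin_cases i <;> fin_cases j <;> simp [contractPhi0]
      rw [this]
      simp
    have h3 := contractPhi0_mul_self v
    rw [h2] at h3
    have h4 := congrArg Matrix.trace h3
    simp [Matrix.trace_vecMulVec] at h4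
    apply hv
    rw [← dotProduct_self_eq_zero]
    linarith
  set S : Matrix (Fin 7) (Fin 7) ℝ := Aᵀ * A with hS
  have hSdet : S.det = A.det ^ 2 := by rw [hS, det_mul, det_transpose, sq]
  have hSpos : S.PosDef := by
    have := Matrix.PosDef.conjTranspose_mul_self A
      (Matrix.mulVec_injective_of_isUnit ((Matrix.isUnit_iff_isUnit_det A).2 hdet.isUnit))
    rwa [Matrix.conjTranspose_eq_transpose_of_trivial] at this
  have hSu : IsUnit S.det := by rw [hSdet]; exact (pow_ne_zero 2 hdet).isUnit
  have hAu : IsUnit A.det := hdet.isUnit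
  have hAtu : IsUnit Aᵀ.det := by rwa [det_transpose]
  -- The left side equals Aᵀ K_{Au}² A, to which the quadratic identity applies.
  have key : ∀ u, contractPhi0 u * S⁻¹ * contractPhi0 u
      = vecMulVec (S *ᵥ u) (S *ᵥ u) - (u ⬝ᵥ (S *ᵥ u)) • S := by
    intro u
    have h1 := contractPhi0_mul_self (A *ᵥ u)
    have h2 : contractPhi0 u * S⁻¹ * contractPhi0 u
        = Aᵀ * (contractPhi0 (A *ᵥ u) * contractPhi0 (A *ᵥ u)) * A := by
      rw [← hK u, hS, Matrix.mul_inv_rev]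
      simp only [Matrix.mul_assoc]
      rw [Matrix.mul_nonsing_inv_cancel_left _ _ hAu, Matrix.nonsing_inv_mul_cancel_left _ _ hAtu]
    rw [h2, h1, Matrix.mul_sub, Matrix.sub_mul]
    congr 1
    · rw [Matrix.mul_vecMulVec, Matrix.vecMulVec_mul, ← Matrix.mulVec_transpose,
        Matrix.mulVec_mulVec]
    · rw [Matrix.mul_smul, Matrix.smul_mul, Matrix.mul_one]
      congr 1
      rw [dotProduct_mulVec, vecMul_mulVec, ← dotProduct_mulVec]
  have hl : ∀ i, hSpos.isHermitian.eigenvalues i ^ 4 * S.det ^ 2 = 1 := by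
    intro i
    set l := hSpos.isHermitian.eigenvalues i with hldef
    have hl0 : 0 < l := hSpos.eigenvalues_pos i
    set u : Fin 7 → ℝ := (hSpos.isHermitian.eigenvectorBasis i).ofLp with hu
    have hSv : S *ᵥ u = l • u := by
      have := hSpos.isHermitian.mulVec_eigenvectorBasis i
      simpa using this
    have huu : u ⬝ᵥ u = 1 := by
      have := hSpos.isHermitian.eigenvectorBasis.orthonormal.1 i
      rw [EuclideanSpace.norm_eq, Real.sqrt_eq_one] at this
      simpa [dotProduct, hu, sq] using this
    have hSiv : S⁻¹ *ᵥ u = l⁻¹ • u := by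
      have : S⁻¹ *ᵥ (S *ᵥ u) = u := by
        rw [Matrix.mulVec_mulVec, Matrix.nonsing_inv_mul _ hSu, Matrix.one_mulVec]
      rw [hSv, Matrix.mulVec_smul] at this
      rw [← this, smul_smul]
      rw [this, inv_mul_cancel₀ hl0.ne', one_smul]
    have hSt : Sᵀ = S := by simp [hS]
    have hSit : (S⁻¹)ᵀ = S⁻¹ := by rw [Matrix.transpose_nonsing_inv, hSt]
    have hk := key u
    rw [hSv] at hk
    set K := contractPhi0 u with hKdef
    -- K kills u, so it cannot be used in a determinant. Adding the projection uuᵀ gives an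
    -- orthogonal matrix (shown in `e2`), whose determinant squares to 1 and drops out.
    have e1 : (K + vecMulVec u u) * S⁻¹ * (K + vecMulVec u u)ᵀ
        = S * (l • (1 : Matrix (Fin 7) (Fin 7) ℝ) + (l⁻¹ ^ 2 - l) • vecMulVec u u) := by
      have t1 : (K + vecMulVec u u)ᵀ = -K + vecMulVec u u := by
        rw [transpose_add, hKdef, contractPhi0_transpose]
        congr 1
        ext a b; simp [vecMulVec, mul_comm]
      have t2 : vecMulVec u u * S⁻¹ = l⁻¹ • vecMulVec u u := by
        rw [Matrix.vecMulVec_mul, ← Matrix.mulVec_transpose, hSit, hSiv]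
        ext a b; simp [vecMulVec]; ring
      have t3 : vecMulVec u u * K = 0 := by
        rw [Matrix.vecMulVec_mul, ← Matrix.mulVec_transpose, hKdef, contractPhi0_transpose,
          Matrix.neg_mulVec, contractPhi0_mulVec_self]
        ext a b; simp [vecMulVec]
      have t4 : S⁻¹ * vecMulVec u u = l⁻¹ • vecMulVec u u := by
        rw [Matrix.mul_vecMulVec, hSiv]
        ext a b; simp [vecMulVec]; ring
      have t5 : K * vecMulVec u u = 0 := by
        rw [Matrix.mul_vecMulVec, hKdef, contractPhi0_mulVec_self]
        ext a b; simp [vecMulVec]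
      have t6 : vecMulVec u u * vecMulVec u u = vecMulVec u u := by
        rw [Matrix.vecMulVec_mul_vecMulVec, huu]; simp
      have t7 : S * vecMulVec u u = l • vecMulVec u u := by
        rw [Matrix.mul_vecMulVec, hSv]
        ext a b; simp [vecMulVec]; ring
      rw [t1, Matrix.add_mul, t2, Matrix.add_mul, Matrix.mul_add, Matrix.mul_neg, hk,
        Matrix.mul_assoc K, t4, Matrix.mul_smul, t5, Matrix.smul_mul, Matrix.mul_add,
        Matrix.mul_neg, t3, t6, Matrix.mul_add, Matrix.mul_smul, Matrix.mul_smul, Matrix.mul_one, t7,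
        dotProduct_smul, huu]
      ext a b
      simp [vecMulVec]
      field_simp
      ring
    have e2 : (K + vecMulVec u u) * (K + vecMulVec u u)ᵀ = 1 := by
      have t1 : (K + vecMulVec u u)ᵀ = -K + vecMulVec u u := by
        rw [transpose_add, hKdef, contractPhi0_transpose]
        congr 1
        ext a b; simp [vecMulVec, mul_comm]
      have t3 : vecMulVec u u * K = 0 := by
        rw [Matrix.vecMulVec_mul, ← Matrix.mulVec_transpose, hKdef, contractPhi0_transpose,
          Matrix.neg_mulVec, contractPhi0_mulVec_self]
        ext a b; simp [vecMulVec]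
      have t5 : K * vecMulVec u u = 0 := by
        rw [Matrix.mul_vecMulVec, hKdef, contractPhi0_mulVec_self]
        ext a b; simp [vecMulVec]
      have t6 : vecMulVec u u * vecMulVec u u = vecMulVec u u := by
        rw [Matrix.vecMulVec_mul_vecMulVec, huu]; simp
      rw [t1, Matrix.add_mul, Matrix.mul_add, Matrix.mul_add, Matrix.mul_neg, Matrix.mul_neg, t3, t5,
        t6, hKdef, contractPhi0_mul_self, huu]
      simp
    have d2 := congrArg Matrix.det e2
    rw [det_mul, det_transpose, det_one] at d2
    have d1 := congrArg Matrix.det e1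
    rw [det_mul, det_mul, det_transpose, det_mul, det_smul_one_add_vecMulVec hl0.ne' huu,
      Matrix.det_nonsing_inv, Ring.inverse_eq_inv'] at d1
    have hS0 : S.det ≠ 0 := hSu.ne_zero
    have d3 : S.det⁻¹ = S.det * (l ^ 6 * (l⁻¹ ^ 2)) := by
      calc S.det⁻¹ = (K + vecMulVec u u).det * (K + vecMulVec u u).det * S.det⁻¹ := by
            rw [d2, one_mul]
        _ = (K + vecMulVec u u).det * S.det⁻¹ * (K + vecMulVec u u).det := by ring
        _ = _ := by rw [d1]; ring
    field_simp at d3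
    linarith
  have hSdpos : 0 < S.det := hSpos.det_pos
  have hl2 : ∀ i, hSpos.isHermitian.eigenvalues i ^ 2 * S.det = 1 := by
    intro i
    have h0 : 0 ≤ hSpos.isHermitian.eigenvalues i ^ 2 * S.det := by positivity
    have h1 : (hSpos.isHermitian.eigenvalues i ^ 2 * S.det) ^ 2 = 1 := by
      rw [← hl i]; ring
    exact (pow_eq_one_iff_of_nonneg h0 two_ne_zero).1 h1
  have hdetprod : S.det = ∏ i, hSpos.isHermitian.eigenvalues i := by
    simpa using hSpos.isHermitian.det_eq_prod_eigenvalues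
  -- The relation l² det S = 1 is multiplied over the seven eigenvalues: (det S)² (det S)⁷ = 1.
  have hd9 : S.det ^ 9 = 1 := by
    have h1 : S.det ^ 2 = ∏ i, hSpos.isHermitian.eigenvalues i ^ 2 := by
      rw [hdetprod, Finset.prod_pow]
    have h2 : ∀ i, hSpos.isHermitian.eigenvalues i ^ 2 = S.det⁻¹ := fun i =>
      eq_inv_of_mul_eq_one_left (hl2 i)
    simp only [h2, Finset.prod_const, Finset.card_univ, Fintype.card_fin] at h1
    have h3 : S.det ^ 2 * S.det ^ 7 = 1 := by
      rw [h1, ← mul_pow, inv_mul_cancel₀ hSdpos.ne', one_pow]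
    linarith [h3, (by ring : S.det ^ 2 * S.det ^ 7 = S.det ^ 9)]
  have hd1 : S.det = 1 := (pow_eq_one_iff_of_nonneg hSdpos.le (by norm_num)).1 hd9
  have hev : hSpos.isHermitian.eigenvalues = fun _ => 1 := by
    funext i
    have := hl2 i
    rw [hd1, mul_one] at this
    exact (pow_eq_one_iff_of_nonneg (hSpos.eigenvalues_pos i).le two_ne_zero).1 this
  have hsp := hSpos.isHermitian.spectral_theorem
  rw [hsp, hev]
  simp

end GTwo

/-! ### The Hodge star in an adapted frame -/

section Star

open Matrix

/-- `e^{pqrs}` on `ℝ⁷`. -/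
def wedge4 (p q r s : Fin 7) (W : Fin 4 → Fin 7 → ℝ) : ℝ :=
  Matrix.det !![W 0 p, W 0 q, W 0 r, W 0 s; W 1 p, W 1 q, W 1 r, W 1 s;
    W 2 p, W 2 q, W 2 r, W 2 s; W 3 p, W 3 q, W 3 r, W 3 s]

/-- The `4`-form `*φ₀`. -/
def psi0 (W : Fin 4 → Fin 7 → ℝ) : ℝ :=
  wedge4 3 4 5 6 W + wedge4 1 2 5 6 W + wedge4 1 2 3 4 W + wedge4 0 2 4 6 W
    - wedge4 0 2 3 5 W - wedge4 0 1 4 5 W - wedge4 0 1 3 6 W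

theorem det_of_cons_single {n : ℕ} (i : Fin (n + 1)) (M : Fin n → Fin (n + 1) → ℝ) :
    (Matrix.of (Matrix.vecCons (Pi.single i 1) M) : Matrix (Fin (n + 1)) (Fin (n + 1)) ℝ).det
      = (-1) ^ (i : ℕ) * (Matrix.of fun a b => M a (i.succAbove b)).det := by
  rw [Matrix.det_succ_row_zero, Finset.sum_eq_single i]
  · simp
    rfl
  · intro j _ hj
    simp [hj]
  · simp

/-- The determinant with first rows `e_i`, `e_j`, `e_k`. -/
def detThree (W : Fin 4 → Fin 7 → ℝ) (i j k : Fin 7) : ℝ :=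
  (Matrix.of ![Pi.single i 1, Pi.single j 1, Pi.single k 1, W 0, W 1, W 2, W 3] :
    Matrix (Fin 7) (Fin 7) ℝ).det

theorem detThree_swap_left (W : Fin 4 → Fin 7 → ℝ) (i j k : Fin 7) :
    detThree W j i k = -detThree W i j k := by
  have e : (Matrix.of ![Pi.single j 1, Pi.single i 1, Pi.single k 1, W 0, W 1, W 2, W 3] : Matrix (Fin 7) (Fin 7) ℝ)
      = (Matrix.of ![Pi.single i 1, Pi.single j 1, Pi.single k 1, W 0, W 1, W 2, W 3]).submatrix
        (Equiv.swap (0 : Fin 7) 1) id := by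
    ext a c
    fin_cases a <;> rfl
  rw [detThree, detThree, e, Matrix.det_permute, Equiv.Perm.sign_swap (by decide)]
  simp

theorem detThree_swap_right (W : Fin 4 → Fin 7 → ℝ) (i j k : Fin 7) :
    detThree W i k j = -detThree W i j k := by
  have e : (Matrix.of ![Pi.single i 1, Pi.single k 1, Pi.single j 1, W 0, W 1, W 2, W 3] : Matrix (Fin 7) (Fin 7) ℝ)
      = (Matrix.of ![Pi.single i 1, Pi.single j 1, Pi.single k 1, W 0, W 1, W 2, W 3]).submatrix
        (Equiv.swap (1 : Fin 7) 2) id := by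
    ext a c
    fin_cases a <;> rfl
  rw [detThree, detThree, e, Matrix.det_permute, Equiv.Perm.sign_swap (by decide)]
  simp

/-- The six terms of the 3×3 determinant contribute equally because `detThree` is alternating in i,
j, k. -/
theorem sum_wedge3_mul_detThree (p q r : Fin 7) (W : Fin 4 → Fin 7 → ℝ) :
    ∑ i : Fin 7, ∑ j : Fin 7, ∑ k : Fin 7,
      wedge3 p q r (Pi.single i 1) (Pi.single j 1) (Pi.single k 1) * detThree W i j k
      = 6 * detThree W p q r := by
  have e1 : detThree W p r q = -detThree W p q r := detThree_swap_right W p q r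
  have e2 : detThree W q p r = -detThree W p q r := detThree_swap_left W p q r
  have e3 : detThree W q r p = detThree W p q r := by
    rw [detThree_swap_right W q p r, e2, neg_neg]
  have e4 : detThree W r p q = detThree W p q r := by
    rw [detThree_swap_left W p r q, e1, neg_neg]
  have e5 : detThree W r q p = -detThree W p q r := by
    rw [detThree_swap_right W r p q, e4]
  simp only [wedge3, Matrix.det_fin_three, Matrix.of_apply, Matrix.cons_val', Matrix.cons_val_zero,
    Matrix.cons_val_one, Matrix.cons_val, Pi.single_apply, sub_mul, add_mul, ite_mul, mul_ite,
    one_mul, mul_one, zero_mul, mul_zero, Finset.sum_add_distrib, Finset.sum_sub_distrib,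
    Finset.sum_ite_eq, Finset.mem_univ, if_true]
  rw [e1, e2, e3, e4, e5]
  ring

theorem detThree_eq (W : Fin 4 → Fin 7 → ℝ) (i : Fin 7) (j : Fin 6) (k : Fin 5) :
    detThree W i (i.succAbove j) (i.succAbove (j.succAbove k)) =
      (-1) ^ (i + j + k : ℕ) * (Matrix.of fun a b => W a
        (i.succAbove (j.succAbove (k.succAbove b)))).det := by
  rw [detThree, det_of_cons_single]
  have h1 : (Matrix.of fun a b => (![Pi.single (i.succAbove j) 1,
        Pi.single (i.succAbove (j.succAbove k)) 1, W 0, W 1, W 2, W 3] :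
          Fin 6 → Fin 7 → ℝ) a (i.succAbove b))
      = Matrix.of (Matrix.vecCons (Pi.single j 1) ![Pi.single (j.succAbove k) 1,
        fun b => W 0 (i.succAbove b), fun b => W 1 (i.succAbove b), fun b => W 2 (i.succAbove b),
        fun b => W 3 (i.succAbove b)]) := by
    ext a b
    fin_cases a <;> simp [Pi.single_apply]
  rw [h1, det_of_cons_single]
  have h2 : (Matrix.of fun a b => (![Pi.single (j.succAbove k) 1,
        fun b => W 0 (i.succAbove b), fun b => W 1 (i.succAbove b), fun b => W 2 (i.succAbove b),
        fun b => W 3 (i.succAbove b)] : Fin 5 → Fin 6 → ℝ) a (j.succAbove b))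
      = Matrix.of (Matrix.vecCons (Pi.single k 1) (fun (a : Fin 4) b =>
        W a (i.succAbove (j.succAbove b)))) := by
    ext a b
    fin_cases a <;> simp [Pi.single_apply]
  rw [h2, det_of_cons_single]
  simp only [pow_add, mul_assoc]

theorem wedge4_eq (p q r s : Fin 7) (W : Fin 4 → Fin 7 → ℝ) :
    wedge4 p q r s W = (Matrix.of fun a b => W a (![p, q, r, s] b)).det := by
  unfold wedge4
  congr 1
  ext a b
  fin_cases a <;> fin_cases b <;> rfl

theorem sum_phi0_mul_detThree (W : Fin 4 → Fin 7 → ℝ) :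
    ∑ i : Fin 7, ∑ j : Fin 7, ∑ k : Fin 7,
      phi0 (Pi.single i 1) (Pi.single j 1) (Pi.single k 1) * detThree W i j k = 6 * psi0 W := by
  -- Here i, j, k are the successive positions of the deleted columns, p, q, r the same columns in
  -- the original numbering, the primed indices the four columns that remain, and e the cofactor
  -- sign.
  have key : ∀ (i : Fin 7) (j : Fin 6) (k : Fin 5) (p q r p' q' r' s' : Fin 7) (e : ℝ), i = p →
      i.succAbove j = q → i.succAbove (j.succAbove k) = r → (-1) ^ (i + j + k : ℕ) = e →
      (fun b => i.succAbove (j.succAbove (k.succAbove b))) = ![p', q', r', s'] →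
      detThree W p q r = e * wedge4 p' q' r' s' W := by
    rintro i j k p q r p' q' r' s' e rfl rfl rfl rfl h
    rw [detThree_eq, wedge4_eq, ← h]
  have d1 := key 0 0 0 0 1 2 3 4 5 6 1 rfl rfl rfl (by norm_num) (by decide)
  have d2 := key 0 2 2 0 3 4 1 2 5 6 1 rfl rfl rfl (by norm_num) (by decide)
  have d3 := key 0 4 4 0 5 6 1 2 3 4 1 rfl rfl rfl (by norm_num) (by decide)
  have d4 := key 1 2 3 1 3 5 0 2 4 6 1 rfl rfl rfl (by norm_num) (by decide)
  have d5 := key 1 3 4 1 4 6 0 2 3 5 1 rfl rfl rfl (by norm_num) (by decide)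
  have d6 := key 2 2 4 2 3 6 0 1 4 5 1 rfl rfl rfl (by norm_num) (by decide)
  have d7 := key 2 3 3 2 4 5 0 1 3 6 1 rfl rfl rfl (by norm_num) (by decide)
  simp only [phi0, sub_mul, add_mul, Finset.sum_add_distrib, Finset.sum_sub_distrib,
    sum_wedge3_mul_detThree]
  rw [d1, d2, d3, d4, d5, d6, d7, psi0]
  ring

theorem hodgeStar_of_isAdapted {V : Type*} [AddCommGroup V] [Module ℝ V] [TopologicalSpace V]
    (φ : V [⋀^Fin 3]→L[ℝ] ℝ) (b : Module.Basis (Fin 7) ℝ V) (hb : IsAdapted φ b)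
    (w : Fin 4 → V) : hodgeStar b φ w = psi0 fun i => b.equivFun (w i) := by
  have h1 : ∀ i, b.equivFun (b i) = Pi.single i 1 := fun i => by
    ext j
    simp [Module.Basis.equivFun_self, Pi.single_apply, eq_comm]
  have h2 : ∀ i j k, b.det ![b i, b j, b k, w 0, w 1, w 2, w 3]
      = detThree (fun i => b.equivFun (w i)) i j k := by
    intro i j k
    rw [Module.Basis.det_apply, detThree, ← Matrix.det_transpose]
    congr 1
    ext a c
    rw [Matrix.transpose_apply, Module.Basis.toMatrix_apply]
    fin_cases a <;> simp [← h1, Module.Basis.equivFun_apply]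
  unfold hodgeStar
  simp only [hb _ _ _, h1, h2]
  rw [sum_phi0_mul_detThree]
  ring

end Star

end


noncomputable section

/-! ### The ambient space `ℝ × ℍ × ℍ` -/

/-- The ambient vector space of `ℝ × S³ × S³`. -/
abbrev Amb : Type := ℝ × ℍ[ℝ] × ℍ[ℝ]

/-- The inclusion `ℝ × S³ × S³ → ℝ × ℍ × ℍ`. -/
def tubeIncl (p : Tube) : Amb := (p.1, (p.2.1 : ℍ[ℝ]), (p.2.2 : ℍ[ℝ]))

theorem contMDiff_tubeIncl : ContMDiff tubeModel 𝓘(ℝ, Amb) ∞ tubeIncl := by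
  have h1 : ContMDiff tubeModel 𝓘(ℝ, ℝ) ∞ (fun p : Tube => p.1) := contMDiff_fst
  have h2 : ContMDiff tubeModel 𝓘(ℝ, ℍ[ℝ]) ∞ (fun p : Tube => (p.2.1 : ℍ[ℝ])) :=
    contMDiff_coe_sphere.comp (contMDiff_fst.comp contMDiff_snd)
  have h3 : ContMDiff tubeModel 𝓘(ℝ, ℍ[ℝ]) ∞ (fun p : Tube => (p.2.2 : ℍ[ℝ])) :=
    contMDiff_coe_sphere.comp (contMDiff_snd.comp contMDiff_snd)
  exact h1.prodMk_space (h2.prodMk_space h3)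

open Classical in
/-- Radial projection `ℍ ∖ 0 → S³` (with a junk value at `0`). -/
def sphereProj (p : ℍ[ℝ]) : Sp1 :=
  if h : p ≠ 0 then ⟨‖p‖⁻¹ • p, by simp [norm_smul, h]⟩ else 1

theorem coe_sphereProj {p : ℍ[ℝ]} (h : p ≠ 0) : (sphereProj p : ℍ[ℝ]) = ‖p‖⁻¹ • p := by
  simp [sphereProj, h]

theorem sphereProj_coe (x : Sp1) : sphereProj (x : ℍ[ℝ]) = x := by
  have h : (x : ℍ[ℝ]) ≠ 0 := ne_zero_of_mem_unit_sphere x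
  ext1
  rw [coe_sphereProj h]
  simp

theorem contMDiffAt_sphereProj {p : ℍ[ℝ]} (h : p ≠ 0) :
    ContMDiffAt 𝓘(ℝ, ℍ[ℝ]) (𝓡 3) ∞ sphereProj p := by
  let U : TopologicalSpace.Opens ℍ[ℝ] := ⟨{0}ᶜ, isOpen_compl_singleton⟩
  have hU : ∀ x : U, (x : ℍ[ℝ]) ≠ 0 := fun x => x.2
  have h1 : ContMDiff 𝓘(ℝ, ℍ[ℝ]) 𝓘(ℝ, ℍ[ℝ]) ∞ (fun x : U => ‖(x : ℍ[ℝ])‖⁻¹ • (x : ℍ[ℝ])) := by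
    intro x
    have : ContMDiffAt 𝓘(ℝ, ℍ[ℝ]) 𝓘(ℝ, ℍ[ℝ]) ∞ (fun x : ℍ[ℝ] => ‖x‖⁻¹ • x) (x : ℍ[ℝ]) :=
      (((contDiffAt_norm ℝ (hU x)).inv (by simpa using hU x)).smul contDiffAt_id).contMDiffAt
    exact contMDiffAt_subtype_iff.2 this
  have h2 : ∀ x : U, ‖(x : ℍ[ℝ])‖⁻¹ • (x : ℍ[ℝ]) ∈ Metric.sphere (0 : ℍ[ℝ]) 1 := by
    intro x
    simp [norm_smul, hU x]
  have h3 := h1.codRestrict_sphere (n := 3) h2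
  have h4 := h3 (⟨p, h⟩ : U)
  have h5 : Set.codRestrict _ _ h2 = fun x : U => sphereProj x := by
    funext x
    ext1
    rw [coe_sphereProj (hU x)]
    rfl
  rw [h5] at h4
  exact contMDiffAt_subtype_iff.1 h4

/-- Radial projection `ℝ × (ℍ ∖ 0) × (ℍ ∖ 0) → ℝ × S³ × S³`. -/
def tubeProj (z : Amb) : Tube := (z.1, sphereProj z.2.1, sphereProj z.2.2)

theorem tubeProj_tubeIncl (p : Tube) : tubeProj (tubeIncl p) = p := by
  simp [tubeProj, tubeIncl, sphereProj_coe]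

/-- The domain of the radial projection. -/
def punctured : Set Amb := {z | z.2.1 ≠ 0 ∧ z.2.2 ≠ 0}

theorem isOpen_punctured : IsOpen punctured := by
  apply IsOpen.inter
  · exact isOpen_compl_singleton.preimage (by fun_prop : Continuous fun z : Amb => z.2.1)
  · exact isOpen_compl_singleton.preimage (by fun_prop : Continuous fun z : Amb => z.2.2)

theorem tubeIncl_mem_punctured (p : Tube) : tubeIncl p ∈ punctured :=
  ⟨ne_zero_of_mem_unit_sphere p.2.1, ne_zero_of_mem_unit_sphere p.2.2⟩

theorem contMDiffAt_tubeProj {z : Amb} (hz : z ∈ punctured) :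
    ContMDiffAt 𝓘(ℝ, Amb) tubeModel ∞ tubeProj z := by
  have h1 : ContMDiffAt 𝓘(ℝ, Amb) 𝓘(ℝ, ℝ) ∞ (fun z : Amb => z.1) z :=
    contDiff_fst.contMDiff.contMDiffAt
  have h2 : ContMDiffAt 𝓘(ℝ, Amb) (𝓡 3) ∞ (fun z : Amb => sphereProj z.2.1) z :=
    ContMDiffAt.comp z (contMDiffAt_sphereProj hz.1)
      (contDiff_fst.comp contDiff_snd).contMDiff.contMDiffAt
  have h3 : ContMDiffAt 𝓘(ℝ, Amb) (𝓡 3) ∞ (fun z : Amb => sphereProj z.2.2) z :=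
    ContMDiffAt.comp z (contMDiffAt_sphereProj hz.2)
      (contDiff_snd.comp contDiff_snd).contMDiff.contMDiffAt
  exact h1.prodMk (h2.prodMk h3)

/-- The differential of the inclusion. -/
def dIncl (p : Tube) : TangentSpace tubeModel p →L[ℝ] Amb :=
  mfderiv tubeModel 𝓘(ℝ, Amb) tubeIncl p

theorem mdifferentiableAt_tubeIncl (p : Tube) :
    MDifferentiableAt tubeModel 𝓘(ℝ, Amb) tubeIncl p :=
  (contMDiff_tubeIncl p).mdifferentiableAt (by simp)

/-- Radial projection is a smooth left inverse of the inclusion. This makes the inclusion an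
immersion and lets tangent vectors be identified with vectors of the ambient space. -/
theorem mfderiv_tubeProj_dIncl (p : Tube) (v : TangentSpace tubeModel p) :
    mfderiv 𝓘(ℝ, Amb) tubeModel tubeProj (tubeIncl p) (dIncl p v) =
      (show TangentSpace tubeModel (tubeProj (tubeIncl p)) from v) := by
  have h := mfderiv_comp p ((contMDiffAt_tubeProj (tubeIncl_mem_punctured p)).mdifferentiableAt
    (by simp)) (mdifferentiableAt_tubeIncl p)
  have h2 : tubeProj ∘ tubeIncl = id := funext tubeProj_tubeIncl
  rw [h2, mfderiv_id] at h
  exact (DFunLike.congr_fun h v).symm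

theorem dIncl_injective (p : Tube) : Function.Injective (dIncl p) := by
  intro v w h
  have h1 := mfderiv_tubeProj_dIncl p v
  have h2 := mfderiv_tubeProj_dIncl p w
  rw [h] at h1
  exact h1.symm.trans h2

/-- The form on `ℝ × S³ × S³` induced by a form on the ambient space. -/
def restrictForm {k : ℕ} (Φ : Amb → Amb [⋀^Fin k]→L[ℝ] ℝ) : DForm tubeModel Tube k := fun p =>
  (Φ (tubeIncl p)).compContinuousLinearMap (dIncl p)

/-- The inclusion in a chart. -/
def inclChart (x₀ : Tube) : (ℝ × EuclideanSpace ℝ (Fin 3) × EuclideanSpace ℝ (Fin 3)) → Amb :=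
  tubeIncl ∘ (extChartAt tubeModel x₀).symm

theorem contDiff_inclChart (x₀ : Tube) :
    ContDiffOn ℝ ∞ (inclChart x₀) (extChartAt tubeModel x₀).target := by
  have h := contMDiff_tubeIncl.comp_contMDiffOn (contMDiffOn_extChartAt_symm (n := ∞) (I := tubeModel) x₀)
  exact h.contDiffOn

theorem inChart_restrictForm {k : ℕ} (Φ : Amb → Amb [⋀^Fin k]→L[ℝ] ℝ) (x₀ : Tube)
    {y : ℝ × EuclideanSpace ℝ (Fin 3) × EuclideanSpace ℝ (Fin 3)}
    (hy : y ∈ (extChartAt tubeModel x₀).target) :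
    DForm.inChart tubeModel (restrictForm Φ) x₀ y
      = (Φ (inclChart x₀ y)).compContinuousLinearMap (fderiv ℝ (inclChart x₀) y) := by
  have ht : (extChartAt tubeModel x₀).target ∈ 𝓝 y := (isOpen_extChartAt_target x₀).mem_nhds hy
  have h1 : MDifferentiableAt 𝓘(ℝ, ℝ × EuclideanSpace ℝ (Fin 3) × EuclideanSpace ℝ (Fin 3))
      tubeModel (extChartAt tubeModel x₀).symm y :=
    ((contMDiffOn_extChartAt_symm (n := ∞) (I := tubeModel) x₀).contMDiffAt ht).mdifferentiableAt
      (by simp)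
  have h2 := mfderiv_comp y (mdifferentiableAt_tubeIncl ((extChartAt tubeModel x₀).symm y)) h1
  have h3 : fderiv ℝ (inclChart x₀) y = (dIncl ((extChartAt tubeModel x₀).symm y)).comp
      (mfderiv 𝓘(ℝ, ℝ × EuclideanSpace ℝ (Fin 3) × EuclideanSpace ℝ (Fin 3)) tubeModel
        (extChartAt tubeModel x₀).symm y) := by
    rw [← mfderiv_eq_fderiv]
    exact h2
  rw [h3]
  rfl

/-- Exterior differentiation commutes with pull-back by the inclusion written in a chart. Composing
with the chart again gives the differential of the inclusion, so the chart disappears. -/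
theorem d_restrictForm {k : ℕ} {Φ : Amb → Amb [⋀^Fin k]→L[ℝ] ℝ} {x : Tube}
    (hΦ : DifferentiableAt ℝ Φ (tubeIncl x)) :
    DForm.d tubeModel (restrictForm Φ) x
      = (extDeriv Φ (tubeIncl x)).compContinuousLinearMap (dIncl x) := by
  have ht : (extChartAt tubeModel x).target ∈ 𝓝 (extChartAt tubeModel x x) :=
    extChartAt_target_mem_nhds x
  have hx : inclChart x (extChartAt tubeModel x x) = tubeIncl x := by
    rw [inclChart, Function.comp_apply, extChartAt_to_inv]
  have h1 : DForm.inChart tubeModel (restrictForm Φ) x =ᶠ[𝓝 (extChartAt tubeModel x x)]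
      fun y => (Φ (inclChart x y)).compContinuousLinearMap (fderiv ℝ (inclChart x) y) := by
    filter_upwards [ht] with y hy using inChart_restrictForm Φ x hy
  have hc : ContDiffAt ℝ ∞ (inclChart x) (extChartAt tubeModel x x) :=
    (contDiff_inclChart x).contDiffAt ht
  unfold DForm.d
  rw [h1.extDeriv_eq, extDeriv_pullback (r := ∞) (by rwa [hx]) hc
    (by simpa using WithTop.coe_le_coe.2 (le_top (a := (2 : ℕ∞)))), hx]
  have h2 : MDifferentiableAt tubeModel
      𝓘(ℝ, ℝ × EuclideanSpace ℝ (Fin 3) × EuclideanSpace ℝ (Fin 3)) (extChartAt tubeModel x) x :=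
    mdifferentiableAt_extChartAt (mem_chart_source _ x)
  have h3 : MDifferentiableAt 𝓘(ℝ, ℝ × EuclideanSpace ℝ (Fin 3) × EuclideanSpace ℝ (Fin 3))
      𝓘(ℝ, Amb) (inclChart x) (extChartAt tubeModel x x) :=
    (hc.differentiableAt (by simp)).mdifferentiableAt
  have h4 := mfderiv_comp x h3 h2
  have h5 : inclChart x ∘ extChartAt tubeModel x =ᶠ[𝓝 x] tubeIncl := by
    filter_upwards [extChartAt_source_mem_nhds (I := tubeModel) x] with y hy
    simp only [inclChart, Function.comp_apply]
    rw [(extChartAt tubeModel x).left_inv hy]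
  rw [h5.mfderiv_eq, mfderiv_eq_fderiv] at h4
  unfold dIncl
  rw [h4]
  rfl

/-- Evaluation on tuples of basis vectors embeds the alternating maps linearly in a
finite-dimensional coordinate space. A linear left inverse carries smoothness back. -/
theorem contDiffOn_continuousAlternatingMap {E F : Type*} [NormedAddCommGroup E] [NormedSpace ℝ E]
    [NormedAddCommGroup F] [NormedSpace ℝ F] [FiniteDimensional ℝ F] {k : ℕ}
    {f : E → F [⋀^Fin k]→L[ℝ] ℝ} {s : Set E} {m : ℕ∞ω}
    (h : ∀ v : Fin k → F, ContDiffOn ℝ m (fun x => f x v) s) : ContDiffOn ℝ m f s := by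
  let b := Module.finBasis ℝ F
  let Λ : (F [⋀^Fin k]→L[ℝ] ℝ) →ₗ[ℝ] ((Fin k → Fin (Module.finrank ℝ F)) → ℝ) :=
    { toFun := fun α i => α fun j => b (i j)
      map_add' := fun _ _ => rfl
      map_smul' := fun _ _ => rfl }
  have hΛ : Function.Injective Λ := by
    intro α β hαβ
    apply ContinuousAlternatingMap.toAlternatingMap_injective
    apply AlternatingMap.coe_multilinearMap_injective
    exact Module.Basis.ext_multilinear (fun _ => b) fun i => congrFun hαβ i
  have : FiniteDimensional ℝ (F [⋀^Fin k]→L[ℝ] ℝ) := FiniteDimensional.of_injective Λ hΛ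
  obtain ⟨Λ', hΛ'⟩ := LinearMap.exists_leftInverse_of_injective Λ (LinearMap.ker_eq_bot.2 hΛ)
  have h1 : ContDiffOn ℝ m (fun x => Λ (f x)) s :=
    contDiffOn_pi.2 fun i => h fun j => b (i j)
  have h2 : ContDiff ℝ m Λ' := (LinearMap.toContinuousLinearMap Λ').contDiff
  refine (h2.comp_contDiffOn h1).congr fun x _ => ?_
  exact (LinearMap.congr_fun hΛ' (f x)).symm

theorem smoothOn_restrictForm {k : ℕ} {Φ : Amb → Amb [⋀^Fin k]→L[ℝ] ℝ} {X : Set Tube} {O : Set Amb}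
    (hΦ : ContDiffOn ℝ ∞ (fun z : Amb × (Fin k → Amb) => Φ z.1 z.2) (O ×ˢ univ))
    (hX : MapsTo tubeIncl X O) : DForm.SmoothOn tubeModel (restrictForm Φ) X := by
  intro x₀ hx₀
  have hc := (contDiff_inclChart x₀)
  have ho := isOpen_extChartAt_target (I := tubeModel) x₀
  have hd : ContDiffOn ℝ ∞ (fderiv ℝ (inclChart x₀)) (extChartAt tubeModel x₀).target :=
    hc.fderiv_of_isOpen ho (by simp)
  apply contDiffOn_continuousAlternatingMap
  intro v
  have h1 : ContDiffOn ℝ ∞ (fun y => Φ (inclChart x₀ y) (fun j => fderiv ℝ (inclChart x₀) y (v j)))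
      ((extChartAt tubeModel x₀).target ∩ (extChartAt tubeModel x₀).symm ⁻¹' X) := by
    refine hΦ.comp (f := fun y => (inclChart x₀ y, fun j => fderiv ℝ (inclChart x₀) y (v j)))
      ?_ ?_
    · refine (hc.mono inter_subset_left).prodMk (contDiffOn_pi.2 fun j => ?_)
      exact (hd.mono inter_subset_left).clm_apply contDiffOn_const
    · intro y hy
      exact ⟨hX hy.2, mem_univ _⟩
  refine h1.congr fun y hy => ?_
  rw [inChart_restrictForm Φ x₀ hy.1]
  rfl

end


noncomputable section

/-! ### Invariant `3`-forms -/

/-- `e^{pqr}` as a continuous alternating map. -/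
def wedge3Form (p q r : Fin 7) : (Fin 7 → ℝ) [⋀^Fin 3]→L[ℝ] ℝ :=
  { (Matrix.detRowAlternating (n := Fin 3) (R := ℝ)).compLinearMap
      (LinearMap.funLeft ℝ ℝ ![p, q, r]) with
    cont := by
      change Continuous fun v : Fin 3 → Fin 7 → ℝ =>
        Matrix.det (Matrix.of fun i j => v i (![p, q, r] j))
      refine Continuous.matrix_det ?_
      exact continuous_pi fun i => continuous_pi fun j => by fun_prop }

theorem wedge3Form_apply (p q r : Fin 7) (v : Fin 3 → Fin 7 → ℝ) :
    wedge3Form p q r v = wedge3 p q r (v 0) (v 1) (v 2) := by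
  change Matrix.det (Matrix.of fun i j => v i (![p, q, r] j)) = _
  unfold wedge3
  congr 1
  ext i j
  fin_cases i <;> fin_cases j <;> rfl

/-- The invariant `3`-form with coefficients `f` on `ℝ ⊕ ℝ³ ⊗ ℝ²`. -/
def beta (f : Fin 5 → ℝ) (u v w : Fin 7 → ℝ) : ℝ :=
  f 0 * (wedge3 0 1 2 u v w + wedge3 0 3 4 u v w + wedge3 0 5 6 u v w)
    + f 1 * wedge3 1 3 5 u v w
    + f 2 * (wedge3 2 3 5 u v w + wedge3 1 4 5 u v w + wedge3 1 3 6 u v w)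
    + f 3 * (wedge3 1 4 6 u v w + wedge3 2 3 6 u v w + wedge3 2 4 5 u v w)
    + f 4 * wedge3 2 4 6 u v w

/-- `beta` as a continuous alternating map. -/
def betaForm (f : Fin 5 → ℝ) : (Fin 7 → ℝ) [⋀^Fin 3]→L[ℝ] ℝ :=
  f 0 • (wedge3Form 0 1 2 + wedge3Form 0 3 4 + wedge3Form 0 5 6) + f 1 • wedge3Form 1 3 5
    + f 2 • (wedge3Form 2 3 5 + wedge3Form 1 4 5 + wedge3Form 1 3 6)
    + f 3 • (wedge3Form 1 4 6 + wedge3Form 2 3 6 + wedge3Form 2 4 5) + f 4 • wedge3Form 2 4 6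

theorem betaForm_apply (f : Fin 5 → ℝ) (v : Fin 3 → Fin 7 → ℝ) :
    betaForm f v = beta f (v 0) (v 1) (v 2) := by
  simp [betaForm, beta, wedge3Form_apply, mul_add]

/-- The bilinear map underlying the left-invariant coframe: `(p, u) ↦ Im (p̄ u)`. -/
def mcBilin (z v : Amb) : Fin 7 → ℝ :=
  ![0, (star z.2.1 * v.2.1).imI, (star z.2.2 * v.2.2).imI, (star z.2.1 * v.2.1).imJ,
    (star z.2.2 * v.2.2).imJ, (star z.2.1 * v.2.1).imK, (star z.2.2 * v.2.2).imK]

/-- The coframe consisting of `dt` and the left-invariant `1`-forms of the two spheres. -/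
def mcCoord (z : Amb) : Amb →L[ℝ] (Fin 7 → ℝ) :=
  LinearMap.toContinuousLinearMap
    { toFun := fun v => ![v.1, (star z.2.1 * v.2.1).imI, (star z.2.2 * v.2.2).imI,
        (star z.2.1 * v.2.1).imJ, (star z.2.2 * v.2.2).imJ, (star z.2.1 * v.2.1).imK,
        (star z.2.2 * v.2.2).imK]
      map_add' := fun v w => by
        ext i
        fin_cases i <;> simp <;> ring
      map_smul' := fun c v => by
        ext i
        fin_cases i <;> simp }

theorem mcCoord_apply (z v : Amb) : mcCoord z v =
    ![v.1, (star z.2.1 * v.2.1).imI, (star z.2.2 * v.2.2).imI,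
      (star z.2.1 * v.2.1).imJ, (star z.2.2 * v.2.2).imJ, (star z.2.1 * v.2.1).imK,
      (star z.2.2 * v.2.2).imK] := rfl

/-- The coframe is affine in the base point, so differentiating an invariant form only replaces one
argument by `mcBilin`. -/
theorem mcCoord_add_smul (z h v : Amb) (s : ℝ) :
    mcCoord (z + s • h) v = mcCoord z v + s • mcBilin h v := by
  ext i
  fin_cases i
  · simp [mcCoord_apply, mcBilin]
  all_goals simp [mcCoord_apply, mcBilin]; ring

/-- The form on the ambient space with coefficients `f`. -/
def ambForm (f : ℝ → Fin 5 → ℝ) (z : Amb) : Amb [⋀^Fin 3]→L[ℝ] ℝ :=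
  (betaForm (f z.1)).compContinuousLinearMap (mcCoord z)

theorem ambForm_apply (f : ℝ → Fin 5 → ℝ) (z : Amb) (v : Fin 3 → Amb) :
    ambForm f z v = beta (f z.1) (mcCoord z (v 0)) (mcCoord z (v 1)) (mcCoord z (v 2)) := by
  rw [ambForm, ContinuousAlternatingMap.compContinuousLinearMap_apply, betaForm_apply]
  rfl

/-- The invariant form with coefficients `f` on the tube. -/
def tubeForm (f : ℝ → Fin 5 → ℝ) : TubeForm := restrictForm (ambForm f)

theorem contDiff_star_quaternion : ContDiff ℝ ∞ (fun q : ℍ[ℝ] => star q) :=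
  (LinearMap.toContinuousLinearMap
    { toFun := fun q : ℍ[ℝ] => star q, map_add' := star_add,
      map_smul' := fun c q => by ext <;> simp }).contDiff

theorem contDiff_imI : ContDiff ℝ ∞ (fun q : ℍ[ℝ] => q.imI) :=
  (LinearMap.toContinuousLinearMap
    { toFun := fun q : ℍ[ℝ] => q.imI, map_add' := by simp, map_smul' := by simp }).contDiff

theorem contDiff_imJ : ContDiff ℝ ∞ (fun q : ℍ[ℝ] => q.imJ) :=
  (LinearMap.toContinuousLinearMap
    { toFun := fun q : ℍ[ℝ] => q.imJ, map_add' := by simp, map_smul' := by simp }).contDiff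

theorem contDiff_imK : ContDiff ℝ ∞ (fun q : ℍ[ℝ] => q.imK) :=
  (LinearMap.toContinuousLinearMap
    { toFun := fun q : ℍ[ℝ] => q.imK, map_add' := by simp, map_smul' := by simp }).contDiff

theorem contDiff_mcCoord : ContDiff ℝ ∞ (fun z : Amb × Amb => mcCoord z.1 z.2) := by
  have hm : ContDiff ℝ ∞ (fun z : ℍ[ℝ] × ℍ[ℝ] => star z.1 * z.2) :=
    (contDiff_star_quaternion.comp contDiff_fst).mul contDiff_snd
  have h1 : ContDiff ℝ ∞ (fun z : Amb × Amb => star z.1.2.1 * z.2.2.1) :=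
    hm.comp (f := fun z : Amb × Amb => (z.1.2.1, z.2.2.1)) (by fun_prop)
  have h2 : ContDiff ℝ ∞ (fun z : Amb × Amb => star z.1.2.2 * z.2.2.2) :=
    hm.comp (f := fun z : Amb × Amb => (z.1.2.2, z.2.2.2)) (by fun_prop)
  have h0 : ContDiff ℝ ∞ (fun z : Amb × Amb => z.2.1) := by fun_prop
  rw [contDiff_pi]
  intro i
  fin_cases i
  · exact h0
  · exact contDiff_imI.comp h1
  · exact contDiff_imI.comp h2
  · exact contDiff_imJ.comp h1
  · exact contDiff_imJ.comp h2
  · exact contDiff_imK.comp h1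
  · exact contDiff_imK.comp h2

theorem contDiff_wedge3 (p q r : Fin 7) : ContDiff ℝ ∞
    (fun v : (Fin 7 → ℝ) × (Fin 7 → ℝ) × (Fin 7 → ℝ) => wedge3 p q r v.1 v.2.1 v.2.2) := by
  simp only [wedge3, Matrix.det_fin_three, Matrix.of_apply, Matrix.cons_val', Matrix.cons_val_zero,
    Matrix.cons_val_one, Matrix.cons_val]
  fun_prop

theorem contDiff_beta : ContDiff ℝ ∞ (fun v : (Fin 5 → ℝ) × (Fin 7 → ℝ) × (Fin 7 → ℝ) × (Fin 7 → ℝ) =>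
    beta v.1 v.2.1 v.2.2.1 v.2.2.2) := by
  have h : ∀ p q r, ContDiff ℝ ∞ (fun v : (Fin 5 → ℝ) × (Fin 7 → ℝ) × (Fin 7 → ℝ) × (Fin 7 → ℝ) =>
      wedge3 p q r v.2.1 v.2.2.1 v.2.2.2) := fun p q r =>
    (contDiff_wedge3 p q r).comp contDiff_snd
  have hf : ∀ i, ContDiff ℝ ∞ (fun v : (Fin 5 → ℝ) × (Fin 7 → ℝ) × (Fin 7 → ℝ) × (Fin 7 → ℝ) =>
      v.1 i) := fun i => by fun_prop
  exact ((((hf 0).mul (((h 0 1 2).add (h 0 3 4)).add (h 0 5 6))).add ((hf 1).mul (h 1 3 5))).add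
    ((hf 2).mul (((h 2 3 5).add (h 1 4 5)).add (h 1 3 6)))).add
    ((hf 3).mul (((h 1 4 6).add (h 2 3 6)).add (h 2 4 5))) |>.add ((hf 4).mul (h 2 4 6))

theorem contDiffOn_ambForm {f : ℝ → Fin 5 → ℝ} {J : Set ℝ} (hf : ContDiffOn ℝ ∞ f J) :
    ContDiffOn ℝ ∞ (fun z : Amb × (Fin 3 → Amb) => ambForm f z.1 z.2)
      ((Prod.fst ⁻¹' J) ×ˢ univ) := by
  simp only [ambForm_apply]
  have hc : ∀ i, ContDiff ℝ ∞ (fun z : Amb × (Fin 3 → Amb) => mcCoord z.1 (z.2 i)) := fun i =>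
    contDiff_mcCoord.comp (f := fun z : Amb × (Fin 3 → Amb) => (z.1, z.2 i)) (by fun_prop)
  have h1 : ContDiffOn ℝ ∞ (fun z : Amb × (Fin 3 → Amb) => f z.1.1)
      ((Prod.fst ⁻¹' J) ×ˢ univ) :=
    hf.comp (f := fun z : Amb × (Fin 3 → Amb) => z.1.1) (by fun_prop) fun z hz => hz.1
  exact contDiff_beta.comp_contDiffOn (h1.prodMk ((hc 0).contDiffOn.prodMk
    ((hc 1).contDiffOn.prodMk (hc 2).contDiffOn)))

theorem smoothOn_tubeForm {f : ℝ → Fin 5 → ℝ} {J : Set ℝ} (hf : ContDiffOn ℝ ∞ f J) :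
    DForm.SmoothOn tubeModel (tubeForm f) (tubeOver J) :=
  smoothOn_restrictForm (contDiffOn_ambForm hf) fun _ hp => hp.1

theorem differentiableAt_ambForm {f : ℝ → Fin 5 → ℝ} {J : Set ℝ} (hJ : IsOpen J)
    (hf : ContDiffOn ℝ ∞ f J) {z : Amb} (hz : z.1 ∈ J) : DifferentiableAt ℝ (ambForm f) z := by
  have h : ContDiffOn ℝ ∞ (ambForm f) (Prod.fst ⁻¹' J) := by
    apply contDiffOn_continuousAlternatingMap
    intro v
    exact (contDiffOn_ambForm hf).comp (f := fun z : Amb => (z, v)) (by fun_prop)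
      fun z hz => ⟨hz, mem_univ _⟩
  have ho : IsOpen (Prod.fst ⁻¹' J : Set Amb) := hJ.preimage continuous_fst
  exact (h.contDiffAt (ho.mem_nhds hz)).differentiableAt (by simp)

/-! ### The exterior derivative of an invariant form -/

theorem hasDerivAt_wedge3 (p q r : Fin 7) (a b c a' b' c' : Fin 7 → ℝ) :
    HasDerivAt (fun s : ℝ => wedge3 p q r (a + s • a') (b + s • b') (c + s • c'))
      (wedge3 p q r a' b c + wedge3 p q r a b' c + wedge3 p q r a b c') 0 := by
  have h : ∀ (u u' : Fin 7 → ℝ) (i : Fin 7), HasDerivAt (fun s : ℝ => (u + s • u') i) (u' i) 0 := by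
    intro u u' i
    simpa using ((hasDerivAt_id (0 : ℝ)).mul_const (u' i)).const_add (u i)
  simp only [wedge3, Matrix.det_fin_three, Matrix.of_apply, Matrix.cons_val', Matrix.cons_val_zero,
    Matrix.cons_val_one, Matrix.cons_val]
  have h3 : ∀ i j k, HasDerivAt (fun s : ℝ => (a + s • a') i * (b + s • b') j * (c + s • c') k)
      (a' i * b j * c k + a i * b' j * c k + a i * b j * c' k) 0 := by
    intro i j k
    refine (((h a a' i).mul (h b b' j)).mul (h c c' k)).congr_deriv ?_
    simp
    ring
  refine ((((((h3 p q r).sub (h3 p r q)).sub (h3 q p r)).add (h3 q r p)).add (h3 r p q)).sub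
    (h3 r q p)).congr_deriv ?_
  ring

theorem hasDerivAt_beta {f : ℝ → Fin 5 → ℝ} {f' : Fin 5 → ℝ} {t τ : ℝ} (hf : HasDerivAt f f' t)
    (a b c a' b' c' : Fin 7 → ℝ) :
    HasDerivAt (fun s : ℝ => beta (f (t + s * τ)) (a + s • a') (b + s • b') (c + s • c'))
      (τ * beta f' a b c + (beta (f t) a' b c + beta (f t) a b' c + beta (f t) a b c')) 0 := by
  have hf0 : ∀ i, HasDerivAt (fun s : ℝ => f (t + s * τ) i) (f' i * τ) 0 := by
    intro i
    have h1 : HasDerivAt (fun s : ℝ => t + s * τ) τ 0 := by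
      simpa using ((hasDerivAt_id (0 : ℝ)).mul_const τ).const_add t
    have h2 : HasDerivAt (fun s => f s i) (f' i) (t + 0 * τ) := by
      simpa using (hasDerivAt_pi.1 hf) i
    exact h2.comp (0 : ℝ) h1
  have hw := fun p q r => hasDerivAt_wedge3 p q r a b c a' b' c'
  have := (((((hf0 0).mul (((hw 0 1 2).add (hw 0 3 4)).add (hw 0 5 6))).add
    ((hf0 1).mul (hw 1 3 5))).add
    ((hf0 2).mul (((hw 2 3 5).add (hw 1 4 5)).add (hw 1 3 6)))).add
    ((hf0 3).mul (((hw 1 4 6).add (hw 2 3 6)).add (hw 2 4 5)))).add ((hf0 4).mul (hw 2 4 6))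
  refine this.congr_deriv ?_
  simp [beta]
  ring

/-- The exterior derivative of the form `beta f`, where `f' = df/dt`. -/
def dBeta (f f' : Fin 5 → ℝ) (W : Fin 4 → Fin 7 → ℝ) : ℝ :=
  f' 1 * wedge4 0 1 3 5 W
    + (f' 2 + 2 * f 0) * (wedge4 0 2 3 5 W + wedge4 0 1 4 5 W + wedge4 0 1 3 6 W)
    + (f' 3 - 2 * f 0) * (wedge4 0 1 4 6 W + wedge4 0 2 3 6 W + wedge4 0 2 4 5 W)
    + f' 4 * wedge4 0 2 4 6 W
    + 2 * (f 2 + f 3) * (wedge4 1 2 3 4 W + wedge4 1 2 5 6 W + wedge4 3 4 5 6 W)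

/-- The Maurer–Cartan bracket: the negative of the cross product in each factor `ℝ³`. -/
def mcBracket (l m : Fin 7 → ℝ) : Fin 7 → ℝ :=
  ![0, -(l 3 * m 5 - l 5 * m 3), -(l 4 * m 6 - l 6 * m 4), -(l 5 * m 1 - l 1 * m 5),
    -(l 6 * m 2 - l 2 * m 6), -(l 1 * m 3 - l 3 * m 1), -(l 2 * m 4 - l 4 * m 2)]

theorem star_mul_eq_of_norm_one {p : ℍ[ℝ]} (hp : ‖p‖ = 1) (u v : ℍ[ℝ]) :
    star u * v = star (star p * u) * (star p * v) := by
  have h : p * star p = 1 := by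
    rw [Quaternion.self_mul_star, Quaternion.normSq_eq_norm_mul_self, hp]; simp
  rw [star_mul, star_star, mul_assoc, ← mul_assoc p, h, one_mul]

/-- At a unit quaternion p, ū v = conj(p̄u)(p̄v), and for imaginary a, b one has Im(ā b) = −a × b.
Antisymmetrized, this is the Maurer–Cartan equation dx_1 = −2 x_2∧x_3 and its cyclic versions. It
requires tangency to the spheres. -/
theorem mcBilin_eq_mcBracket {z u v : Amb} (h1 : ‖z.2.1‖ = 1) (h2 : ‖z.2.2‖ = 1)
    (hu1 : (star z.2.1 * u.2.1).re = 0) (hu2 : (star z.2.2 * u.2.2).re = 0)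
    (hv1 : (star z.2.1 * v.2.1).re = 0) (hv2 : (star z.2.2 * v.2.2).re = 0) :
    mcBilin u v = mcBracket (mcCoord z u) (mcCoord z v) := by
  have e1 := star_mul_eq_of_norm_one h1 u.2.1 v.2.1
  have e2 := star_mul_eq_of_norm_one h2 u.2.2 v.2.2
  simp only [mcBilin, mcBracket, mcCoord_apply, e1, e2]
  generalize star z.2.1 * u.2.1 = a at *
  generalize star z.2.1 * v.2.1 = b at *
  generalize star z.2.2 * u.2.2 = c at *
  generalize star z.2.2 * v.2.2 = d at *
  ext i
  fin_cases i <;> simp [hu1, hu2, hv1, hv2] <;> ring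

theorem wedge4_laplace (p q r s : Fin 7) (a b c d : Fin 7 → ℝ) :
    wedge4 p q r s ![a, b, c, d] = a p * wedge3 q r s b c d - a q * wedge3 p r s b c d
      + a r * wedge3 p q s b c d - a s * wedge3 p q r b c d := by
  simp [wedge3, wedge4, Matrix.det_succ_row_zero, Fin.sum_univ_succ, Fin.succAbove]
  ring

theorem wedge3_expand (p q r : Fin 7) (u v w : Fin 7 → ℝ) :
    wedge3 p q r u v w = u p * v q * w r - u p * v r * w q - u q * v p * w r + u q * v r * w p
      + u r * v p * w q - u r * v q * w p := by
  simp [wedge3, Matrix.det_fin_three]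

theorem sum_wedge3_dt (p q r : Fin 7) (a b c d : Fin 7 → ℝ) :
    a 0 * wedge3 p q r b c d - b 0 * wedge3 p q r a c d + c 0 * wedge3 p q r a b d
      - d 0 * wedge3 p q r a b c = wedge4 0 p q r ![a, b, c, d] := by
  simp only [wedge4_laplace, wedge3_expand]
  ring

/-- The cyclic sum computing the exterior derivative of the left-invariant form `e^{pqr}`. -/
def dWedge3 (p q r : Fin 7) (a b c d : Fin 7 → ℝ) : ℝ :=
  (wedge3 p q r (mcBracket a b) c d + wedge3 p q r b (mcBracket a c) d
      + wedge3 p q r b c (mcBracket a d))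
    - (wedge3 p q r (mcBracket b a) c d + wedge3 p q r a (mcBracket b c) d
      + wedge3 p q r a c (mcBracket b d))
    + (wedge3 p q r (mcBracket c a) b d + wedge3 p q r a (mcBracket c b) d
      + wedge3 p q r a b (mcBracket c d))
    - (wedge3 p q r (mcBracket d a) b c + wedge3 p q r a (mcBracket d b) c
      + wedge3 p q r a b (mcBracket d c))

/-- From dx_1 = −2 x_2∧x_3 and dy_1 = −2 y_2∧y_3 (cyclically), together with the sign from moving d
past dt. In the four lemmas that follow, the pure volume forms of the two spheres are closed, and
both mixed types have the same derivative, a multiple of the square of Σ x_k∧y_k. -/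
theorem dWedge3_omega (a b c d : Fin 7 → ℝ) :
    dWedge3 0 1 2 a b c d + dWedge3 0 3 4 a b c d + dWedge3 0 5 6 a b c d
      = 2 * (wedge4 0 2 3 5 ![a, b, c, d] + wedge4 0 1 4 5 ![a, b, c, d]
          + wedge4 0 1 3 6 ![a, b, c, d])
        - 2 * (wedge4 0 1 4 6 ![a, b, c, d] + wedge4 0 2 3 6 ![a, b, c, d]
          + wedge4 0 2 4 5 ![a, b, c, d]) := by
  simp only [dWedge3, wedge4_laplace, wedge3_expand, mcBracket, Matrix.cons_val]
  ring

theorem dWedge3_xxx (a b c d : Fin 7 → ℝ) : dWedge3 1 3 5 a b c d = 0 := by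
  simp only [dWedge3, wedge3_expand, mcBracket, Matrix.cons_val]
  ring

theorem dWedge3_yyy (a b c d : Fin 7 → ℝ) : dWedge3 2 4 6 a b c d = 0 := by
  simp only [dWedge3, wedge3_expand, mcBracket, Matrix.cons_val]
  ring

theorem dWedge3_xxy (a b c d : Fin 7 → ℝ) :
    dWedge3 2 3 5 a b c d + dWedge3 1 4 5 a b c d + dWedge3 1 3 6 a b c d
      = 2 * (wedge4 1 2 3 4 ![a, b, c, d] + wedge4 1 2 5 6 ![a, b, c, d]
          + wedge4 3 4 5 6 ![a, b, c, d]) := by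
  simp only [dWedge3, wedge4_laplace, wedge3_expand, mcBracket, Matrix.cons_val]
  ring

theorem dWedge3_xyy (a b c d : Fin 7 → ℝ) :
    dWedge3 1 4 6 a b c d + dWedge3 2 3 6 a b c d + dWedge3 2 4 5 a b c d
      = 2 * (wedge4 1 2 3 4 ![a, b, c, d] + wedge4 1 2 5 6 ![a, b, c, d]
          + wedge4 3 4 5 6 ![a, b, c, d]) := by
  simp only [dWedge3, wedge4_laplace, wedge3_expand, mcBracket, Matrix.cons_val]
  ring

theorem wedge4_self_left (q r : Fin 7) (W : Fin 4 → Fin 7 → ℝ) : wedge4 0 0 q r W = 0 := by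
  rw [wedge4_eq]
  exact Matrix.det_zero_of_column_eq (show (0 : Fin 4) ≠ 1 by decide) fun _ => rfl

theorem sum_beta_mcBracket (f f' : Fin 5 → ℝ) (a b c d : Fin 7 → ℝ) :
    (a 0 * beta f' b c d + (beta f (mcBracket a b) c d + beta f b (mcBracket a c) d
        + beta f b c (mcBracket a d)))
      - (b 0 * beta f' a c d + (beta f (mcBracket b a) c d + beta f a (mcBracket b c) d
        + beta f a c (mcBracket b d)))
      + (c 0 * beta f' a b d + (beta f (mcBracket c a) b d + beta f a (mcBracket c b) d
        + beta f a b (mcBracket c d)))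
      - (d 0 * beta f' a b c + (beta f (mcBracket d a) b c + beta f a (mcBracket d b) c
        + beta f a b (mcBracket d c)))
      = dBeta f f' ![a, b, c, d] := by
  have e0 := dWedge3_omega a b c d
  have e1 := dWedge3_xxx a b c d
  have e2 := dWedge3_xxy a b c d
  have e3 := dWedge3_xyy a b c d
  have e4 := dWedge3_yyy a b c d
  have t := fun p q r => sum_wedge3_dt p q r a b c d
  -- The derivative of the coefficient of dt∧Σ x_k∧y_k does not contribute, since dt∧dt = 0.
  have z1 := (t 0 1 2).trans (wedge4_self_left 1 2 _)
  have z2 := (t 0 3 4).trans (wedge4_self_left 3 4 _)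
  have z3 := (t 0 5 6).trans (wedge4_self_left 5 6 _)
  simp only [dWedge3] at e0 e1 e2 e3 e4
  unfold dBeta beta
  rw [← t 1 3 5, ← t 2 3 5, ← t 1 4 5, ← t 1 3 6, ← t 1 4 6, ← t 2 3 6, ← t 2 4 5, ← t 2 4 6]
  rw [← t 2 3 5, ← t 1 4 5, ← t 1 3 6, ← t 1 4 6, ← t 2 3 6, ← t 2 4 5] at e0
  linear_combination f 0 * e0 + f 1 * e1 + f 2 * e2 + f 3 * e3 + f 4 * e4
    + f' 0 * z1 + f' 0 * z2 + f' 0 * z3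

/-- The exterior derivative is the alternating sum of directional derivatives. A direction enters
through its dt-component, which differentiates the coefficients, and through the Maurer–Cartan
bracket in each slot. -/
theorem extDeriv_ambForm {f : ℝ → Fin 5 → ℝ} {f' : Fin 5 → ℝ} {z : Amb} (w : Fin 4 → Amb)
    (hd : DifferentiableAt ℝ (ambForm f) z) (hf : HasDerivAt f f' z.1)
    (h1 : ‖z.2.1‖ = 1) (h2 : ‖z.2.2‖ = 1) (hw1 : ∀ i, (star z.2.1 * (w i).2.1).re = 0)
    (hw2 : ∀ i, (star z.2.2 * (w i).2.2).re = 0) :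
    extDeriv (ambForm f) z w = dBeta (f z.1) f' fun i => mcCoord z (w i) := by
  have key : ∀ (h : Fin 3 → Amb) (i : Fin 4), fderiv ℝ (fun y => ambForm f y h) z (w i)
      = (w i).1 * beta f' (mcCoord z (h 0)) (mcCoord z (h 1)) (mcCoord z (h 2))
        + (beta (f z.1) (mcBilin (w i) (h 0)) (mcCoord z (h 1)) (mcCoord z (h 2))
          + beta (f z.1) (mcCoord z (h 0)) (mcBilin (w i) (h 1)) (mcCoord z (h 2))
          + beta (f z.1) (mcCoord z (h 0)) (mcCoord z (h 1)) (mcBilin (w i) (h 2))) := by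
    intro h i
    have hd1 : HasFDerivAt (fun y => ambForm f y h) (fderiv ℝ (fun y => ambForm f y h) z)
        (z + (0 : ℝ) • w i) := by
      rw [zero_smul, add_zero]
      exact (hd.continuousAlternatingMap_apply_const h).hasFDerivAt
    have hl : HasDerivAt (fun s : ℝ => z + s • w i) (w i) 0 := by
      simpa using ((hasDerivAt_id (0 : ℝ)).smul_const (w i)).const_add z
    have hc := hd1.comp_hasDerivAt (0 : ℝ) hl
    have hb := hasDerivAt_beta (τ := (w i).1) hf (mcCoord z (h 0)) (mcCoord z (h 1))
      (mcCoord z (h 2)) (mcBilin (w i) (h 0)) (mcBilin (w i) (h 1)) (mcBilin (w i) (h 2))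
    refine hc.unique (hb.congr_of_eventuallyEq (Filter.Eventually.of_forall fun s => ?_))
    simp only [Function.comp_apply, ambForm_apply, mcCoord_add_smul]
    simp
  have hb := fun i j => mcBilin_eq_mcBracket h1 h2 (hw1 i) (hw2 i) (hw1 j) (hw2 j)
  rw [extDeriv_apply hd]
  simp only [key, Fin.removeNth, hb]
  have hv : (fun i => mcCoord z (w i)) = ![mcCoord z (w 0), mcCoord z (w 1), mcCoord z (w 2),
      mcCoord z (w 3)] := by
    ext i
    fin_cases i <;> rfl
  rw [hv, ← sum_beta_mcBracket]
  have hz : ∀ i, (w i).1 = mcCoord z (w i) 0 := fun i => rfl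
  simp [Fin.succAbove, hz, Fin.sum_univ_succ]
  ring

end


noncomputable section

/-! ### The ordinary differential equation -/

section ODE

/-- Real part of `τ (1 + τ)`, `τ = x + i y`. -/
def aa (x y : ℝ) : ℝ := x ^ 2 + x - y ^ 2

/-- Imaginary part of `τ (1 + τ)`. -/
def bb (x y : ℝ) : ℝ := y * (2 * x + 1)

/-- The polynomial `3 (x² + x) + y²`. -/
def cc (x y : ℝ) : ℝ := 3 * (x ^ 2 + x) + y ^ 2

/-- `|τ (1 + τ)|²`. -/
def qq (x y : ℝ) : ℝ := (x ^ 2 + y ^ 2) * ((x + 1) ^ 2 + y ^ 2)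

theorem qq_eq (x y : ℝ) : qq x y = aa x y ^ 2 + bb x y ^ 2 := by
  unfold qq aa bb
  ring

theorem qq_pos {x y : ℝ} (hy : 0 < y) : 0 < qq x y := by
  unfold qq
  positivity

/-- `|ν|² / (1 + p²)`, where `ν` is the traceless part of the shape operator of the orbits. -/
def shapeRatio (x y : ℝ) : ℝ := (bb x y ^ 2 + cc x y ^ 2) / qq x y

/-- The derivative of `p`. -/
def pDot (p x y : ℝ) : ℝ := -(1 + p ^ 2) * (1 + shapeRatio x y)

/-- The derivative of `x`. -/
def xDot (p x y : ℝ) : ℝ :=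
  2 * y * (p * (aa x y * bb x y - bb x y * cc x y) + (bb x y ^ 2 + aa x y * cc x y)) / qq x y

/-- The derivative of `y`. -/
def yDot (p x y : ℝ) : ℝ :=
  2 * y * (p * (bb x y ^ 2 + aa x y * cc x y) - (aa x y * bb x y - bb x y * cc x y)) / qq x y

/-- The vector field of the ordinary differential equation. -/
def stateField (c : ℝ × ℝ × ℝ) : ℝ × ℝ × ℝ :=
  (pDot c.1 c.2.1 c.2.2, xDot c.1 c.2.1 c.2.2, yDot c.1 c.2.1 c.2.2)

/-- The area `D = Im (ξ̄ η)`. -/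
def areaD (p x y : ℝ) : ℝ := qq x y / (4 * y ^ 3 * (1 + p ^ 2))

/-- The real part of `Z = ξ³`. -/
def zRe (p x y : ℝ) : ℝ := qq x y * (aa x y - bb x y * p) / (8 * y ^ 6 * (1 + p ^ 2) ^ 2)

/-- The imaginary part of `Z = ξ³`. -/
def zIm (p x y : ℝ) : ℝ := -(qq x y * (bb x y + aa x y * p)) / (8 * y ^ 6 * (1 + p ^ 2) ^ 2)

/-- The coefficients `D`, `Re Z`, `Re Zτ`, `Re Zτ²`, `Re Zτ³`. -/
def stateCoeffs (c : ℝ × ℝ × ℝ) : Fin 5 → ℝ :=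
  let p := c.1
  let x := c.2.1
  let y := c.2.2
  ![areaD p x y, zRe p x y, x * zRe p x y - y * zIm p x y,
    (x ^ 2 - y ^ 2) * zRe p x y - 2 * x * y * zIm p x y,
    (x ^ 3 - 3 * x * y ^ 2) * zRe p x y - (3 * x ^ 2 * y - y ^ 3) * zIm p x y]

/-- The derivative of the coefficients along a solution. -/
def stateCoeffsDot (c : ℝ × ℝ × ℝ) : Fin 5 → ℝ :=
  let p := c.1
  let x := c.2.1
  let y := c.2.2
  ![2 * p * areaD p x y, -4 * zIm p x y, -2 * areaD p x y - 4 * (x * zIm p x y + y * zRe p x y),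
    2 * areaD p x y - 4 * ((x ^ 2 - y ^ 2) * zIm p x y + 2 * x * y * zRe p x y),
    -4 * ((x ^ 3 - 3 * x * y ^ 2) * zIm p x y + (3 * x ^ 2 * y - y ^ 3) * zRe p x y)]

/-! ### The coefficients along a trajectory -/

variable {p x y : ℝ → ℝ} {t : ℝ}

theorem hasDerivAt_qq {x' y' : ℝ} (hx : HasDerivAt x x' t) (hy : HasDerivAt y y' t) :
    HasDerivAt (fun s => qq (x s) (y s))
      ((2 * x t * x' + 2 * y t * y') * ((x t + 1) ^ 2 + y t ^ 2)
        + (x t ^ 2 + y t ^ 2) * (2 * (x t + 1) * x' + 2 * y t * y')) t := by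
  have h := ((hx.pow 2).add (hy.pow 2)).mul (((hx.add_const 1).pow 2).add (hy.pow 2))
  refine h.congr_deriv ?_
  simp

/-- The volume of an orbit is proportional to D³, so this identifies 6p with the trace of the shape
operator. -/
theorem hasDerivAt_areaD (hp : HasDerivAt p (pDot (p t) (x t) (y t)) t)
    (hx : HasDerivAt x (xDot (p t) (x t) (y t)) t) (hy : HasDerivAt y (yDot (p t) (x t) (y t)) t)
    (h0 : 0 < y t) :
    HasDerivAt (fun s => areaD (p s) (x s) (y s)) (2 * p t * areaD (p t) (x t) (y t)) t := by
  have hq := hasDerivAt_qq hx hy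
  have hd := ((hy.pow 3).const_mul 4).mul ((hp.pow 2).const_add 1)
  have h1 : (4 * y t ^ 3 * (1 + p t ^ 2)) ≠ 0 := by positivity
  refine (hq.div hd h1).congr_deriv ?_
  have h2 : qq (x t) (y t) ≠ 0 := (qq_pos h0).ne'
  have h3 : (1 + p t ^ 2) ≠ 0 := by positivity
  simp only [areaD, pDot, xDot, yDot, shapeRatio, Pi.pow_apply, Pi.mul_apply]
  generalize p t = P at *
  generalize x t = X at *
  generalize y t = Y at *
  have h0' : Y ≠ 0 := h0.ne'
  field_simp
  simp only [aa, bb, cc, qq]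
  ring

theorem hasDerivAt_zRe (hp : HasDerivAt p (pDot (p t) (x t) (y t)) t)
    (hx : HasDerivAt x (xDot (p t) (x t) (y t)) t) (hy : HasDerivAt y (yDot (p t) (x t) (y t)) t)
    (h0 : 0 < y t) :
    HasDerivAt (fun s => zRe (p s) (x s) (y s)) (-4 * zIm (p t) (x t) (y t)) t := by
  have hq := hasDerivAt_qq hx hy
  have ha := ((hx.pow 2).add hx).sub (hy.pow 2)
  have hb := hy.mul ((hx.const_mul 2).add_const 1)
  have hd := ((hy.pow 6).const_mul 8).mul (((hp.pow 2).const_add 1).pow 2)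
  have h1 : (8 * y t ^ 6 * (1 + p t ^ 2) ^ 2) ≠ 0 := by positivity
  refine ((hq.mul (ha.sub (hb.mul hp))).div hd h1).congr_deriv ?_
  have h2 : qq (x t) (y t) ≠ 0 := (qq_pos h0).ne'
  have h3 : (1 + p t ^ 2) ≠ 0 := by positivity
  simp only [zIm, pDot, xDot, yDot, shapeRatio, Pi.pow_apply, Pi.mul_apply, Pi.add_apply,
    Pi.sub_apply]
  generalize p t = P at *
  generalize x t = X at *
  generalize y t = Y at *
  have h0' : Y ≠ 0 := h0.ne'
  field_simp
  simp only [aa, bb, cc, qq]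
  ring

/-- The nearly parallel equations involve derivatives of real parts only, but the product rule for
Re(Zτ^k) also needs that of Im Z. The two factors are the logarithmic derivative of |Z| =
(D/y)^{3/2} and the derivative of the phase of Z. -/
theorem hasDerivAt_zIm (hp : HasDerivAt p (pDot (p t) (x t) (y t)) t)
    (hx : HasDerivAt x (xDot (p t) (x t) (y t)) t) (hy : HasDerivAt y (yDot (p t) (x t) (y t)) t)
    (h0 : 0 < y t) :
    HasDerivAt (fun s => zIm (p s) (x s) (y s))
      (zIm (p t) (x t) (y t) * (3 * p t - 3 * yDot (p t) (x t) (y t) / (2 * y t))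
        + zRe (p t) (x t) (y t) * (1 + 3 * xDot (p t) (x t) (y t) / (2 * y t))) t := by
  have hq := hasDerivAt_qq hx hy
  have ha := ((hx.pow 2).add hx).sub (hy.pow 2)
  have hb := hy.mul ((hx.const_mul 2).add_const 1)
  have hd := ((hy.pow 6).const_mul 8).mul (((hp.pow 2).const_add 1).pow 2)
  have h1 : (8 * y t ^ 6 * (1 + p t ^ 2) ^ 2) ≠ 0 := by positivity
  refine ((hq.mul (hb.add (ha.mul hp))).neg.div hd h1).congr_deriv ?_
  have h2 : qq (x t) (y t) ≠ 0 := (qq_pos h0).ne'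
  have h3 : (1 + p t ^ 2) ≠ 0 := by positivity
  simp only [zIm, zRe, pDot, xDot, yDot, shapeRatio, Pi.pow_apply, Pi.mul_apply, Pi.add_apply,
    Pi.sub_apply, Pi.neg_apply]
  generalize p t = P at *
  generalize x t = X at *
  generalize y t = Y at *
  have h0' : Y ≠ 0 := h0.ne'
  field_simp
  simp only [aa, bb, cc, qq]
  ring

/-- This and the next two lemmas match Re((Zτ^k)') for k = 1, 2, 3, expanded by the product rule,
with the value demanded by the nearly parallel system. -/
theorem zDot_aux₁ {p x y : ℝ} (h0 : 0 < y) :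
    xDot p x y * zRe p x y + x * (-4 * zIm p x y) - (yDot p x y * zIm p x y
      + y * (zIm p x y * (3 * p - 3 * yDot p x y / (2 * y))
        + zRe p x y * (1 + 3 * xDot p x y / (2 * y))))
      = -2 * areaD p x y - 4 * (x * zIm p x y + y * zRe p x y) := by
  have h2 : qq x y ≠ 0 := (qq_pos h0).ne'
  have h3 : (1 + p ^ 2) ≠ 0 := by positivity
  have h0' : y ≠ 0 := h0.ne'
  simp only [areaD, zIm, zRe, xDot, yDot]
  field_simp
  simp only [aa, bb, cc, qq]
  ring

theorem zDot_aux₂ {p x y : ℝ} (h0 : 0 < y) :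
    (2 * x * xDot p x y - 2 * y * yDot p x y) * zRe p x y + (x ^ 2 - y ^ 2) * (-4 * zIm p x y)
      - (2 * (xDot p x y * y + x * yDot p x y) * zIm p x y
      + 2 * x * y * (zIm p x y * (3 * p - 3 * yDot p x y / (2 * y))
        + zRe p x y * (1 + 3 * xDot p x y / (2 * y))))
      = 2 * areaD p x y - 4 * ((x ^ 2 - y ^ 2) * zIm p x y + 2 * x * y * zRe p x y) := by
  have h2 : qq x y ≠ 0 := (qq_pos h0).ne'
  have h3 : (1 + p ^ 2) ≠ 0 := by positivity
  have h0' : y ≠ 0 := h0.ne'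
  simp only [areaD, zIm, zRe, xDot, yDot]
  field_simp
  simp only [aa, bb, cc, qq]
  ring

theorem zDot_aux₃ {p x y : ℝ} (h0 : 0 < y) :
    (3 * x ^ 2 * xDot p x y - 3 * (xDot p x y * y ^ 2 + x * (2 * y * yDot p x y))) * zRe p x y
      + (x ^ 3 - 3 * x * y ^ 2) * (-4 * zIm p x y)
      - ((3 * (2 * x * xDot p x y * y + x ^ 2 * yDot p x y) - 3 * y ^ 2 * yDot p x y) * zIm p x y
      + (3 * x ^ 2 * y - y ^ 3) * (zIm p x y * (3 * p - 3 * yDot p x y / (2 * y))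
        + zRe p x y * (1 + 3 * xDot p x y / (2 * y))))
      = -4 * ((x ^ 3 - 3 * x * y ^ 2) * zIm p x y + (3 * x ^ 2 * y - y ^ 3) * zRe p x y) := by
  have h2 : qq x y ≠ 0 := (qq_pos h0).ne'
  have h3 : (1 + p ^ 2) ≠ 0 := by positivity
  have h0' : y ≠ 0 := h0.ne'
  simp only [zIm, zRe, xDot, yDot]
  field_simp
  simp only [aa, bb, cc, qq]
  ring

theorem hasDerivAt_quadratic {x y r i : ℝ → ℝ} {t x' y' r' i' : ℝ} (hx : HasDerivAt x x' t)
    (hy : HasDerivAt y y' t) (hr : HasDerivAt r r' t) (hi : HasDerivAt i i' t) :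
    HasDerivAt (fun s => (x s ^ 2 - y s ^ 2) * r s - 2 * x s * y s * i s)
      ((2 * x t * x' - 2 * y t * y') * r t + (x t ^ 2 - y t ^ 2) * r'
        - (2 * (x' * y t + x t * y') * i t + 2 * x t * y t * i')) t := by
  refine ((((hx.pow 2).sub (hy.pow 2)).mul hr).sub
    (((hx.const_mul 2).mul hy).mul hi)).congr_deriv ?_
  simp only [Pi.sub_apply, Pi.pow_apply, Pi.mul_apply]
  push_cast
  ring

theorem hasDerivAt_cubic {x y r i : ℝ → ℝ} {t x' y' r' i' : ℝ} (hx : HasDerivAt x x' t)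
    (hy : HasDerivAt y y' t) (hr : HasDerivAt r r' t) (hi : HasDerivAt i i' t) :
    HasDerivAt (fun s => (x s ^ 3 - 3 * x s * y s ^ 2) * r s
        - (3 * x s ^ 2 * y s - y s ^ 3) * i s)
      ((3 * x t ^ 2 * x' - 3 * (x' * y t ^ 2 + x t * (2 * y t * y'))) * r t
        + (x t ^ 3 - 3 * x t * y t ^ 2) * r'
        - ((3 * (2 * x t * x' * y t + x t ^ 2 * y') - 3 * y t ^ 2 * y') * i t
        + (3 * x t ^ 2 * y t - y t ^ 3) * i')) t := by
  refine ((((hx.pow 3).sub ((hx.const_mul 3).mul (hy.pow 2))).mul hr).sub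
    (((((hx.pow 2).const_mul 3).mul hy).sub (hy.pow 3)).mul hi)).congr_deriv ?_
  simp only [Pi.sub_apply, Pi.pow_apply, Pi.mul_apply]
  push_cast
  ring

theorem hasDerivAt_triple {c : ℝ → ℝ × ℝ × ℝ} {t a b d : ℝ} (h : HasDerivAt c (a, b, d) t) :
    HasDerivAt (fun s => (c s).1) a t ∧ HasDerivAt (fun s => (c s).2.1) b t ∧
      HasDerivAt (fun s => (c s).2.2) d t := by
  have h' := hasDerivAt_iff_hasFDerivAt.1 h
  refine ⟨h'.fst.hasDerivAt.congr_deriv ?_, h'.snd.fst.hasDerivAt.congr_deriv ?_,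
    h'.snd.snd.hasDerivAt.congr_deriv ?_⟩ <;> simp

theorem hasDerivAt_stateCoeffs {c : ℝ → ℝ × ℝ × ℝ} (hc : HasDerivAt c (stateField (c t)) t)
    (h0 : 0 < (c t).2.2) :
    HasDerivAt (fun s => stateCoeffs (c s)) (stateCoeffsDot (c t)) t := by
  obtain ⟨p, hp', x, hx', y, hy', h⟩ : ∃ p : ℝ → ℝ, (p = fun s => (c s).1) ∧ ∃ x : ℝ → ℝ,
      (x = fun s => (c s).2.1) ∧ ∃ y : ℝ → ℝ, (y = fun s => (c s).2.2) ∧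
      c = fun s => (p s, x s, y s) := ⟨_, rfl, _, rfl, _, rfl, rfl⟩
  clear hp' hx' hy'
  subst h
  obtain ⟨hp, hx, hy⟩ := hasDerivAt_triple hc
  dsimp only at h0
  have hD := hasDerivAt_areaD hp hx hy h0
  have hr := hasDerivAt_zRe hp hx hy h0
  have hi := hasDerivAt_zIm hp hx hy h0
  have h1 := (hx.mul hr).sub (hy.mul hi)
  rw [zDot_aux₁ h0] at h1
  have h2 := hasDerivAt_quadratic hx hy hr hi
  rw [zDot_aux₂ h0] at h2
  have h3 := hasDerivAt_cubic hx hy hr hi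
  rw [zDot_aux₃ h0] at h3
  rw [hasDerivAt_pi]
  intro i
  fin_cases i
  · simpa only [stateCoeffs, stateCoeffsDot, Matrix.cons_val, Fin.zero_eta] using hD
  · simpa only [stateCoeffs, stateCoeffsDot, Matrix.cons_val, Fin.mk_one] using hr
  · simpa only [stateCoeffs, stateCoeffsDot, Matrix.cons_val, Fin.reduceFinMk] using! h1
  · simpa only [stateCoeffs, stateCoeffsDot, Matrix.cons_val, Fin.reduceFinMk] using h2
  · simpa only [stateCoeffs, stateCoeffsDot, Matrix.cons_val, Fin.reduceFinMk] using h3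

/-- The component of dφ = 4*φ without dt. It is the real part of Zτ(1+τ) = 2D²(1 − ip), the relation
from which the formulas for Z in terms of (p, x, y) are obtained. -/
theorem stateCoeffs_constraint {c : ℝ × ℝ × ℝ} (h0 : 0 < c.2.2) :
    stateCoeffs c 2 + stateCoeffs c 3 = 2 * stateCoeffs c 0 ^ 2 := by
  obtain ⟨p, x, y⟩ := c
  have h3 : (1 + p ^ 2) ≠ 0 := by positivity
  have h0' : y ≠ 0 := ne_of_gt h0
  simp only [stateCoeffs, areaD, zIm, zRe, Matrix.cons_val]
  field_simp
  simp only [aa, bb, qq]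
  ring

theorem areaD_pos {p x y : ℝ} (h0 : 0 < y) : 0 < areaD p x y := by
  have := qq_pos (x := x) h0
  unfold areaD
  positivity

/-- Since D = Im(ξ̄η) = |ξ|² y, this is |Z|² = |ξ|⁶. It is what makes the formula for D consistent
with Z being ξ³. -/
theorem zRe_sq_add_zIm_sq {p x y : ℝ} (h0 : 0 < y) :
    zRe p x y ^ 2 + zIm p x y ^ 2 = (areaD p x y / y) ^ 3 := by
  have h3 : (1 + p ^ 2) ≠ 0 := by positivity
  have h0' : y ≠ 0 := ne_of_gt h0
  simp only [areaD, zIm, zRe]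
  field_simp
  simp only [aa, bb, qq]
  ring

end ODE

/-! ### Adapted coordinates -/

/-- The coordinates `(dt, Re z_k, Im z_k)`, where `z_k = ξ x_k + η y_k`, `ξ = a + i b`,
`η = c + i d`. -/
def adaptedCoord (a b c d : ℝ) : (Fin 7 → ℝ) →ₗ[ℝ] (Fin 7 → ℝ) where
  toFun u := ![u 0, a * u 1 + c * u 2, b * u 1 + d * u 2, a * u 3 + c * u 4, b * u 3 + d * u 4,
    a * u 5 + c * u 6, b * u 5 + d * u 6]
  map_add' u v := by
    ext i
    fin_cases i <;> simp <;> ring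
  map_smul' r u := by
    ext i
    fin_cases i <;> simp <;> ring

theorem adaptedCoord_apply (a b c d : ℝ) (u : Fin 7 → ℝ) : adaptedCoord a b c d u =
    ![u 0, a * u 1 + c * u 2, b * u 1 + d * u 2, a * u 3 + c * u 4, b * u 3 + d * u 4,
      a * u 5 + c * u 6, b * u 5 + d * u 6] := rfl

theorem adaptedCoord_injective {a b c d : ℝ} (h : a * d - b * c ≠ 0) :
    Function.Injective (adaptedCoord a b c d) := by
  rw [injective_iff_map_eq_zero]
  intro u hu
  have key : ∀ s r : ℝ, a * s + c * r = 0 → b * s + d * r = 0 → s = 0 ∧ r = 0 := by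
    intro s r h1 h2
    constructor
    · have : (a * d - b * c) * s = 0 := by linear_combination d * h1 - c * h2
      simpa [h] using this
    · have : (a * d - b * c) * r = 0 := by linear_combination a * h2 - b * h1
      simpa [h] using this
  have hi := fun i => congrFun hu i
  have h12 := key (u 1) (u 2) (hi 1) (hi 2)
  have h34 := key (u 3) (u 4) (hi 3) (hi 4)
  have h56 := key (u 5) (u 6) (hi 5) (hi 6)
  ext i
  fin_cases i
  exacts [hi 0, h12.1, h12.2, h34.1, h34.2, h56.1, h56.2]

/-- The model form is dt∧ω + Re Ω, with ω and Ω the standard Hermitian form and complex volume form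
of ℂ³. Substituting z_k = ξ x_k + η y_k gives Im(ξ̄η) and the real parts of the cubic monomials in
ξ, η. -/
theorem phi0_adaptedCoord (a b c d : ℝ) (u v w : Fin 7 → ℝ) :
    phi0 (adaptedCoord a b c d u) (adaptedCoord a b c d v) (adaptedCoord a b c d w)
      = beta ![a * d - b * c, a ^ 3 - 3 * a * b ^ 2, (a ^ 2 - b ^ 2) * c - 2 * a * b * d,
          (c ^ 2 - d ^ 2) * a - 2 * c * d * b, c ^ 3 - 3 * c * d ^ 2] u v w := by
  simp only [phi0, beta, wedge3_expand, adaptedCoord_apply, Matrix.cons_val]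
  ring

/-- The dual form is ω²/2 − dt∧Im Ω, so the imaginary parts of the same monomials appear. -/
theorem psi0_adaptedCoord (a b c d : ℝ) (W : Fin 4 → Fin 7 → ℝ) :
    psi0 (fun i => adaptedCoord a b c d (W i))
      = (a * d - b * c) ^ 2 * (wedge4 1 2 3 4 W + wedge4 1 2 5 6 W + wedge4 3 4 5 6 W)
        - (3 * a ^ 2 * b - b ^ 3) * wedge4 0 1 3 5 W
        - ((a ^ 2 - b ^ 2) * d + 2 * a * b * c)
          * (wedge4 0 2 3 5 W + wedge4 0 1 4 5 W + wedge4 0 1 3 6 W)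
        - ((c ^ 2 - d ^ 2) * b + 2 * c * d * a)
          * (wedge4 0 1 4 6 W + wedge4 0 2 3 6 W + wedge4 0 2 4 5 W)
        - (3 * c ^ 2 * d - d ^ 3) * wedge4 0 2 4 6 W := by
  have hW : W = ![W 0, W 1, W 2, W 3] := by
    ext i
    fin_cases i <;> rfl
  have hW' : (fun i => adaptedCoord a b c d (W i)) = ![adaptedCoord a b c d (W 0),
      adaptedCoord a b c d (W 1), adaptedCoord a b c d (W 2), adaptedCoord a b c d (W 3)] := by
    ext i
    fin_cases i <;> rfl
  rw [hW', hW]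
  simp only [psi0, wedge4_laplace, wedge3_expand, adaptedCoord_apply, Matrix.cons_val]
  ring

end


noncomputable section

/-! ### Invariant nearly parallel structures -/

theorem norm_coe_sp1 (q : Sp1) : ‖(q : ℍ[ℝ])‖ = 1 := norm_eq_of_mem_sphere q

theorem star_coe_mul_coe (q : Sp1) : star (q : ℍ[ℝ]) * q = 1 := by
  rw [Quaternion.star_mul_self, Quaternion.normSq_eq_norm_mul_self, norm_coe_sp1]
  simp

theorem coe_inv_sp1 (q : Sp1) : ((q⁻¹ : Sp1) : ℍ[ℝ]) = star (q : ℍ[ℝ]) := by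
  have h : ((q⁻¹ : Sp1) : ℍ[ℝ]) * q = 1 := by
    rw [← Metric.unitSphere.coe_mul, inv_mul_cancel, Metric.unitSphere.coe_one]
  have h2 : (q : ℍ[ℝ]) * star (q : ℍ[ℝ]) = 1 := by
    rw [Quaternion.self_mul_star, Quaternion.normSq_eq_norm_mul_self, norm_coe_sp1]
    simp
  calc ((q⁻¹ : Sp1) : ℍ[ℝ]) = ((q⁻¹ : Sp1) : ℍ[ℝ]) * ((q : ℍ[ℝ]) * star (q : ℍ[ℝ])) := by
        rw [h2, mul_one]
    _ = star (q : ℍ[ℝ]) := by rw [← mul_assoc, h, one_mul]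

/-- The tangent space of the sphere is orthogonal to the position vector. -/
theorem re_star_mul_dIncl (p : Tube) (v : TangentSpace tubeModel p) :
    (star (p.2.1 : ℍ[ℝ]) * (dIncl p v).2.1).re = 0 ∧
      (star (p.2.2 : ℍ[ℝ]) * (dIncl p v).2.2).re = 0 := by
  have hfun : ∀ g : Amb → ℝ, ContDiff ℝ ∞ g → (∀ p, g (tubeIncl p) = 1) →
      fderiv ℝ g (tubeIncl p) (dIncl p v) = 0 := by
    intro g hg h1
    have hc := mfderiv_comp p (I'' := 𝓘(ℝ, ℝ))
      ((hg.contMDiff (tubeIncl p)).mdifferentiableAt (by simp)) (mdifferentiableAt_tubeIncl p)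
    have h2 : g ∘ tubeIncl = fun _ => 1 := funext h1
    rw [h2, mfderiv_const] at hc
    have := DFunLike.congr_fun hc v
    rw [mfderiv_eq_fderiv] at this
    exact this.symm
  have hn : ∀ q : Sp1, inner ℝ (q : ℍ[ℝ]) (q : ℍ[ℝ]) = (1 : ℝ) := fun q => by
    rw [real_inner_self_eq_norm_sq, norm_coe_sp1, one_pow]
  have hre : ∀ a b : ℍ[ℝ], (star a * b).re = inner ℝ a b := fun a b => by
    rw [Quaternion.inner_def]
    simp
  have hd1 : HasFDerivAt (fun z : Amb => z.2.1)
      (ContinuousLinearMap.fst ℝ ℍ[ℝ] ℍ[ℝ] ∘L ContinuousLinearMap.snd ℝ ℝ (ℍ[ℝ] × ℍ[ℝ]))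
      (tubeIncl p) := ContinuousLinearMap.hasFDerivAt (ContinuousLinearMap.fst ℝ ℍ[ℝ] ℍ[ℝ] ∘L
        ContinuousLinearMap.snd ℝ ℝ (ℍ[ℝ] × ℍ[ℝ]))
  have hd2 : HasFDerivAt (fun z : Amb => z.2.2)
      (ContinuousLinearMap.snd ℝ ℍ[ℝ] ℍ[ℝ] ∘L ContinuousLinearMap.snd ℝ ℝ (ℍ[ℝ] × ℍ[ℝ]))
      (tubeIncl p) := ContinuousLinearMap.hasFDerivAt (ContinuousLinearMap.snd ℝ ℍ[ℝ] ℍ[ℝ] ∘L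
        ContinuousLinearMap.snd ℝ ℝ (ℍ[ℝ] × ℍ[ℝ]))
  have h1 := hfun (fun z => inner ℝ z.2.1 z.2.1) (ContDiff.inner ℝ (by fun_prop) (by fun_prop))
    fun p => hn p.2.1
  have h2 := hfun (fun z => inner ℝ z.2.2 z.2.2) (ContDiff.inner ℝ (by fun_prop) (by fun_prop))
    fun p => hn p.2.2
  rw [(hd1.inner ℝ hd1).fderiv] at h1
  rw [(hd2.inner ℝ hd2).fderiv] at h2
  simp [real_inner_comm] at h1 h2
  rw [hre, hre]
  exact ⟨h1, h2⟩

theorem mcCoord_dIncl_injective (p : Tube) :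
    Function.Injective fun v : TangentSpace tubeModel p => mcCoord (tubeIncl p) (dIncl p v) := by
  have hl : ∀ v : TangentSpace tubeModel p, mcCoord (tubeIncl p) (dIncl p v) = 0 → v = 0 := by
    intro v hv
    obtain ⟨h1, h2⟩ := re_star_mul_dIncl p v
    have hi := fun i => congrFun hv i
    have e1 : star (p.2.1 : ℍ[ℝ]) * (dIncl p v).2.1 = 0 := by
      ext
      exacts [h1, hi 1, hi 3, hi 5]
    have e2 : star (p.2.2 : ℍ[ℝ]) * (dIncl p v).2.2 = 0 := by
      ext
      exacts [h2, hi 2, hi 4, hi 6]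
    have n1 : star (p.2.1 : ℍ[ℝ]) ≠ 0 := star_ne_zero.2 (ne_zero_of_mem_unit_sphere p.2.1)
    have n2 : star (p.2.2 : ℍ[ℝ]) ≠ 0 := star_ne_zero.2 (ne_zero_of_mem_unit_sphere p.2.2)
    apply dIncl_injective p
    rw [map_zero]
    exact Prod.ext (hi 0) (Prod.ext ((mul_eq_zero.1 e1).resolve_left n1)
      ((mul_eq_zero.1 e2).resolve_left n2))
  intro v w h
  rw [← sub_eq_zero]
  apply hl
  rw [map_sub, map_sub]
  exact sub_eq_zero.2 h

theorem finrank_tangentSpace_tube (p : Tube) :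
    Module.finrank ℝ (TangentSpace tubeModel p) = 7 := by
  change Module.finrank ℝ (ℝ × EuclideanSpace ℝ (Fin 3) × EuclideanSpace ℝ (Fin 3)) = 7
  simp

/-- The frame dual to the coframe `adaptedCoord`. -/
def adaptedBasis (p : Tube) {a b c d : ℝ} (h : a * d - b * c ≠ 0) :
    Module.Basis (Fin 7) ℝ (TangentSpace tubeModel p) :=
  Module.Basis.ofEquivFun (LinearEquiv.ofInjectiveOfFinrankEq
    (adaptedCoord a b c d ∘ₗ (mcCoord (tubeIncl p)).toLinearMap ∘ₗ (dIncl p).toLinearMap)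
    ((adaptedCoord_injective h).comp (mcCoord_dIncl_injective p))
    (by rw [finrank_tangentSpace_tube]; simp))

theorem adaptedBasis_equivFun (p : Tube) {a b c d : ℝ} (h : a * d - b * c ≠ 0)
    (v : TangentSpace tubeModel p) : (adaptedBasis p h).equivFun v
      = adaptedCoord a b c d (mcCoord (tubeIncl p) (dIncl p v)) := by
  rw [adaptedBasis, Module.Basis.equivFun_ofEquivFun]
  rfl

theorem isAdapted_adaptedBasis {f : ℝ → Fin 5 → ℝ} (p : Tube) {a b c d : ℝ}
    (h : a * d - b * c ≠ 0)
    (hf : f p.1 = ![a * d - b * c, a ^ 3 - 3 * a * b ^ 2, (a ^ 2 - b ^ 2) * c - 2 * a * b * d,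
          (c ^ 2 - d ^ 2) * a - 2 * c * d * b, c ^ 3 - 3 * c * d ^ 2]) :
    IsAdapted (tubeForm f p) (adaptedBasis p h) := by
  intro u v w
  simp only [adaptedBasis_equivFun, phi0_adaptedCoord]
  rw [← hf]
  exact ambForm_apply f (tubeIncl p) _

/-- Here a + ib = ξ is a complex cube root of Z and e + id = τξ. The statement concerns a single
state, so any of the three roots will do and no continuous branch is needed. -/
theorem exists_adapted_numbers (c : ℝ × ℝ × ℝ) (h0 : 0 < c.2.2) : ∃ a b e d : ℝ,
    a * d - b * e = stateCoeffs c 0 ∧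
    stateCoeffs c = ![a * d - b * e, a ^ 3 - 3 * a * b ^ 2, (a ^ 2 - b ^ 2) * e - 2 * a * b * d,
          (e ^ 2 - d ^ 2) * a - 2 * e * d * b, e ^ 3 - 3 * e * d ^ 2] ∧
    stateCoeffsDot c = ![2 * c.1 * stateCoeffs c 0, -4 * (3 * a ^ 2 * b - b ^ 3),
      -2 * stateCoeffs c 0 - 4 * ((a ^ 2 - b ^ 2) * d + 2 * a * b * e),
      2 * stateCoeffs c 0 - 4 * ((e ^ 2 - d ^ 2) * b + 2 * e * d * a),
      -4 * (3 * e ^ 2 * d - d ^ 3)] ∧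
    e = a * c.2.1 - b * c.2.2 ∧ d = b * c.2.1 + a * c.2.2 ∧
    a ^ 2 + b ^ 2 = areaD c.1 c.2.1 c.2.2 / c.2.2 := by
  obtain ⟨p, x, y⟩ := c
  dsimp only at h0
  obtain ⟨ξ, hξ⟩ := IsAlgClosed.exists_pow_nat_eq (⟨zRe p x y, zIm p x y⟩ : ℂ)
    (n := 3) (by norm_num)
  have hre : ξ.re ^ 3 - 3 * ξ.re * ξ.im ^ 2 = zRe p x y := by
    have := congrArg Complex.re hξ
    simp [pow_succ] at this
    linarith
  have him : 3 * ξ.re ^ 2 * ξ.im - ξ.im ^ 3 = zIm p x y := by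
    have := congrArg Complex.im hξ
    simp [pow_succ] at this
    linarith
  have hn : ξ.re ^ 2 + ξ.im ^ 2 = areaD p x y / y := by
    have h1 : (ξ.re ^ 2 + ξ.im ^ 2) ^ 3 = (areaD p x y / y) ^ 3 := by
      rw [← zRe_sq_add_zIm_sq h0, ← hre, ← him]
      ring
    have h2 : 0 < areaD p x y / y := div_pos (areaD_pos h0) h0
    exact (pow_left_inj₀ (by positivity) h2.le (by norm_num)).1 h1
  have hD : ξ.re * (ξ.im * x + ξ.re * y) - ξ.im * (ξ.re * x - ξ.im * y) = areaD p x y := by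
    have : areaD p x y = areaD p x y / y * y := by field_simp
    rw [this, ← hn]
    ring
  refine ⟨ξ.re, ξ.im, ξ.re * x - ξ.im * y, ξ.im * x + ξ.re * y, ?_, ?_, ?_, rfl, rfl, hn⟩
  · simpa only [stateCoeffs, Matrix.cons_val] using hD
  · rw [hD]
    simp only [stateCoeffs, ← hre, ← him]
    ext i
    fin_cases i <;> simp <;> ring
  · simp only [stateCoeffsDot, stateCoeffs, ← hre, ← him, Matrix.cons_val]
    ext i
    fin_cases i <;> simp <;> ring

/-- `c` solves the ordinary differential equation on `J`, with values in the half space. -/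
structure IsSolution (c : ℝ → ℝ × ℝ × ℝ) (J : Set ℝ) : Prop where
  isOpen : IsOpen J
  deriv : ∀ t ∈ J, HasDerivAt c (stateField (c t)) t
  pos : ∀ t ∈ J, 0 < (c t).2.2
  smooth : ContDiffOn ℝ ∞ c J

/-- The form belonging to a solution. -/
def solutionForm (c : ℝ → ℝ × ℝ × ℝ) : TubeForm := tubeForm fun t => stateCoeffs (c t)

theorem contDiffOn_stateCoeffs : ContDiffOn ℝ ∞ stateCoeffs {c : ℝ × ℝ × ℝ | 0 < c.2.2} := by
  have hx : ContDiff ℝ ∞ fun c : ℝ × ℝ × ℝ => c.2.1 := by fun_prop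
  have hp : ContDiff ℝ ∞ fun c : ℝ × ℝ × ℝ => c.1 := by fun_prop
  have hy : ContDiff ℝ ∞ fun c : ℝ × ℝ × ℝ => c.2.2 := by fun_prop
  have hD : ContDiffOn ℝ ∞ (fun c : ℝ × ℝ × ℝ => areaD c.1 c.2.1 c.2.2) {c | 0 < c.2.2} := by
    unfold areaD qq
    refine ContDiffOn.div (by fun_prop) (by fun_prop) fun c (hc : 0 < c.2.2) => ?_
    positivity
  have hr : ContDiffOn ℝ ∞ (fun c : ℝ × ℝ × ℝ => zRe c.1 c.2.1 c.2.2) {c | 0 < c.2.2} := by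
    unfold zRe qq aa bb
    refine ContDiffOn.div (by fun_prop) (by fun_prop) fun c (hc : 0 < c.2.2) => ?_
    positivity
  have hi : ContDiffOn ℝ ∞ (fun c : ℝ × ℝ × ℝ => zIm c.1 c.2.1 c.2.2) {c | 0 < c.2.2} := by
    unfold zIm qq aa bb
    refine ContDiffOn.div (by fun_prop) (by fun_prop) fun c (hc : 0 < c.2.2) => ?_
    positivity
  rw [contDiffOn_pi]
  intro i
  fin_cases i <;> simp only [stateCoeffs, Matrix.cons_val, Fin.zero_eta, Fin.mk_one,
    Fin.reduceFinMk] <;> fun_prop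

theorem IsSolution.smooth_stateCoeffs {c : ℝ → ℝ × ℝ × ℝ} {J : Set ℝ} (hc : IsSolution c J) :
    ContDiffOn ℝ ∞ (fun t => stateCoeffs (c t)) J :=
  contDiffOn_stateCoeffs.comp hc.smooth hc.pos

theorem IsSolution.isNearlyParallel {c : ℝ → ℝ × ℝ × ℝ} {J : Set ℝ} (hc : IsSolution c J) :
    IsNearlyParallel tubeModel 4 (solutionForm c) (tubeOver J) := by
  refine ⟨by norm_num, smoothOn_tubeForm hc.smooth_stateCoeffs, fun p hp => ?_⟩
  have hpJ : p.1 ∈ J := hp.1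
  have hpos := hc.pos _ hpJ
  obtain ⟨a, b, e, d, hD, hf, hf', -⟩ := exists_adapted_numbers (c p.1) hpos
  have hne : a * d - b * e ≠ 0 := by
    rw [hD]
    exact (areaD_pos hpos).ne'
  have had := isAdapted_adaptedBasis (f := fun t => stateCoeffs (c t)) p hne hf
  refine ⟨adaptedBasis p hne, had, fun w => ?_⟩
  change _ = 4 * hodgeStar (adaptedBasis p hne) (tubeForm (fun t => stateCoeffs (c t)) p) w
  rw [hodgeStar_of_isAdapted _ _ had]
  simp only [adaptedBasis_equivFun, psi0_adaptedCoord]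
  have hd := differentiableAt_ambForm hc.isOpen hc.smooth_stateCoeffs (z := tubeIncl p) hpJ
  have h1 : DForm.d tubeModel (solutionForm c) p = _ := d_restrictForm hd
  rw [h1]
  change extDeriv (ambForm fun t => stateCoeffs (c t)) (tubeIncl p) (fun i => dIncl p (w i)) = _
  rw [extDeriv_ambForm (fun i => dIncl p (w i)) hd
    (hasDerivAt_stateCoeffs (hc.deriv _ hpJ) hpos) (norm_coe_sp1 _) (norm_coe_sp1 _)
    (fun i => (re_star_mul_dIncl p (w i)).1) (fun i => (re_star_mul_dIncl p (w i)).2)]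
  -- The four components containing dt hold by the formula for `stateCoeffsDot`; the remaining one
  -- is this constraint.
  have hcon := stateCoeffs_constraint hpos
  change dBeta (stateCoeffs (c p.1)) (stateCoeffsDot (c p.1)) _ = _
  rw [dBeta, hf', hcon, hD]
  simp only [Matrix.cons_val]
  ring

/-! ### Invariance -/

/-- For imaginary quaternions the inner product is −Re(ab) and the triple product is −Re(abc). Both
are unchanged when all arguments are conjugated by one unit quaternion, which gives the invariance
of the form. -/
theorem beta_eq_quaternion (f : Fin 5 → ℝ) (t : Fin 3 → ℝ) (a b : Fin 3 → ℍ[ℝ])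
    (ha : ∀ i, (a i).re = 0) (hb : ∀ i, (b i).re = 0) (u : Fin 3 → Fin 7 → ℝ)
    (hu : ∀ i, u i = ![t i, (a i).imI, (b i).imI, (a i).imJ, (b i).imJ, (a i).imK, (b i).imK]) :
    beta f (u 0) (u 1) (u 2) =
      f 0 * (t 0 * ((b 1 * a 2).re - (a 1 * b 2).re) - t 1 * ((b 0 * a 2).re - (a 0 * b 2).re)
        + t 2 * ((b 0 * a 1).re - (a 0 * b 1).re))
      - f 1 * (a 0 * a 1 * a 2).re
      - f 2 * ((b 0 * a 1 * a 2).re + (a 0 * b 1 * a 2).re + (a 0 * a 1 * b 2).re)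
      - f 3 * ((a 0 * b 1 * b 2).re + (b 0 * a 1 * b 2).re + (b 0 * b 1 * a 2).re)
      - f 4 * (b 0 * b 1 * b 2).re := by
  simp only [beta, wedge3_expand, hu, Matrix.cons_val, Quaternion.re_mul, Quaternion.imI_mul,
    Quaternion.imJ_mul, Quaternion.imK_mul, ha, hb]
  ring

/-- The linear map of the ambient space that induces the action of `q`. -/
def ambAct (q : GG) : Amb →L[ℝ] Amb :=
  LinearMap.toContinuousLinearMap
    { toFun := fun z => (z.1, q.1 * z.2.1 * star (q.2.2 : ℍ[ℝ]),
        q.2.1 * z.2.2 * star (q.2.2 : ℍ[ℝ]))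
      map_add' := fun v w => by simp [mul_add, add_mul]
      map_smul' := fun c v => by simp }

theorem ambAct_apply (q : GG) (z : Amb) : ambAct q z =
    (z.1, q.1 * z.2.1 * star (q.2.2 : ℍ[ℝ]), q.2.1 * z.2.2 * star (q.2.2 : ℍ[ℝ])) := rfl

theorem tubeIncl_tubeAct (q : GG) (p : Tube) : tubeIncl (tubeAct q p) = ambAct q (tubeIncl p) := by
  simp only [tubeIncl, tubeAct, orbitAct, ambAct_apply, Metric.unitSphere.coe_mul, coe_inv_sp1]

theorem contMDiff_of_tubeIncl_comp {E : Type*} [NormedAddCommGroup E] [NormedSpace ℝ E] {H : Type*}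
    [TopologicalSpace H] {I : ModelWithCorners ℝ E H} {M : Type*} [TopologicalSpace M]
    [ChartedSpace H M] {g : M → Tube} {x : M}
    (h : ContMDiffAt I 𝓘(ℝ, Amb) ∞ (tubeIncl ∘ g) x) : ContMDiffAt I tubeModel ∞ g x := by
  have h1 : g = tubeProj ∘ (tubeIncl ∘ g) := funext fun y => (tubeProj_tubeIncl (g y)).symm
  rw [h1]
  exact (contMDiffAt_tubeProj (tubeIncl_mem_punctured (g x))).comp x h

theorem contMDiff_tubeAct (q : GG) : ContMDiff tubeModel tubeModel ∞ (tubeAct q) := by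
  intro p
  apply contMDiff_of_tubeIncl_comp
  have h : tubeIncl ∘ tubeAct q = ambAct q ∘ tubeIncl := funext (tubeIncl_tubeAct q)
  rw [h]
  exact ((ambAct q).contDiff.contMDiff (n := ∞)).contMDiffAt.comp p (contMDiff_tubeIncl p)

theorem dIncl_mfderiv_tubeAct (q : GG) (p : Tube) (v : TangentSpace tubeModel p) :
    dIncl (tubeAct q p) (mfderiv tubeModel tubeModel (tubeAct q) p v) = ambAct q (dIncl p v) := by
  have h1 := mfderiv_comp p (mdifferentiableAt_tubeIncl (tubeAct q p))
    ((contMDiff_tubeAct q p).mdifferentiableAt (by simp))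
  have h2 := mfderiv_comp p (I'' := 𝓘(ℝ, Amb)) (g := ambAct q)
    (((ambAct q).contDiff.contMDiff (n := ∞)).contMDiffAt.mdifferentiableAt (by simp))
    (mdifferentiableAt_tubeIncl p)
  have h : tubeIncl ∘ tubeAct q = ambAct q ∘ tubeIncl := funext (tubeIncl_tubeAct q)
  rw [h, h2] at h1
  have h3 := DFunLike.congr_fun h1 v
  rw [mfderiv_eq_fderiv, ContinuousLinearMap.fderiv] at h3
  exact h3.symm

theorem re_conj {q : Sp1} (a : ℍ[ℝ]) : ((q : ℍ[ℝ]) * a * star (q : ℍ[ℝ])).re = a.re := by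
  have h := Quaternion.normSq_eq_norm_mul_self (q : ℍ[ℝ])
  rw [norm_coe_sp1, Quaternion.normSq_def'] at h
  simp
  linear_combination a.re * h

theorem conj_mul_conj (q : Sp1) (a b : ℍ[ℝ]) : ((q : ℍ[ℝ]) * a * star (q : ℍ[ℝ])) *
    ((q : ℍ[ℝ]) * b * star (q : ℍ[ℝ])) = (q : ℍ[ℝ]) * (a * b) * star (q : ℍ[ℝ]) := by
  have h := star_coe_mul_coe q
  calc ((q : ℍ[ℝ]) * a * star (q : ℍ[ℝ])) * ((q : ℍ[ℝ]) * b * star (q : ℍ[ℝ]))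
      = (q : ℍ[ℝ]) * a * (star (q : ℍ[ℝ]) * q) * b * star (q : ℍ[ℝ]) := by
        simp only [mul_assoc]
    _ = (q : ℍ[ℝ]) * (a * b) * star (q : ℍ[ℝ]) := by rw [h, mul_one]; simp only [mul_assoc]

theorem star_act_mul (q r : Sp1) (a b : ℍ[ℝ]) :
    star ((r : ℍ[ℝ]) * a * star (q : ℍ[ℝ])) * ((r : ℍ[ℝ]) * b * star (q : ℍ[ℝ]))
      = (q : ℍ[ℝ]) * (star a * b) * star (q : ℍ[ℝ]) := by
  have h := star_coe_mul_coe r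
  rw [star_mul, star_mul, star_star]
  calc (q : ℍ[ℝ]) * (star a * star (r : ℍ[ℝ])) * ((r : ℍ[ℝ]) * b * star (q : ℍ[ℝ]))
      = (q : ℍ[ℝ]) * star a * (star (r : ℍ[ℝ]) * r) * b * star (q : ℍ[ℝ]) := by
        simp only [mul_assoc]
    _ = (q : ℍ[ℝ]) * (star a * b) * star (q : ℍ[ℝ]) := by rw [h, mul_one]; simp only [mul_assoc]

/-- In p̄u the left factors q₁, q₂ cancel, and q₃ acts by simultaneous conjugation. -/
theorem isGInvariant_tubeForm (f : ℝ → Fin 5 → ℝ) (J : Set ℝ) : IsGInvariant (tubeForm f) J := by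
  intro q p _
  ext v
  change ambForm f (tubeIncl (tubeAct q p)) (fun i => dIncl (tubeAct q p)
    (mfderiv tubeModel tubeModel (tubeAct q) p (v i))) = ambForm f (tubeIncl p)
      (fun i => dIncl p (v i))
  simp only [dIncl_mfderiv_tubeAct, tubeIncl_tubeAct]
  have hr := fun i => re_star_mul_dIncl p (v i)
  rw [ambForm_apply, ambForm_apply]
  have e1 := beta_eq_quaternion (f p.1) (fun i => (dIncl p (v i)).1)
    (fun i => star (p.2.1 : ℍ[ℝ]) * (dIncl p (v i)).2.1)
    (fun i => star (p.2.2 : ℍ[ℝ]) * (dIncl p (v i)).2.2) (fun i => (hr i).1) (fun i => (hr i).2)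
    (fun i => mcCoord (tubeIncl p) (dIncl p (v i))) fun i => rfl
  have e2 := beta_eq_quaternion (f p.1) (fun i => (dIncl p (v i)).1)
    (fun i => q.2.2 * (star (p.2.1 : ℍ[ℝ]) * (dIncl p (v i)).2.1) * star (q.2.2 : ℍ[ℝ]))
    (fun i => q.2.2 * (star (p.2.2 : ℍ[ℝ]) * (dIncl p (v i)).2.2) * star (q.2.2 : ℍ[ℝ]))
    (fun i => by rw [re_conj]; exact (hr i).1) (fun i => by rw [re_conj]; exact (hr i).2)
    (fun i => mcCoord (ambAct q (tubeIncl p)) (ambAct q (dIncl p (v i)))) fun i => by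
      have m1 := star_act_mul q.2.2 q.1 p.2.1 (dIncl p (v i)).2.1
      have m2 := star_act_mul q.2.2 q.2.1 p.2.2 (dIncl p (v i)).2.2
      simp only [mcCoord_apply, ambAct_apply, tubeIncl, m1, m2]
  simp only [conj_mul_conj, re_conj] at e2
  exact e2.trans e1.symm

/-! ### The frame along `γ` -/

theorem dIncl_mfderiv_curve {g : ℝ → Tube} {s : ℝ} {w : Amb} {p : Tube} (hp : g s = p)
    (hs : ContDiffAt ℝ ∞ (fun t => tubeIncl (g t)) s)
    (h : HasDerivAt (fun t => tubeIncl (g t)) w s) :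
    dIncl p (show TangentSpace tubeModel p from mfderiv 𝓘(ℝ, ℝ) tubeModel g s (1 : ℝ)) = w := by
  subst hp
  have hg : ContMDiffAt 𝓘(ℝ, ℝ) tubeModel ∞ g s := contMDiff_of_tubeIncl_comp hs.contMDiffAt
  have h1 := mfderiv_comp s (mdifferentiableAt_tubeIncl (g s)) (hg.mdifferentiableAt (by simp))
  have h2 := DFunLike.congr_fun h1 (1 : ℝ)
  rw [mfderiv_eq_fderiv] at h2
  refine h2.symm.trans ?_
  exact h.deriv

theorem dIncl_frameT (t : ℝ) : dIncl (gammaCurve t) (frameT t) = (1, 0, 0) := by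
  have h : (fun s => tubeIncl (gammaCurve s)) = fun s : ℝ => ((s, 1, 1) : Amb) := by
    ext1 s
    simp [tubeIncl, gammaCurve]
  refine dIncl_mfderiv_curve rfl ?_ ?_
  · rw [h]
    fun_prop
  · rw [h]
    exact (hasDerivAt_id t).prodMk ((hasDerivAt_const t (1 : ℍ[ℝ])).prodMk
      (hasDerivAt_const t (1 : ℍ[ℝ])))

theorem coe_expSp1 (x : ℍ[ℝ]) : (expSp1 x : ℍ[ℝ]) = NormedSpace.exp x.im := rfl

theorem dIncl_inducedVector (X : ℍ[ℝ] × ℍ[ℝ] × ℍ[ℝ]) (t : ℝ) :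
    dIncl (gammaCurve t) (inducedVector X (gammaCurve t))
      = (0, X.1.im - X.2.2.im, X.2.1.im - X.2.2.im) := by
  have him : ∀ (s : ℝ) (x : ℍ[ℝ]), (s • x).im = s • x.im := fun s x => by ext <;> simp
  have hstar : ∀ (s : ℝ) (x : ℍ[ℝ]), star (NormedSpace.exp (s • x.im))
      = NormedSpace.exp (s • (-x.im)) := by
    intro s x
    rw [NormedSpace.star_exp]
    congr 1
    ext <;> simp
  have h : (fun s : ℝ => tubeIncl (tubeAct (expSp1 (s • X.1), expSp1 (s • X.2.1),
      expSp1 (s • X.2.2)) (gammaCurve t))) = fun s : ℝ => ((t,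
        NormedSpace.exp (s • X.1.im) * NormedSpace.exp (s • (-X.2.2.im)),
        NormedSpace.exp (s • X.2.1.im) * NormedSpace.exp (s • (-X.2.2.im))) : Amb) := by
    ext1 s
    rw [tubeIncl_tubeAct]
    simp [ambAct_apply, tubeIncl, gammaCurve, coe_expSp1, him, hstar]
  have hz : tubeAct (expSp1 ((0 : ℝ) • X.1), expSp1 ((0 : ℝ) • X.2.1), expSp1 ((0 : ℝ) • X.2.2))
      (gammaCurve t) = gammaCurve t := by
    have h1 : expSp1 0 = 1 := by
      ext1
      simp [coe_expSp1]
    have h2 : ((1, 1, 1) : GG) = 1 := rfl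
    simp only [zero_smul, h1, h2, tubeAct, orbitAct_one]
  have hexp : ∀ x : ℍ[ℝ], HasDerivAt (fun s : ℝ => NormedSpace.exp (s • x)) x 0 := by
    intro x
    simpa using hasDerivAt_exp_smul_const x (0 : ℝ)
  have hmul : ∀ x y : ℍ[ℝ], HasDerivAt (fun s : ℝ => NormedSpace.exp (s • x) *
      NormedSpace.exp (s • (-y))) (x - y) 0 := by
    intro x y
    refine ((hexp x).mul (hexp (-y))).congr_deriv ?_
    simp [sub_eq_add_neg]
  have hsm : ∀ x : ℍ[ℝ], ContDiff ℝ ∞ (fun s : ℝ => NormedSpace.exp (s • x)) := fun x =>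
    (contDiff_iff_contDiffAt.2 fun y => (NormedSpace.exp_analytic (𝕂 := ℝ) y).contDiffAt).comp
      (by fun_prop : ContDiff ℝ ∞ fun s : ℝ => s • x)
  exact dIncl_mfderiv_curve (g := fun s : ℝ => tubeAct (expSp1 (s • X.1),
    expSp1 (s • X.2.1), expSp1 (s • X.2.2)) (gammaCurve t)) (s := 0)
    (w := (0, X.1.im - X.2.2.im, X.2.1.im - X.2.2.im)) hz (by
      rw [h]
      exact (contDiff_const.prodMk (((hsm _).mul (hsm _)).prodMk
        ((hsm _).mul (hsm _)))).contDiffAt) (by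
      rw [h]
      exact (hasDerivAt_const (0 : ℝ) t).prodMk ((hmul _ _).prodMk (hmul _ _)))

theorem mcCoord_gammaCurve (t r : ℝ) (u v : ℍ[ℝ]) :
    mcCoord (tubeIncl (gammaCurve t)) (r, u, v) = ![r, u.imI, v.imI, u.imJ, v.imJ, u.imK, v.imK] := by
  simp [mcCoord_apply, tubeIncl, gammaCurve]

/-- At the base point X ∈ sp(1)³ induces (X₁ − X₃, X₂ − X₃). Thus e₂, e₃, e₄ are −3 times the basis
of the second sphere and e₅, e₆, e₇ are −3 times that of the first. This explains the factors 9 and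
27, the sign of the first coefficient and the reversed order of the others. -/
theorem coeffs_tubeForm (f : ℝ → Fin 5 → ℝ) (t : ℝ) :
    coeffs (tubeForm f) t = ![-9 * f t 0, -27 * f t 4, -27 * f t 1, -27 * f t 3, -27 * f t 2] := by
  have h : ∀ u v w : TangentSpace tubeModel (gammaCurve t),
      tubeForm f (gammaCurve t) ![u, v, w]
      = beta (f t) (mcCoord (tubeIncl (gammaCurve t)) (dIncl (gammaCurve t) u))
        (mcCoord (tubeIncl (gammaCurve t)) (dIncl (gammaCurve t) v))
        (mcCoord (tubeIncl (gammaCurve t)) (dIncl (gammaCurve t) w)) := fun u v w =>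
    ambForm_apply f (tubeIncl (gammaCurve t)) _
  simp only [coeffs, h, framePlus, frameMinus, dIncl_frameT, dIncl_inducedVector,
    mcCoord_gammaCurve]
  have hI : ∀ (r : ℝ) (n : Fin 3), ((r • sp1Basis n).im).imI = r * (sp1Basis n).imI := fun _ _ => rfl
  have hJ : ∀ (r : ℝ) (n : Fin 3), ((r • sp1Basis n).im).imJ = r * (sp1Basis n).imJ := fun _ _ => rfl
  have hK : ∀ (r : ℝ) (n : Fin 3), ((r • sp1Basis n).im).imK = r * (sp1Basis n).imK := fun _ _ => rfl
  have hI' : ∀ n : Fin 3, ((sp1Basis n).im).imI = (sp1Basis n).imI := fun _ => rfl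
  have hJ' : ∀ n : Fin 3, ((sp1Basis n).im).imJ = (sp1Basis n).imJ := fun _ => rfl
  have hK' : ∀ n : Fin 3, ((sp1Basis n).im).imK = (sp1Basis n).imK := fun _ => rfl
  have hbI : ∀ n : Fin 3, (sp1Basis n).imI = ![1, 0, 0] n := fun n => by fin_cases n <;> rfl
  have hbJ : ∀ n : Fin 3, (sp1Basis n).imJ = ![0, 1, 0] n := fun n => by fin_cases n <;> rfl
  have hbK : ∀ n : Fin 3, (sp1Basis n).imK = ![0, 0, 1] n := fun n => by fin_cases n <;> rfl
  simp only [beta, wedge3_expand, Matrix.cons_val, Quaternion.imI_sub, Quaternion.imJ_sub,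
    Quaternion.imK_sub, hI, hJ, hK, hI', hJ', hK', hbI, hbJ, hbK, Quaternion.imI_zero,
    Quaternion.imJ_zero, Quaternion.imK_zero]
  ext i
  fin_cases i <;> simp <;> ring

theorem IsSolution.isArcLength {c : ℝ → ℝ × ℝ × ℝ} {J : Set ℝ} (hc : IsSolution c J) :
    IsArcLength (solutionForm c) J := by
  intro t ht
  have hpos := hc.pos _ ht
  obtain ⟨a, b, e, d, hD, hf, -⟩ := exists_adapted_numbers (c t) hpos
  have hne : a * d - b * e ≠ 0 := by
    rw [hD]
    exact (areaD_pos hpos).ne'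
  refine ⟨adaptedBasis (gammaCurve t) hne,
    isAdapted_adaptedBasis (f := fun t => stateCoeffs (c t)) (gammaCurve t) hne hf, ?_⟩
  simp only [frameMetric, adaptedBasis_equivFun, dIncl_frameT, mcCoord_gammaCurve,
    adaptedCoord_apply]
  simp [Fin.sum_univ_succ]

end


noncomputable section

/-! ### The family of solutions -/

theorem contDiffOn_stateField : ContDiffOn ℝ ∞ stateField {c : ℝ × ℝ × ℝ | 0 < c.2.2} := by
  have hq : ∀ c ∈ {c : ℝ × ℝ × ℝ | 0 < c.2.2}, qq c.2.1 c.2.2 ≠ 0 := fun c hc => (qq_pos hc).ne'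
  have hqs : ContDiffOn ℝ ∞ (fun c : ℝ × ℝ × ℝ => qq c.2.1 c.2.2) {c | 0 < c.2.2} := by
    unfold qq
    fun_prop
  have ha : ContDiffOn ℝ ∞ (fun c : ℝ × ℝ × ℝ => aa c.2.1 c.2.2) {c | 0 < c.2.2} := by
    unfold aa
    fun_prop
  have hb : ContDiffOn ℝ ∞ (fun c : ℝ × ℝ × ℝ => bb c.2.1 c.2.2) {c | 0 < c.2.2} := by
    unfold bb
    fun_prop
  have hc : ContDiffOn ℝ ∞ (fun c : ℝ × ℝ × ℝ => cc c.2.1 c.2.2) {c | 0 < c.2.2} := by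
    unfold cc
    fun_prop
  have h1 : ContDiffOn ℝ ∞ (fun c : ℝ × ℝ × ℝ => pDot c.1 c.2.1 c.2.2) {c | 0 < c.2.2} := by
    unfold pDot shapeRatio
    have := ((hb.pow 2).add (hc.pow 2)).div hqs hq
    fun_prop
  have h2 : ContDiffOn ℝ ∞ (fun c : ℝ × ℝ × ℝ => xDot c.1 c.2.1 c.2.2) {c | 0 < c.2.2} := by
    unfold xDot
    exact ContDiffOn.div (by fun_prop) hqs hq
  have h3 : ContDiffOn ℝ ∞ (fun c : ℝ × ℝ × ℝ => yDot c.1 c.2.1 c.2.2) {c | 0 < c.2.2} := by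
    unfold yDot
    exact ContDiffOn.div (by fun_prop) hqs hq
  exact h1.prodMk (h2.prodMk h3)

theorem isOpen_halfSpace : IsOpen {c : ℝ × ℝ × ℝ | 0 < c.2.2} :=
  isOpen_lt continuous_const (by fun_prop)

theorem contDiffAt_stateField {c : ℝ × ℝ × ℝ} (h : 0 < c.2.2) : ContDiffAt ℝ ∞ stateField c :=
  contDiffOn_stateField.contDiffAt (isOpen_halfSpace.mem_nhds h)

/-- Smoothness comes from bootstrapping: the vector field is smooth on the half space, so
differentiable solutions are smooth. -/
theorem IsSolution.of_hasDerivAt {c : ℝ → ℝ × ℝ × ℝ} {J : Set ℝ} (hJ : IsOpen J)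
    (hd : ∀ t ∈ J, HasDerivAt c (stateField (c t)) t) (hp : ∀ t ∈ J, 0 < (c t).2.2) :
    IsSolution c J := by
  refine ⟨hJ, hd, hp, fun t ht => ContDiffAt.contDiffWithinAt ?_⟩
  obtain ⟨e, he, hb⟩ := Metric.isOpen_iff.1 hJ t ht
  have hsub : Icc (t - e / 2) (t + e / 2) ⊆ J := by
    refine Subset.trans ?_ hb
    rw [Real.ball_eq_Ioo]
    exact Icc_subset_Ioo (by linarith) (by linarith)
  have h := ODE.contDiffOn_enat_Icc_of_hasDerivWithinAt (n := ⊤) (f := fun _ => stateField)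
    (u := {c | 0 < c.2.2}) (α := c) (tmin := t - e / 2) (tmax := t + e / 2)
    (contDiffOn_stateField.comp (f := fun z : ℝ × ℝ × ℝ × ℝ => z.2) (by fun_prop)
      fun z hz => hz.2)
    (fun s hs => (hd s (hsub hs)).hasDerivWithinAt) fun s hs => hp s (hsub hs)
  exact h.contDiffAt (Icc_mem_nhds (by linarith) (by linarith))

theorem IsSolution.mono {c : ℝ → ℝ × ℝ × ℝ} {J K : Set ℝ} (hc : IsSolution c J) (hK : IsOpen K)
    (h : K ⊆ J) : IsSolution c K :=
  ⟨hK, fun t ht => hc.deriv t (h ht), fun t ht => hc.pos t (h ht), hc.smooth.mono h⟩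

theorem IsSolution.comp_add {c : ℝ → ℝ × ℝ × ℝ} {J : Set ℝ} (hc : IsSolution c J) (h : ℝ) :
    IsSolution (fun t => c (t + h)) ((fun t => t + h) ⁻¹' J) := by
  refine IsSolution.of_hasDerivAt (hc.isOpen.preimage (by fun_prop)) (fun t ht => ?_)
    fun t ht => hc.pos _ ht
  exact HasDerivAt.comp_add_const t h (hc.deriv _ ht)

theorem IsSolution.continuousOn {c : ℝ → ℝ × ℝ × ℝ} {J : Set ℝ} (hc : IsSolution c J) :
    ContinuousOn c J := fun t ht => (hc.deriv t ht).continuousAt.continuousWithinAt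

/-- The set where the two solutions agree near t is open, the set where they differ is open, and
local uniqueness shows that these cover J. -/
theorem IsSolution.eqOn {c c' : ℝ → ℝ × ℝ × ℝ} {J : Set ℝ} (hc : IsSolution c J)
    (hc' : IsSolution c' J) (hJ : IsPreconnected J) {t₀ : ℝ} (h₀ : t₀ ∈ J) (h : c t₀ = c' t₀) :
    EqOn c c' J := by
  have hloc : ∀ t ∈ J, c t = c' t → c =ᶠ[𝓝 t] c' := by
    intro t ht htt
    obtain ⟨K, s, hs, hK⟩ := ((contDiffAt_stateField (hc.pos t ht)).of_le
      (by simp : (1 : ℕ∞ω) ≤ ∞)).exists_lipschitzOnWith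
    refine ODE_solution_unique_of_eventually (v := fun _ => stateField) (s := fun _ => s) (K := K)
      (Filter.Eventually.of_forall fun _ => hK) ?_ ?_ htt
    · filter_upwards [hc.isOpen.mem_nhds ht, (hc.deriv t ht).continuousAt hs] with r hr hrs
      exact ⟨hc.deriv r hr, hrs⟩
    · rw [htt] at hs
      filter_upwards [hc.isOpen.mem_nhds ht, (hc'.deriv t ht).continuousAt hs] with r hr hrs
      exact ⟨hc'.deriv r hr, hrs⟩
  have hu : IsOpen {t | t ∈ J ∧ c =ᶠ[𝓝 t] c'} :=
    hc.isOpen.inter isOpen_setOfPred_eventually_nhds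
  have hv : IsOpen (J ∩ {t | c t ≠ c' t}) := by
    have h1 : ContinuousOn (fun t => c t - c' t) J := hc.continuousOn.sub hc'.continuousOn
    have h2 := h1.isOpen_inter_preimage hc.isOpen (isOpen_compl_singleton (x := (0 : ℝ × ℝ × ℝ)))
    convert h2 using 1
    ext t
    simp [sub_eq_zero]
  have hsub : J ⊆ {t | t ∈ J ∧ c =ᶠ[𝓝 t] c'} := by
    refine hJ.subset_left_of_subset_union hu hv ?_ ?_ ⟨t₀, h₀, h₀, hloc t₀ h₀ h⟩
    · rw [Set.disjoint_left]
      exact fun t ht ht' => ht'.2 ht.2.self_of_nhds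
    · intro t ht
      by_cases htt : c t = c' t
      · exact Or.inl ⟨ht, hloc t ht htt⟩
      · exact Or.inr ⟨ht, htt⟩
  exact fun t ht => (hsub ht).2.self_of_nhds

/-- The geometric source is the trace of the Riccati equation, 6p' = −|S|² − Ric(∂_t, ∂_t), with
|S|² = 6(p² + (1 + p²)M) and Ric = 6. -/
theorem pDot_neg {p x y : ℝ} (hy : 0 < y) : pDot p x y < 0 := by
  have h1 := qq_pos (x := x) hy
  have h2 : 0 ≤ shapeRatio x y := by
    unfold shapeRatio
    positivity
  unfold pDot
  nlinarith [sq_nonneg p]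

theorem IsSolution.strictAntiOn {c : ℝ → ℝ × ℝ × ℝ} {J : Set ℝ} (hc : IsSolution c J)
    (hJ : Convex ℝ J) : StrictAntiOn (fun t => (c t).1) J := by
  apply strictAntiOn_of_deriv_neg hJ
  · exact continuous_fst.comp_continuousOn hc.continuousOn
  · intro t ht
    rw [hc.isOpen.interior_eq] at ht
    rw [(hasDerivAt_triple (hc.deriv t ht)).1.deriv]
    exact pDot_neg (hc.pos t ht)

/-- The solution belonging to the round sphere. -/
def roundSolution (t : ℝ) : ℝ × ℝ × ℝ :=
  ((1 - Real.tan t ^ 2) / (2 * Real.tan t), 0, Real.tan t)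

/-- Here p = cot 2t. The orbits are products of round spheres of radii cos t and sin t, so ξ and η
are orthogonal (x = 0) and y = |η|/|ξ| = tan t. -/
theorem isSolution_roundSolution : IsSolution roundSolution (Ioo 0 (Real.pi / 2)) := by
  have hpos : ∀ t ∈ Ioo 0 (Real.pi / 2), 0 < Real.tan t := fun t ht =>
    Real.tan_pos_of_pos_of_lt_pi_div_two ht.1 ht.2
  refine IsSolution.of_hasDerivAt isOpen_Ioo (fun t ht => ?_) hpos
  have hcos : Real.cos t ≠ 0 := (Real.cos_pos_of_mem_Ioo ⟨by linarith [ht.1, Real.pi_pos], ht.2⟩).ne'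
  have hy : HasDerivAt Real.tan (1 + Real.tan t ^ 2) t := by
    refine (Real.hasDerivAt_tan hcos).congr_deriv ?_
    rw [Real.tan_eq_sin_div_cos]
    field_simp
    rw [add_comm, Real.sin_sq_add_cos_sq]
  have h0 := hpos t ht
  have hp : HasDerivAt (fun t => (1 - Real.tan t ^ 2) / (2 * Real.tan t)) _ t :=
    ((hy.pow 2).const_sub 1).div (hy.const_mul 2) (by positivity)
  have h := hp.prodMk ((hasDerivAt_const t (0 : ℝ)).prodMk hy)
  refine h.congr_deriv ?_
  have h0' := h0.ne'
  have h1 : 1 + Real.tan t ^ 2 ≠ 0 := by positivity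
  simp only [stateField, roundSolution, pDot, xDot, yDot, shapeRatio, aa, bb, cc, qq, Pi.pow_apply]
  generalize Real.tan t = y at *
  refine Prod.ext ?_ (Prod.ext ?_ ?_)
  · field_simp
    ring
  · field_simp
    ring
  · field_simp
    ring

theorem coeffs_roundSolution {t : ℝ} (ht : t ∈ Ioo 0 (Real.pi / 2)) :
    coeffs (solutionForm roundSolution) t = roundCoeffs t := by
  have h0 : Real.tan t ≠ 0 := (Real.tan_pos_of_pos_of_lt_pi_div_two ht.1 ht.2).ne'
  have hcos : Real.cos t ≠ 0 := (Real.cos_pos_of_mem_Ioo ⟨by linarith [ht.1, Real.pi_pos], ht.2⟩).ne'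
  have hsin : Real.sin t = Real.tan t * Real.cos t := (Real.tan_mul_cos hcos).symm
  have hc2 : Real.cos t ^ 2 = 1 / (1 + Real.tan t ^ 2) := by
    have h2 := Real.sin_sq_add_cos_sq t
    rw [hsin] at h2
    rw [eq_div_iff (by positivity)]
    linarith
  have e : ∀ y : ℝ, y ≠ 0 → 1 + ((1 - y ^ 2) / (2 * y)) ^ 2 = (1 + y ^ 2) ^ 2 / (4 * y ^ 2) := by
    intro y hy
    field_simp
    ring
  rw [solutionForm, coeffs_tubeForm]
  have h1 : 1 + Real.tan t ^ 2 ≠ 0 := by positivity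
  simp only [roundCoeffs, roundSolution, stateCoeffs, areaD, zRe, zIm, Matrix.cons_val, e _ h0,
    hsin, aa, bb, qq]
  have h4 : Real.cos t ^ 4 = (1 / (1 + Real.tan t ^ 2)) ^ 2 := by
    rw [← hc2]
    ring
  ext i
  fin_cases i
  · simp only [Matrix.cons_val, Fin.zero_eta]
    rw [show -9 * (Real.tan t * Real.cos t) * Real.cos t = -9 * Real.tan t * Real.cos t ^ 2 by ring,
      hc2]
    field_simp
    ring
  · simp only [Matrix.cons_val, Fin.mk_one, mul_pow, h4]
    field_simp
    ring
  · simp only [Matrix.cons_val, Fin.reduceFinMk, h4]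
    field_simp
    ring
  · simp only [Matrix.cons_val, Fin.reduceFinMk, mul_pow, hc2]
    field_simp
    ring
  · simp only [Matrix.cons_val, Fin.reduceFinMk, mul_pow, hc2]
    field_simp
    ring

/-- The local flow of Picard–Lindelöf, with its joint continuity, restricted to the slice p = 0 at
time π/4. The member through (0, 0, 1) is the round solution by uniqueness. -/
theorem exists_solution_family : ∃ (δ ρ : ℝ) (c : ℝ × ℝ → ℝ → ℝ × ℝ × ℝ), 0 < δ ∧ 0 < ρ ∧
    (∀ s ∈ Metric.ball (0 : ℝ × ℝ) ρ,
      IsSolution (c s) (Ioo (Real.pi / 4 - δ) (Real.pi / 4 + δ)) ∧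
      c s (Real.pi / 4) = (0, s.1, 1 + s.2)) ∧
    ContinuousOn (fun z : (ℝ × ℝ) × ℝ => c z.1 z.2)
      (Metric.ball (0 : ℝ × ℝ) ρ ×ˢ Ioo (Real.pi / 4 - δ) (Real.pi / 4 + δ)) ∧
    ∀ t ∈ Ioo (Real.pi / 4 - δ) (Real.pi / 4 + δ), c 0 t = roundSolution t := by
  set t₀ := Real.pi / 4 with ht₀
  set x₀ : ℝ × ℝ × ℝ := (0, 0, 1) with hx₀
  have hf : ContDiffAt ℝ 1 stateField x₀ :=
    (contDiffAt_stateField (by simp [hx₀] : 0 < x₀.2.2)).of_le (by simp)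
  obtain ⟨ε, hε, a, r, L, K, hr, hpl⟩ := IsPicardLindelof.of_contDiffAt_one hf
  obtain ⟨α, hα, hcont⟩ :=
    (hpl t₀).exists_forall_mem_closedBall_eq_hasDerivWithinAt_continuousOn
  have hx₀mem : x₀ ∈ Metric.closedBall x₀ (r : ℝ) := Metric.mem_closedBall_self r.2
  have hnh : Metric.closedBall x₀ (r : ℝ) ×ˢ Icc (t₀ - ε) (t₀ + ε) ∈ 𝓝 (x₀, t₀) :=
    prod_mem_nhds (Metric.closedBall_mem_nhds _ hr) (Icc_mem_nhds (by linarith) (by linarith))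
  have hca : ContinuousAt α (x₀, t₀) := hcont.continuousAt hnh
  have hpos : ∀ᶠ z in 𝓝 (x₀, t₀), 0 < (α z).2.2 := by
    have h1 : α (x₀, t₀) = x₀ := (hα x₀ hx₀mem).1
    have h2 : {c : ℝ × ℝ × ℝ | 0 < c.2.2} ∈ 𝓝 (α (x₀, t₀)) := by
      rw [h1]
      exact isOpen_halfSpace.mem_nhds (by simp [hx₀])
    exact hca h2
  obtain ⟨e, he, hball⟩ := Metric.eventually_nhds_iff_ball.1 (hpos.and hnh)
  have hpi := Real.pi_pos
  -- The bound π/4 keeps the time interval inside (0, π/2), where the round solution is defined.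
  have hδ : 0 < min e (Real.pi / 4) := lt_min he (by linarith)
  let init : ℝ × ℝ → ℝ × ℝ × ℝ := fun s => (0, s.1, 1 + s.2)
  have hinit : ∀ s ∈ Metric.ball (0 : ℝ × ℝ) e, init s ∈ Metric.ball x₀ e := by
    intro s hs
    rw [Metric.mem_ball, dist_eq_norm] at hs ⊢
    have : init s - x₀ = (0, s - 0) := by
      ext <;> simp [init, hx₀]
    rw [this, Prod.norm_def]
    simpa using hs
  have hmem : ∀ s ∈ Metric.ball (0 : ℝ × ℝ) e,
      ∀ t ∈ Ioo (t₀ - min e (Real.pi / 4)) (t₀ + min e (Real.pi / 4)),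
      (init s, t) ∈ Metric.ball (x₀, t₀) e := by
    intro s hs t ht
    rw [← ball_prod_same]
    refine ⟨hinit s hs, ?_⟩
    rw [Real.ball_eq_Ioo]
    exact ⟨by linarith [ht.1, min_le_left e (Real.pi / 4)],
      by linarith [ht.2, min_le_left e (Real.pi / 4)]⟩
  have hsol : ∀ s ∈ Metric.ball (0 : ℝ × ℝ) e, IsSolution (fun t => α (init s, t))
      (Ioo (t₀ - min e (Real.pi / 4)) (t₀ + min e (Real.pi / 4))) := by
    intro s hs
    refine IsSolution.of_hasDerivAt isOpen_Ioo (fun t ht => ?_) fun t ht =>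
      (hball _ (hmem s hs t ht)).1
    have h1 := (hball _ (hmem s hs t ht)).2
    refine ((hα _ h1.1).2 t h1.2).hasDerivAt ?_
    have hn : Ioo (t₀ - min e (Real.pi / 4)) (t₀ + min e (Real.pi / 4)) ∈ 𝓝 t :=
      Ioo_mem_nhds ht.1 ht.2
    exact Filter.mem_of_superset hn fun r hr => (hball _ (hmem s hs r hr)).2.2
  have hself : t₀ ∈ Ioo (t₀ - min e (Real.pi / 4)) (t₀ + min e (Real.pi / 4)) :=
    ⟨by linarith, by linarith⟩
  have hzero : (0 : ℝ × ℝ) ∈ Metric.ball (0 : ℝ × ℝ) e := Metric.mem_ball_self he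
  refine ⟨min e (Real.pi / 4), e, fun s t => α (init s, t), hδ, he, fun s hs => ⟨hsol s hs, ?_⟩,
    ?_, ?_⟩
  · exact (hα _ (hball _ (hmem s hs t₀ hself)).2.1).1
  · refine hcont.comp (f := fun z : (ℝ × ℝ) × ℝ => (init z.1, z.2)) ?_ fun z hz =>
      (hball _ (hmem z.1 hz.1 z.2 hz.2)).2
    exact Continuous.continuousOn (by fun_prop)
  · refine (hsol 0 hzero).eqOn (isSolution_roundSolution.mono isOpen_Ioo ?_) isPreconnected_Ioo
      hself ?_
    · intro t ht
      have := min_le_right e (Real.pi / 4)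
      exact ⟨by linarith [ht.1], by linarith [ht.2]⟩
    · rw [(hα _ (hball _ (hmem 0 hzero t₀ hself)).2.1).1]
      simp [roundSolution, ht₀, init]

end


noncomputable section

/-! ### The initial data -/

/-- The coefficients at `t = π / 4` of the member with parameter `s`. -/
def initialCoeffs (s : ℝ × ℝ) : Fin 5 → ℝ :=
  ![-9 * stateCoeffs (0, s.1, 1 + s.2) 0, -27 * stateCoeffs (0, s.1, 1 + s.2) 4,
    -27 * stateCoeffs (0, s.1, 1 + s.2) 1, -27 * stateCoeffs (0, s.1, 1 + s.2) 3,
    -27 * stateCoeffs (0, s.1, 1 + s.2) 2]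

theorem contDiffAt_initialCoeffs {s : ℝ × ℝ} (hs : 0 < 1 + s.2) :
    ContDiffAt ℝ ∞ initialCoeffs s := by
  have h1 : ContDiffAt ℝ ∞ stateCoeffs (0, s.1, 1 + s.2) :=
    contDiffOn_stateCoeffs.contDiffAt (isOpen_halfSpace.mem_nhds hs)
  have h2 : ContDiffAt ℝ ∞ (fun s : ℝ × ℝ => stateCoeffs (0, s.1, 1 + s.2)) s :=
    h1.comp s (f := fun s : ℝ × ℝ => ((0, s.1, 1 + s.2) : ℝ × ℝ × ℝ)) (by fun_prop)
  have h3 := contDiffAt_pi.1 h2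
  rw [contDiffAt_pi]
  intro i
  fin_cases i
  exacts [contDiffAt_const.mul (h3 0), contDiffAt_const.mul (h3 4), contDiffAt_const.mul (h3 1),
    contDiffAt_const.mul (h3 3), contDiffAt_const.mul (h3 2)]

/-- The trace `2x` of the recursion satisfied by the coefficients. -/
def recTrace (k : Fin 5 → ℝ) : ℝ := (k 2 * k 1 - k 4 * k 3) / (k 2 * k 3 - k 4 ^ 2)

/-- The determinant `x² + y²` of the recursion satisfied by the coefficients. -/
def recDet (k : Fin 5 → ℝ) : ℝ := (k 4 * k 1 - k 3 ^ 2) / (k 2 * k 3 - k 4 ^ 2)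

/-- The left inverse of `initialCoeffs`. -/
def initialInverse (k : Fin 5 → ℝ) : ℝ × ℝ :=
  (recTrace k / 2, √(recDet k - (recTrace k / 2) ^ 2) - 1)

/-- The numbers r_k = Re(Zτ^k), k = 0, …, 3, satisfy r_{k+2} = 2x r_{k+1} − (x² + y²) r_k. Cramer's
rule recovers 2x and x² + y², hence τ, from the coefficients. -/
theorem recursion_initialCoeffs {s : ℝ × ℝ} (hs : 0 < 1 + s.2) :
    initialCoeffs s 2 * initialCoeffs s 3 - initialCoeffs s 4 ^ 2 ≠ 0 ∧
      recTrace (initialCoeffs s) = 2 * s.1 ∧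
      recDet (initialCoeffs s) = s.1 ^ 2 + (1 + s.2) ^ 2 := by
  obtain ⟨x, y⟩ := s
  dsimp only at hs ⊢
  have hz : zRe 0 x (1 + y) ^ 2 + zIm 0 x (1 + y) ^ 2 ≠ 0 := by
    rw [zRe_sq_add_zIm_sq hs]
    exact (pow_pos (div_pos (areaD_pos hs) hs) 3).ne'
  -- The determinant is a multiple of r₀r₂ − r₁² = −y²|Z|², which does not vanish.
  have hd : initialCoeffs (x, y) 2 * initialCoeffs (x, y) 3 - initialCoeffs (x, y) 4 ^ 2
      = -(27 * (1 + y)) ^ 2 * (zRe 0 x (1 + y) ^ 2 + zIm 0 x (1 + y) ^ 2) := by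
    simp only [initialCoeffs, stateCoeffs, Matrix.cons_val]
    ring
  have h0 : initialCoeffs (x, y) 2 * initialCoeffs (x, y) 3 - initialCoeffs (x, y) 4 ^ 2 ≠ 0 := by
    rw [hd]
    exact mul_ne_zero (neg_ne_zero.2 (by positivity)) hz
  refine ⟨h0, ?_, ?_⟩
  · rw [recTrace, div_eq_iff h0, hd]
    simp only [initialCoeffs, stateCoeffs, Matrix.cons_val]
    ring
  · rw [recDet, div_eq_iff h0, hd]
    simp only [initialCoeffs, stateCoeffs, Matrix.cons_val]
    ring

theorem initialInverse_initialCoeffs {s : ℝ × ℝ} (hs : 0 < 1 + s.2) :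
    initialInverse (initialCoeffs s) = s := by
  obtain ⟨-, h1, h2⟩ := recursion_initialCoeffs hs
  rw [initialInverse, h1, h2]
  refine Prod.ext (by simp) ?_
  have : s.1 ^ 2 + (1 + s.2) ^ 2 - (2 * s.1 / 2) ^ 2 = (1 + s.2) ^ 2 := by ring
  simp only [this, Real.sqrt_sq hs.le]
  ring

theorem differentiableAt_initialInverse {s : ℝ × ℝ} (hs : 0 < 1 + s.2) :
    DifferentiableAt ℝ initialInverse (initialCoeffs s) := by
  obtain ⟨h0, h1, h2⟩ := recursion_initialCoeffs hs
  have hD : DifferentiableAt ℝ (fun k : Fin 5 → ℝ => k 2 * k 3 - k 4 ^ 2) (initialCoeffs s) := by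
    fun_prop
  have d1 : DifferentiableAt ℝ recTrace (initialCoeffs s) :=
    (by fun_prop : DifferentiableAt ℝ (fun k : Fin 5 → ℝ => k 2 * k 1 - k 4 * k 3)
      (initialCoeffs s)).mul (hD.inv h0)
  have d2 : DifferentiableAt ℝ recDet (initialCoeffs s) :=
    (by fun_prop : DifferentiableAt ℝ (fun k : Fin 5 → ℝ => k 4 * k 1 - k 3 ^ 2)
      (initialCoeffs s)).mul (hD.inv h0)
  have hne : recDet (initialCoeffs s) - (recTrace (initialCoeffs s) / 2) ^ 2 ≠ 0 := by
    rw [h1, h2]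
    have : s.1 ^ 2 + (1 + s.2) ^ 2 - (2 * s.1 / 2) ^ 2 = (1 + s.2) ^ 2 := by ring
    rw [this]
    positivity
  have d3 : DifferentiableAt ℝ (fun k => recTrace k / 2) (initialCoeffs s) := d1.mul_const (2 : ℝ)⁻¹
  exact d3.prodMk (((d2.sub (d3.pow 2)).sqrt hne).sub_const 1)

theorem injective_fderiv_initialCoeffs {s : ℝ × ℝ} (hs : 0 < 1 + s.2) :
    Function.Injective (fderiv ℝ initialCoeffs s) := by
  have h1 : initialInverse ∘ initialCoeffs =ᶠ[𝓝 s] id := by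
    have : {s : ℝ × ℝ | 0 < 1 + s.2} ∈ 𝓝 s :=
      (isOpen_lt continuous_const (by fun_prop)).mem_nhds hs
    filter_upwards [this] with r hr using initialInverse_initialCoeffs hr
  have h2 := fderiv_comp s (differentiableAt_initialInverse hs)
    ((contDiffAt_initialCoeffs hs).differentiableAt (by simp))
  rw [h1.fderiv_eq, fderiv_id] at h2
  intro v w hvw
  have hv := DFunLike.congr_fun h2 v
  have hw := DFunLike.congr_fun h2 w
  simp only [ContinuousLinearMap.comp_apply, hvw] at hv hw
  exact hv.trans hw.symm

theorem hasDerivAt_areaD_line (u v : ℝ) :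
    HasDerivAt (fun r : ℝ => areaD 0 (r * u) (1 + r * v)) (u / 2) 0 := by
  have hx : HasDerivAt (fun r : ℝ => r * u) u 0 := by
    simpa using (hasDerivAt_id (0 : ℝ)).mul_const u
  have hy : HasDerivAt (fun r : ℝ => 1 + r * v) v 0 := by
    simpa using ((hasDerivAt_id (0 : ℝ)).mul_const v).const_add 1
  have hq := hasDerivAt_qq hx hy
  have := hq.div (((hy.pow 3).const_mul 4).mul_const (1 + (0 : ℝ) ^ 2)) (by simp)
  refine this.congr_deriv ?_
  simp [qq]
  ring

theorem hasDerivAt_stateCoeffs_two (v : ℝ) :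
    HasDerivAt (fun r : ℝ => stateCoeffs (0, 0, 1 + r * v) 2) (-v / 4) 0 := by
  have hy : HasDerivAt (fun r : ℝ => 1 + r * v) v 0 := by
    simpa using ((hasDerivAt_id (0 : ℝ)).mul_const v).const_add 1
  have h1 : HasDerivAt (fun r : ℝ => (1 + (1 + r * v) ^ 2) / (8 * (1 + r * v) ^ 2)) (-v / 4) 0 := by
    have := ((hy.pow 2).const_add 1).div ((hy.pow 2).const_mul 8) (by simp)
    refine this.congr_deriv ?_
    simp
    ring
  refine h1.congr_of_eventuallyEq ?_
  have hne : ∀ᶠ r : ℝ in 𝓝 0, 1 + r * v ≠ 0 := hy.continuousAt.eventually_ne (by simp)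
  filter_upwards [hne] with r hr
  simp only [stateCoeffs, Matrix.cons_val, zIm, zRe, qq, aa, bb]
  field_simp
  ring

/-- The derivative of the round coefficients at π/4 is (0, 27, −27, 0, 0). If it were the image of
(u, v), its zeros in positions 0 and 4 would force u = 0 and v = 0 in turn, contradicting the entry
27. -/
theorem transverse_initialCoeffs :
    deriv roundCoeffs (Real.pi / 4) ∉ Set.range (fderiv ℝ initialCoeffs 0) := by
  rintro ⟨⟨u, v⟩, h⟩
  have hr : HasDerivAt roundCoeffs ![0, 27, -27, 0, 0] (Real.pi / 4) := by
    have hs := Real.hasDerivAt_sin (Real.pi / 4)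
    have hc := Real.hasDerivAt_cos (Real.pi / 4)
    have e1 : Real.sin (Real.pi / 4) = Real.cos (Real.pi / 4) := by
      rw [Real.sin_pi_div_four, Real.cos_pi_div_four]
    have e2 : Real.cos (Real.pi / 4) ^ 2 = 1 / 2 := by
      rw [Real.cos_pi_div_four, div_pow, Real.sq_sqrt (by norm_num)]
      norm_num
    have e4 : Real.cos (Real.pi / 4) ^ 4 = 1 / 4 := by
      rw [show Real.cos (Real.pi / 4) ^ 4 = (Real.cos (Real.pi / 4) ^ 2) ^ 2 by ring, e2]
      norm_num
    have h34 := ((hs.pow 2).const_mul (-27)).mul (hc.pow 2)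
    rw [hasDerivAt_pi]
    intro i
    fin_cases i
    · refine ((hs.const_mul (-9)).mul hc).congr_deriv ?_
      simp only [e1, Matrix.cons_val, Fin.zero_eta]
      ring
    · refine ((hs.pow 4).const_mul 27).congr_deriv ?_
      simp only [e1, Matrix.cons_val, Fin.mk_one]
      linear_combination 108 * e4
    · refine ((hc.pow 4).const_mul 27).congr_deriv ?_
      simp only [e1, Matrix.cons_val, Fin.reduceFinMk]
      linear_combination -108 * e4
    · refine h34.congr_deriv ?_
      simp only [e1, Matrix.cons_val, Fin.reduceFinMk, Pi.pow_apply]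
      ring
    · refine h34.congr_deriv ?_
      simp only [e1, Matrix.cons_val, Fin.reduceFinMk, Pi.pow_apply]
      ring
  rw [hr.deriv] at h
  have hl : ∀ w : ℝ × ℝ, HasDerivAt (fun r : ℝ => initialCoeffs (r • w))
      (fderiv ℝ initialCoeffs 0 w) 0 := by
    intro w
    have h1 : HasFDerivAt initialCoeffs (fderiv ℝ initialCoeffs 0) ((0 : ℝ) • w) := by
      rw [zero_smul]
      exact ((contDiffAt_initialCoeffs (by simp)).differentiableAt (by simp)).hasFDerivAt
    refine (h1.comp_hasDerivAt (0 : ℝ) ((hasDerivAt_id (0 : ℝ)).smul_const w)).congr_deriv ?_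
    simp
  have hi := fun w => hasDerivAt_pi.1 (hl w)
  have h0 := (hi (u, v) 0).unique ((hasDerivAt_areaD_line u v).const_mul (-9))
  rw [h] at h0
  have hu : u = 0 := by
    simp only [Matrix.cons_val] at h0
    linarith
  subst hu
  have h4 := (hi (0, v) 4).unique (f := fun r : ℝ => initialCoeffs (r • ((0, v) : ℝ × ℝ)) 4) (by
    refine ((hasDerivAt_stateCoeffs_two v).const_mul (-27)).congr_of_eventuallyEq
      (Filter.Eventually.of_forall fun r => ?_)
    simp [initialCoeffs])
  rw [h] at h4
  have hv : v = 0 := by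
    simp only [Matrix.cons_val] at h4
    linarith
  subst hv
  rw [show ((0, 0) : ℝ × ℝ) = 0 from rfl, map_zero] at h
  have := congrFun h 1
  simp at this

end


noncomputable section

/-! ### The Levi-Civita connection of a frame and its curvature -/

section Frames

variable {E : Type*} [NormedAddCommGroup E] [NormedSpace ℝ E] {ι : Type*} [Fintype ι]

/-- The functions `Γ a i j` are the connection forms, evaluated on `X a`, of the Levi-Civita
connection of the metric for which the (involutive) frame `X` is orthonormal. -/
structure IsLeviCivita (X : ι → E → E) (Γ : ι → ι → ι → E → ℝ) (O : Set E) : Prop where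
  differentiableAt : ∀ z ∈ O, ∀ a, DifferentiableAt ℝ (X a) z
  linearIndependent : ∀ z ∈ O, LinearIndependent ℝ fun a => X a z
  differentiableAt_conn : ∀ z ∈ O, ∀ a i j, DifferentiableAt ℝ (Γ a i j) z
  skew : ∀ z ∈ O, ∀ a i j, Γ a i j z = -Γ a j i z
  torsion : ∀ z ∈ O, ∀ c a, fderiv ℝ (X a) z (X c z) - fderiv ℝ (X c) z (X a z)
    = ∑ d, (Γ c d a z - Γ a d c z) • X d z

/-- The components of the curvature of the connection `Γ`. -/
def frameCurvature (X : ι → E → E) (Γ : ι → ι → ι → E → ℝ) (z : E) (c a i j : ι) : ℝ :=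
  fderiv ℝ (Γ a i j) z (X c z) - fderiv ℝ (Γ c i j) z (X a z)
    + ∑ k, (Γ c i k z * Γ a k j z - Γ a i k z * Γ c k j z)
    - ∑ d, (Γ c d a z - Γ a d c z) * Γ d i j z

/-- The squared norm of the curvature. -/
def frameCurvatureSq (X : ι → E → E) (Γ : ι → ι → ι → E → ℝ) (z : E) : ℝ :=
  ∑ c, ∑ a, ∑ i, ∑ j, frameCurvature X Γ z c a i j ^ 2

/-- `Ψ` carries the frame `X` to the frame `X'`, up to the orthogonal matrices `A`. -/
structure IsFrameMap (X X' : ι → E → E) (A : ι → ι → E → ℝ) (Ψ : E → E) (O O' : Set E) : Prop where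
  isOpen : IsOpen O
  mapsTo : MapsTo Ψ O O'
  contDiffAt : ∀ z ∈ O, ContDiffAt ℝ ∞ Ψ z
  contDiffAt_matrix : ∀ z ∈ O, ∀ i j, ContDiffAt ℝ ∞ (A i j) z
  fderiv_apply : ∀ z ∈ O, ∀ a, fderiv ℝ Ψ z (X a z) = ∑ b, A b a z • X' b (Ψ z)

variable {X X' : ι → E → E} {Γ Γ' : ι → ι → ι → E → ℝ} {A : ι → ι → E → ℝ} {Ψ : E → E}
  {O O' : Set E}

theorem eventuallyEq_of_open {E F : Type*} [TopologicalSpace E] {f g : E → F} {O : Set E} (hO : IsOpen O) (h : ∀ z ∈ O, f z = g z)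
    {z : E} (hz : z ∈ O) : f =ᶠ[𝓝 z] g :=
  Filter.eventuallyEq_of_mem (hO.mem_nhds hz) h

theorem fderiv_fderiv_apply {F : Type*} [NormedAddCommGroup F] [NormedSpace ℝ F] {f : E → F}
    {Y : E → E} {z : E} (hf : ContDiffAt ℝ ∞ f z) (hY : DifferentiableAt ℝ Y z) (v : E) :
    fderiv ℝ (fun y => fderiv ℝ f y (Y y)) z v
      = fderiv ℝ (fderiv ℝ f) z v (Y z) + fderiv ℝ f z (fderiv ℝ Y z v) := by
  have h : DifferentiableAt ℝ (fderiv ℝ f) z :=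
    (hf.fderiv_right (m := ∞) (by simp)).differentiableAt (by simp)
  rw [fderiv_clm_apply h hY]
  simp [add_comm]

/-- The commutator of two directional derivatives. -/
theorem fderiv_commutator {F : Type*} [NormedAddCommGroup F] [NormedSpace ℝ F] {f : E → F}
    {Y Z : E → E} {z : E} (hf : ContDiffAt ℝ ∞ f z) (hY : DifferentiableAt ℝ Y z)
    (hZ : DifferentiableAt ℝ Z z) :
    fderiv ℝ (fun y => fderiv ℝ f y (Y y)) z (Z z) - fderiv ℝ (fun y => fderiv ℝ f y (Z y)) z (Y z)
      = fderiv ℝ f z (fderiv ℝ Y z (Z z) - fderiv ℝ Z z (Y z)) := by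
  have hs : IsSymmSndFDerivAt ℝ f z := hf.isSymmSndFDerivAt
    (by rw [minSmoothness_of_isRCLikeNormedField]; exact WithTop.coe_le_coe.2 (le_top : (2 : ℕ∞) ≤ ⊤))
  rw [fderiv_fderiv_apply hf hY, fderiv_fderiv_apply hf hZ, hs.eq (Z z) (Y z), map_sub]
  abel

/-- The commutator of two frame fields is computed twice: pushed forward by Ψ, and expanded through
Ψ_* X_a = Σ A_{ba} X'_b. Coefficients are compared in the independent frame X'. -/
theorem IsFrameMap.structure_eq (hΨ : IsFrameMap X X' A Ψ O O') (hX : IsLeviCivita X Γ O)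
    (hX' : IsLeviCivita X' Γ' O') {z : E} (hz : z ∈ O) (c a b : ι) :
    ∑ d, (Γ c d a z - Γ a d c z) * A b d z
      = fderiv ℝ (A b a) z (X c z) - fderiv ℝ (A b c) z (X a z)
        + ∑ e, ∑ f, A e c z * A f a z * (Γ' e b f (Ψ z) - Γ' f b e (Ψ z)) := by
  have hdΨ : DifferentiableAt ℝ Ψ z := (hΨ.contDiffAt z hz).differentiableAt (by simp)
  have hdA : ∀ i j, DifferentiableAt ℝ (A i j) z := fun i j =>
    (hΨ.contDiffAt_matrix z hz i j).differentiableAt (by simp)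
  have hdX' : ∀ b, DifferentiableAt ℝ (fun y => X' b (Ψ y)) z := fun b =>
    (hX'.differentiableAt _ (hΨ.mapsTo hz) b).comp z hdΨ
  have h1 : ∀ a c, fderiv ℝ (fun y => fderiv ℝ Ψ y (X a y)) z (X c z)
      = ∑ b, (fderiv ℝ (A b a) z (X c z) • X' b (Ψ z)
        + A b a z • ∑ e, A e c z • fderiv ℝ (X' b) (Ψ z) (X' e (Ψ z))) := by
    intro a c
    rw [(eventuallyEq_of_open hΨ.isOpen (fun y hy => hΨ.fderiv_apply y hy a) hz).fderiv_eq,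
      fderiv_fun_sum fun b _ => (hdA b a).fun_smul (hdX' b)]
    rw [sum_apply]
    refine Finset.sum_congr rfl fun b _ => ?_
    rw [fderiv_fun_smul (hdA b a) (hdX' b)]
    have h2 : fderiv ℝ (fun y => X' b (Ψ y)) z (X c z)
        = ∑ e, A e c z • fderiv ℝ (X' b) (Ψ z) (X' e (Ψ z)) := by
      have := fderiv_comp z (hX'.differentiableAt _ (hΨ.mapsTo hz) b) hdΨ
      have h3 := DFunLike.congr_fun this (X c z)
      simp only [ContinuousLinearMap.comp_apply, hΨ.fderiv_apply z hz c, map_sum, map_smul] at h3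
      exact h3
    simp [h2, add_comm]
  have h2 := fderiv_commutator (hΨ.contDiffAt z hz) (hX.differentiableAt z hz a)
    (hX.differentiableAt z hz c)
  rw [h1, h1, hX.torsion z hz, map_sum] at h2
  simp only [map_smul, hΨ.fderiv_apply z hz, Finset.smul_sum, smul_smul] at h2
  have h3 : ∑ b, ∑ e, (A b a z * A e c z) • fderiv ℝ (X' b) (Ψ z) (X' e (Ψ z))
      - ∑ b, ∑ e, (A b c z * A e a z) • fderiv ℝ (X' b) (Ψ z) (X' e (Ψ z))
      = ∑ b, (∑ e, ∑ f, A e c z * A f a z * (Γ' e b f (Ψ z) - Γ' f b e (Ψ z))) • X' b (Ψ z) := by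
    rw [Finset.sum_comm, ← Finset.sum_sub_distrib]
    have : ∀ e, ∑ f, (A f a z * A e c z) • fderiv ℝ (X' f) (Ψ z) (X' e (Ψ z))
        - ∑ f, (A e c z * A f a z) • fderiv ℝ (X' e) (Ψ z) (X' f (Ψ z))
        = ∑ f, (A e c z * A f a z) • ∑ b, (Γ' e b f (Ψ z) - Γ' f b e (Ψ z)) • X' b (Ψ z) := by
      intro e
      rw [← Finset.sum_sub_distrib]
      refine Finset.sum_congr rfl fun f _ => ?_
      rw [← hX'.torsion _ (hΨ.mapsTo hz), smul_sub, mul_comm (A f a z)]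
    simp only [this, Finset.smul_sum, smul_smul]
    simp only [Finset.sum_smul]
    exact (Finset.sum_congr rfl fun e _ => Finset.sum_comm).trans Finset.sum_comm
  have h4 : ∑ b, ((∑ d, (Γ c d a z - Γ a d c z) * A b d z)
      - (fderiv ℝ (A b a) z (X c z) - fderiv ℝ (A b c) z (X a z)
        + ∑ e, ∑ f, A e c z * A f a z * (Γ' e b f (Ψ z) - Γ' f b e (Ψ z)))) • X' b (Ψ z) = 0 := by
    simp only [sub_smul, add_smul, Finset.sum_sub_distrib, Finset.sum_add_distrib]
    rw [← h3]
    simp only [Finset.sum_smul]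
    rw [Finset.sum_comm (γ := ι) (f := fun b d => ((Γ c d a z - Γ a d c z) * A b d z) • X' b (Ψ z)),
      ← h2]
    simp only [Finset.sum_add_distrib]
    abel
  have h5 := Fintype.linearIndependent_iff.1 (hX'.linearIndependent _ (hΨ.mapsTo hz)) _ h4 b
  linarith

theorem sum_eq_of_orthogonal [DecidableEq ι] {A : ι → ι → ℝ}
    (hA : ∀ a c, ∑ b, A b a * A b c = if a = c then 1 else 0) {Y Z : ι → ℝ}
    (h : ∀ a, ∑ b, A b a * Y b = ∑ b, A b a * Z b) (b : ι) : Y b = Z b := by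
  have h1 : (Matrix.of A).transpose * Matrix.of A = 1 := by
    ext a c
    simp [Matrix.mul_apply, hA, Matrix.one_apply]
  have h2 : Matrix.of A * (Matrix.of A).transpose = 1 := mul_eq_one_comm.1 h1
  have h3 : (Matrix.of A).transpose.mulVec Y = (Matrix.of A).transpose.mulVec Z := funext fun a => h a
  have h4 := congrArg (fun v => (Matrix.of A).mulVec v) h3
  simp only [Matrix.mulVec_mulVec, h2, Matrix.one_mulVec] at h4
  exact congrFun h4 b

/-- The matrices of a frame map intertwine the Levi-Civita connections. -/
theorem IsFrameMap.fderiv_matrix [DecidableEq ι] (hΨ : IsFrameMap X X' A Ψ O O')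
    (hX : IsLeviCivita X Γ O) (hX' : IsLeviCivita X' Γ' O')
    (hA : ∀ z ∈ O, ∀ a c, ∑ b, A b a z * A b c z = if a = c then 1 else 0) {z : E} (hz : z ∈ O)
    (a i j : ι) : fderiv ℝ (A i j) z (X a z)
      = ∑ k, A i k z * Γ a k j z - ∑ k, (∑ b, A b a z * Γ' b i k (Ψ z)) * A k j z := by
  have hdA : ∀ i j, DifferentiableAt ℝ (A i j) z := fun i j =>
    (hΨ.contDiffAt_matrix z hz i j).differentiableAt (by simp)
  let Y : ι → ι → ι → ℝ := fun c i a => fderiv ℝ (A i a) z (X c z)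
    - ∑ k, A i k z * Γ c k a z + ∑ k, (∑ b, A b c z * Γ' b i k (Ψ z)) * A k a z
  have hY : ∀ c b a, Y c b a = Y a b c := by
    intro c b a
    have h1 := hΨ.structure_eq hX hX' hz c a b
    have h2 : ∑ e, ∑ f, A e c z * A f a z * (Γ' e b f (Ψ z) - Γ' f b e (Ψ z))
        = ∑ k, (∑ e, A e c z * Γ' e b k (Ψ z)) * A k a z
          - ∑ k, (∑ e, A e a z * Γ' e b k (Ψ z)) * A k c z := by
      simp only [Finset.sum_mul, mul_sub, Finset.sum_sub_distrib]
      congr 1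
      · rw [Finset.sum_comm]
        exact Finset.sum_congr rfl fun k _ => Finset.sum_congr rfl fun e _ => by ring
      · exact Finset.sum_congr rfl fun k _ => Finset.sum_congr rfl fun e _ => by ring
    have h3 : ∑ d, (Γ c d a z - Γ a d c z) * A b d z
        = ∑ k, A b k z * Γ c k a z - ∑ k, A b k z * Γ a k c z := by
      rw [← Finset.sum_sub_distrib]
      exact Finset.sum_congr rfl fun d _ => by ring
    simp only [Y]
    linarith
  have hskew : ∀ c d a, ∑ b, A b d z * Y c b a = -∑ b, A b a z * Y c b d := by
    intro c d a
    have h1 : ∑ b, (A b d z * fderiv ℝ (A b a) z (X c z) + A b a z * fderiv ℝ (A b d) z (X c z))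
        = 0 := by
      have h0 : fderiv ℝ (fun y => ∑ b, A b d y * A b a y) z = 0 := by
        rw [(eventuallyEq_of_open hΨ.isOpen (fun y hy => hA y hy d a) hz).fderiv_eq]
        simp
      rw [fderiv_fun_sum fun b _ => (hdA b d).fun_mul (hdA b a)] at h0
      have h2 := DFunLike.congr_fun h0 (X c z)
      rw [sum_apply] at h2
      rw [← Finset.sum_congr rfl fun b _ => ?_]
      · exact h2
      · rw [fderiv_fun_mul (hdA b d) (hdA b a)]
        simp
    have h2 : ∀ d a, ∑ b, A b d z * ∑ k, A b k z * Γ c k a z = Γ c d a z := by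
      intro d a
      simp only [Finset.mul_sum]
      rw [Finset.sum_comm]
      simp only [← mul_assoc, ← Finset.sum_mul, hA z hz]
      simp
    have h3 : ∑ b, A b d z * ∑ k, (∑ e, A e c z * Γ' e b k (Ψ z)) * A k a z
        = -∑ b, A b a z * ∑ k, (∑ e, A e c z * Γ' e b k (Ψ z)) * A k d z := by
      simp only [Finset.mul_sum]
      rw [Finset.sum_comm, ← Finset.sum_neg_distrib]
      refine Finset.sum_congr rfl fun k _ => ?_
      rw [← Finset.sum_neg_distrib]
      refine Finset.sum_congr rfl fun b _ => ?_
      have : ∑ e, A e c z * Γ' e b k (Ψ z) = -∑ e, A e c z * Γ' e k b (Ψ z) := by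
        rw [← Finset.sum_neg_distrib]
        exact Finset.sum_congr rfl fun e _ => by rw [hX'.skew _ (hΨ.mapsTo hz) e b k]; ring
      rw [this]
      ring
    simp only [Y, mul_add, mul_sub, Finset.sum_add_distrib, Finset.sum_sub_distrib, h2] at h1 ⊢
    rw [h3, hX.skew z hz c d a]
    linarith
  -- Three indices, symmetric in one pair and skew in an overlapping pair: such an array vanishes.
  -- This is the argument for uniqueness of the Levi-Civita connection.
  have hzero : ∀ c a d, ∑ b, A b d z * Y c b a = 0 := by
    intro c a d
    have e1 := hskew c d a
    have e2 := hskew d c a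
    have e3 := hskew a c d
    have s1 : ∑ b, A b a z * Y c b d = ∑ b, A b a z * Y d b c := by simp only [hY c _ d]
    have s2 : ∑ b, A b c z * Y d b a = ∑ b, A b c z * Y a b d := by simp only [hY d _ a]
    have s3 : ∑ b, A b d z * Y a b c = ∑ b, A b d z * Y c b a := by simp only [hY a _ c]
    linarith
  have := sum_eq_of_orthogonal (hA z hz) (Y := fun b => Y a b j) (Z := 0)
    (fun d => by simpa using hzero a j d) i
  simp only [Y, Pi.zero_apply] at this
  linarith

/-- The pulled back connection forms. -/
def pulledConn (A : ι → ι → E → ℝ) (Γ' : ι → ι → ι → E → ℝ) (Ψ : E → E) (a i j : ι) (z : E) : ℝ :=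
  ∑ b, A b a z * Γ' b i j (Ψ z)

theorem IsFrameMap.fderiv_pulledConn (hΨ : IsFrameMap X X' A Ψ O O')
    (hX' : IsLeviCivita X' Γ' O') {z : E} (hz : z ∈ O) (c a i j : ι) :
    DifferentiableAt ℝ (pulledConn A Γ' Ψ a i j) z ∧
    fderiv ℝ (pulledConn A Γ' Ψ a i j) z (X c z)
      = ∑ b, (fderiv ℝ (A b a) z (X c z) * Γ' b i j (Ψ z)
        + A b a z * ∑ e, A e c z * fderiv ℝ (Γ' b i j) (Ψ z) (X' e (Ψ z))) := by
  have hdΨ : DifferentiableAt ℝ Ψ z := (hΨ.contDiffAt z hz).differentiableAt (by simp)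
  have hdA : ∀ i j, DifferentiableAt ℝ (A i j) z := fun i j =>
    (hΨ.contDiffAt_matrix z hz i j).differentiableAt (by simp)
  have hdΓ : ∀ b, DifferentiableAt ℝ (Γ' b i j) (Ψ z) := fun b =>
    hX'.differentiableAt_conn _ (hΨ.mapsTo hz) b i j
  have hdΓ' : ∀ b, DifferentiableAt ℝ (fun y => Γ' b i j (Ψ y)) z := fun b => (hdΓ b).comp z hdΨ
  have hd : ∀ b ∈ Finset.univ, DifferentiableAt ℝ (fun y => A b a y * Γ' b i j (Ψ y)) z :=
    fun b _ => (hdA b a).fun_mul (hdΓ' b)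
  refine ⟨DifferentiableAt.fun_sum hd, ?_⟩
  unfold pulledConn
  rw [fderiv_fun_sum hd, sum_apply]
  refine Finset.sum_congr rfl fun b _ => ?_
  rw [fderiv_fun_mul (hdA b a) (hdΓ' b)]
  have h2 : fderiv ℝ (fun y => Γ' b i j (Ψ y)) z (X c z)
      = ∑ e, A e c z * fderiv ℝ (Γ' b i j) (Ψ z) (X' e (Ψ z)) := by
    have h3 := DFunLike.congr_fun (fderiv_comp z (hdΓ b) hdΨ) (X c z)
    simp only [ContinuousLinearMap.comp_apply, hΨ.fderiv_apply z hz c, map_sum, map_smul,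
      smul_eq_mul] at h3
    exact h3
  simp [h2]
  ring

/-- The curvature of the pulled back connection. -/
theorem IsFrameMap.pulled_curvature (hΨ : IsFrameMap X X' A Ψ O O') (hX : IsLeviCivita X Γ O)
    (hX' : IsLeviCivita X' Γ' O') {z : E} (hz : z ∈ O) (c a i j : ι) :
    fderiv ℝ (pulledConn A Γ' Ψ a i j) z (X c z) - fderiv ℝ (pulledConn A Γ' Ψ c i j) z (X a z)
      + ∑ k, (pulledConn A Γ' Ψ c i k z * pulledConn A Γ' Ψ a k j z
        - pulledConn A Γ' Ψ a i k z * pulledConn A Γ' Ψ c k j z)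
      - ∑ d, (Γ c d a z - Γ a d c z) * pulledConn A Γ' Ψ d i j z
      = ∑ e, ∑ f, A e c z * A f a z * frameCurvature X' Γ' (Ψ z) e f i j := by
  rw [(hΨ.fderiv_pulledConn hX' hz c a i j).2, (hΨ.fderiv_pulledConn hX' hz a c i j).2]
  have h1 : ∑ d, (Γ c d a z - Γ a d c z) * pulledConn A Γ' Ψ d i j z
      = ∑ b, (fderiv ℝ (A b a) z (X c z) - fderiv ℝ (A b c) z (X a z)) * Γ' b i j (Ψ z)
        + ∑ e, ∑ f, A e c z * A f a z
          * ∑ b, (Γ' e b f (Ψ z) - Γ' f b e (Ψ z)) * Γ' b i j (Ψ z) := by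
    simp only [pulledConn, Finset.mul_sum]
    rw [Finset.sum_comm]
    simp only [← mul_assoc, ← Finset.sum_mul, hΨ.structure_eq hX hX' hz, add_mul,
      Finset.sum_add_distrib]
    congr 1
    simp only [Finset.sum_mul]
    exact Finset.sum_comm.trans (Finset.sum_congr rfl fun e _ => Finset.sum_comm)
  have h2 : ∑ k, (pulledConn A Γ' Ψ c i k z * pulledConn A Γ' Ψ a k j z
        - pulledConn A Γ' Ψ a i k z * pulledConn A Γ' Ψ c k j z)
      = ∑ e, ∑ f, A e c z * A f a z * ∑ k, (Γ' e i k (Ψ z) * Γ' f k j (Ψ z)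
        - Γ' f i k (Ψ z) * Γ' e k j (Ψ z)) := by
    have h3 : ∀ k, pulledConn A Γ' Ψ c i k z * pulledConn A Γ' Ψ a k j z
        - pulledConn A Γ' Ψ a i k z * pulledConn A Γ' Ψ c k j z
        = ∑ e, ∑ f, A e c z * A f a z * (Γ' e i k (Ψ z) * Γ' f k j (Ψ z)
        - Γ' f i k (Ψ z) * Γ' e k j (Ψ z)) := by
      intro k
      simp only [pulledConn, Finset.sum_mul_sum, mul_sub, Finset.sum_sub_distrib]
      congr 1
      · exact Finset.sum_congr rfl fun e _ => Finset.sum_congr rfl fun f _ => by ring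
      · rw [Finset.sum_comm]
        exact Finset.sum_congr rfl fun e _ => Finset.sum_congr rfl fun f _ => by ring
    simp only [h3, Finset.mul_sum]
    exact Finset.sum_comm.trans (Finset.sum_congr rfl fun e _ => Finset.sum_comm)
  have h3 : ∀ c a, ∑ b, (fderiv ℝ (A b a) z (X c z) * Γ' b i j (Ψ z)
        + A b a z * ∑ e, A e c z * fderiv ℝ (Γ' b i j) (Ψ z) (X' e (Ψ z)))
      = ∑ b, fderiv ℝ (A b a) z (X c z) * Γ' b i j (Ψ z)
        + ∑ f, ∑ e, A e c z * A f a z * fderiv ℝ (Γ' f i j) (Ψ z) (X' e (Ψ z)) := by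
    intro c a
    rw [Finset.sum_add_distrib]
    congr 1
    refine Finset.sum_congr rfl fun f _ => ?_
    rw [Finset.mul_sum]
    exact Finset.sum_congr rfl fun e _ => by ring
  have h4 : ∑ f, ∑ e, A e c z * A f a z * fderiv ℝ (Γ' f i j) (Ψ z) (X' e (Ψ z))
      - ∑ f, ∑ e, A e a z * A f c z * fderiv ℝ (Γ' f i j) (Ψ z) (X' e (Ψ z))
      = ∑ e, ∑ f, A e c z * A f a z * (fderiv ℝ (Γ' f i j) (Ψ z) (X' e (Ψ z))
        - fderiv ℝ (Γ' e i j) (Ψ z) (X' f (Ψ z))) := by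
    rw [Finset.sum_comm, ← Finset.sum_sub_distrib]
    refine Finset.sum_congr rfl fun e _ => ?_
    rw [← Finset.sum_sub_distrib]
    exact Finset.sum_congr rfl fun f _ => by ring
  rw [h1, h2, h3, h3]
  simp only [frameCurvature, mul_sub, mul_add, sub_mul, Finset.sum_sub_distrib,
    Finset.sum_add_distrib] at h4 ⊢
  linarith

/-- The curvature is equivariant. -/
theorem IsFrameMap.curvature_eq [DecidableEq ι] (hΨ : IsFrameMap X X' A Ψ O O')
    (hX : IsLeviCivita X Γ O) (hX' : IsLeviCivita X' Γ' O')
    (hA : ∀ z ∈ O, ∀ a c, ∑ b, A b a z * A b c z = if a = c then 1 else 0) {z : E} (hz : z ∈ O)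
    (c a i j : ι) : ∑ k, A i k z * frameCurvature X Γ z c a k j
      = ∑ k, (∑ e, ∑ f, A e c z * A f a z * frameCurvature X' Γ' (Ψ z) e f i k) * A k j z := by
  have hdA : ∀ i j, DifferentiableAt ℝ (A i j) z := fun i j =>
    (hΨ.contDiffAt_matrix z hz i j).differentiableAt (by simp)
  have hdΓ : ∀ a i j, DifferentiableAt ℝ (Γ a i j) z := hX.differentiableAt_conn z hz
  have hdB : ∀ a i j, DifferentiableAt ℝ (pulledConn A Γ' Ψ a i j) z := fun a i j =>
    (hΨ.fderiv_pulledConn hX' hz a a i j).1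
  let M : Matrix ι ι ℝ := Matrix.of fun i j => A i j z
  let W : ι → Matrix ι ι ℝ := fun a => Matrix.of fun i j => Γ a i j z
  let B : ι → Matrix ι ι ℝ := fun a => Matrix.of fun i j => pulledConn A Γ' Ψ a i j z
  let dM : ι → Matrix ι ι ℝ := fun c => Matrix.of fun i j => fderiv ℝ (A i j) z (X c z)
  let dW : ι → ι → Matrix ι ι ℝ := fun c a => Matrix.of fun i j => fderiv ℝ (Γ a i j) z (X c z)
  let dB : ι → ι → Matrix ι ι ℝ := fun c a => Matrix.of fun i j =>
    fderiv ℝ (pulledConn A Γ' Ψ a i j) z (X c z)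
  -- The gauge equation: M carries the connection W to the pulled-back connection B.
  have hdM : ∀ a, dM a = M * W a - B a * M := by
    intro a
    ext i j
    simpa [M, W, B, dM, Matrix.mul_apply, pulledConn] using hΨ.fderiv_matrix hX hX' hA hz a i j
  have hsecond : ∀ c a i j, fderiv ℝ (fun y => fderiv ℝ (A i j) y (X a y)) z (X c z)
      = (dM c * W a + M * dW c a - dB c a * M - B a * dM c) i j := by
    intro c a i j
    have e : ∀ y ∈ O, fderiv ℝ (A i j) y (X a y)
        = ∑ k, (A i k y * Γ a k j y - pulledConn A Γ' Ψ a i k y * A k j y) := by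
      intro y hy
      rw [Finset.sum_sub_distrib]
      exact hΨ.fderiv_matrix hX hX' hA hy a i j
    have hk : ∀ k ∈ Finset.univ, DifferentiableAt ℝ (fun y => A i k y * Γ a k j y
        - pulledConn A Γ' Ψ a i k y * A k j y) z := fun k _ =>
      ((hdA i k).fun_mul (hdΓ a k j)).fun_sub ((hdB a i k).fun_mul (hdA k j))
    rw [(eventuallyEq_of_open hΨ.isOpen e hz).fderiv_eq, fderiv_fun_sum hk, sum_apply]
    simp only [Matrix.sub_apply, Matrix.add_apply, Matrix.mul_apply, ← Finset.sum_add_distrib,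
      ← Finset.sum_sub_distrib]
    refine Finset.sum_congr rfl fun k _ => ?_
    rw [fderiv_fun_sub ((hdA i k).fun_mul (hdΓ a k j)) ((hdB a i k).fun_mul (hdA k j)),
      fderiv_fun_mul (hdA i k) (hdΓ a k j), fderiv_fun_mul (hdB a i k) (hdA k j)]
    simp [M, W, B, dM, dW, dB]
    ring
  -- Integrability of the gauge equation: second derivatives of A commute up to the bracket of the
  -- fields. Substituting the equation for dM leaves M · curv(W) = curv(B) · M.
  have hcomm : dM c * W a + M * dW c a - dB c a * M - B a * dM c
      - (dM a * W c + M * dW a c - dB a c * M - B c * dM a)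
      = ∑ d, (Γ c d a z - Γ a d c z) • dM d := by
    ext i j
    have h := fderiv_commutator (hΨ.contDiffAt_matrix z hz i j) (hX.differentiableAt z hz a)
      (hX.differentiableAt z hz c)
    rw [hsecond, hsecond, hX.torsion z hz, map_sum] at h
    rw [Matrix.sub_apply, h, Matrix.sum_apply]
    simp [dM]
  have hsum : ∑ d, (Γ c d a z - Γ a d c z) • dM d
      = M * (∑ d, (Γ c d a z - Γ a d c z) • W d) - (∑ d, (Γ c d a z - Γ a d c z) • B d) * M := by
    simp only [hdM, smul_sub, Finset.sum_sub_distrib, Matrix.mul_sum, Matrix.sum_mul,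
      Matrix.mul_smul, Matrix.smul_mul]
  rw [hsum, hdM, hdM] at hcomm
  have hfin : M * (dW c a - dW a c + (W c * W a - W a * W c)
      - ∑ d, (Γ c d a z - Γ a d c z) • W d)
      = (dB c a - dB a c + (B c * B a - B a * B c) - ∑ d, (Γ c d a z - Γ a d c z) • B d) * M := by
    rw [← sub_eq_zero] at hcomm ⊢
    rw [← hcomm]
    noncomm_ring
  have h := congrFun (congrFun hfin i) j
  simp only [← hΨ.pulled_curvature hX hX' hz]
  simpa [M, W, B, dW, dB, Matrix.mul_apply, Matrix.sum_apply, frameCurvature,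
    Finset.sum_sub_distrib] using h

theorem sum_sq_of_orthogonal [DecidableEq ι] {A : ι → ι → ℝ}
    (hA : ∀ a c, ∑ b, A b a * A b c = if a = c then 1 else 0) (v : ι → ℝ) :
    ∑ c, (∑ e, A e c * v e) ^ 2 = ∑ e, v e ^ 2 := by
  have h1 : (Matrix.of A).transpose * Matrix.of A = 1 := by
    ext a c
    simp [Matrix.mul_apply, hA, Matrix.one_apply]
  have h2 : Matrix.of A * (Matrix.of A).transpose = 1 := mul_eq_one_comm.1 h1
  have h3 : ∀ e f, ∑ c, A e c * A f c = if e = f then 1 else 0 := by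
    intro e f
    have := congrFun (congrFun h2 e) f
    simpa [Matrix.mul_apply, Matrix.one_apply] using this
  have h4 : ∀ c, (∑ e, A e c * v e) ^ 2 = ∑ e, ∑ f, A e c * A f c * (v e * v f) := by
    intro c
    rw [sq, Finset.sum_mul_sum]
    exact Finset.sum_congr rfl fun e _ => Finset.sum_congr rfl fun f _ => by ring
  simp only [h4]
  rw [Finset.sum_comm]
  refine Finset.sum_congr rfl fun e _ => ?_
  rw [Finset.sum_comm]
  simp only [← Finset.sum_mul, h3]
  simp [sq]

/-- The norm of the curvature is invariant. -/
theorem IsFrameMap.curvatureSq_eq [DecidableEq ι] (hΨ : IsFrameMap X X' A Ψ O O')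
    (hX : IsLeviCivita X Γ O) (hX' : IsLeviCivita X' Γ' O')
    (hA : ∀ z ∈ O, ∀ a c, ∑ b, A b a z * A b c z = if a = c then 1 else 0) {z : E} (hz : z ∈ O) :
    frameCurvatureSq X Γ z = frameCurvatureSq X' Γ' (Ψ z) := by
  have hsq := fun v => sum_sq_of_orthogonal (hA z hz) v
  have h1 : ∀ c a i j, frameCurvature X Γ z c a i j = ∑ k, A k i z * ∑ l, A l j z
      * ∑ e, A e c z * ∑ f, A f a z * frameCurvature X' Γ' (Ψ z) e f k l := by
    intro c a i j
    have h2 : ∑ k, A k i z * ∑ l, A k l z * frameCurvature X Γ z c a l j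
        = frameCurvature X Γ z c a i j := by
      simp only [Finset.mul_sum]
      rw [Finset.sum_comm]
      simp only [← mul_assoc, ← Finset.sum_mul, hA z hz]
      simp
    rw [← h2]
    refine Finset.sum_congr rfl fun k _ => ?_
    rw [hΨ.curvature_eq hX hX' hA hz]
    congr 1
    refine Finset.sum_congr rfl fun l _ => ?_
    rw [mul_comm]
    congr 1
    refine Finset.sum_congr rfl fun e _ => ?_
    rw [Finset.mul_sum]
    exact Finset.sum_congr rfl fun f _ => by ring
  unfold frameCurvatureSq
  -- The four indices are rotated away one at a time, each by orthogonality of A after moving the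
  -- sum over that index innermost.
  calc ∑ c, ∑ a, ∑ i, ∑ j, frameCurvature X Γ z c a i j ^ 2
      = ∑ c, ∑ a, ∑ j, ∑ k, (∑ l, A l j z
        * ∑ e, A e c z * ∑ f, A f a z * frameCurvature X' Γ' (Ψ z) e f k l) ^ 2 := by
        refine Finset.sum_congr rfl fun c _ => Finset.sum_congr rfl fun a _ => ?_
        rw [Finset.sum_comm]
        refine Finset.sum_congr rfl fun j _ => ?_
        simp only [h1, hsq]
    _ = ∑ c, ∑ a, ∑ k, ∑ l, (∑ e, A e c z * ∑ f, A f a z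
        * frameCurvature X' Γ' (Ψ z) e f k l) ^ 2 := by
        refine Finset.sum_congr rfl fun c _ => Finset.sum_congr rfl fun a _ => ?_
        rw [Finset.sum_comm]
        refine Finset.sum_congr rfl fun k _ => ?_
        simp only [hsq]
    _ = ∑ k, ∑ l, ∑ a, ∑ e, (∑ f, A f a z * frameCurvature X' Γ' (Ψ z) e f k l) ^ 2 := by
        rw [Finset.sum_comm]
        have : ∀ a, ∑ c, ∑ k, ∑ l, (∑ e, A e c z * ∑ f, A f a z
            * frameCurvature X' Γ' (Ψ z) e f k l) ^ 2
            = ∑ k, ∑ l, ∑ e, (∑ f, A f a z * frameCurvature X' Γ' (Ψ z) e f k l) ^ 2 := by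
          intro a
          rw [Finset.sum_comm]
          refine Finset.sum_congr rfl fun k _ => ?_
          rw [Finset.sum_comm]
          refine Finset.sum_congr rfl fun l _ => ?_
          simp only [hsq]
        simp only [this]
        rw [Finset.sum_comm]
        exact Finset.sum_congr rfl fun k _ => Finset.sum_comm
    _ = ∑ k, ∑ l, ∑ e, ∑ f, frameCurvature X' Γ' (Ψ z) e f k l ^ 2 := by
        refine Finset.sum_congr rfl fun k _ => Finset.sum_congr rfl fun l _ => ?_
        rw [Finset.sum_comm]
        refine Finset.sum_congr rfl fun e _ => ?_
        simp only [hsq]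
    _ = ∑ e, ∑ f, ∑ k, ∑ l, frameCurvature X' Γ' (Ψ z) e f k l ^ 2 := by
        have h3 : ∀ k, ∑ l, ∑ e, ∑ f, frameCurvature X' Γ' (Ψ z) e f k l ^ 2
            = ∑ e, ∑ f, ∑ l, frameCurvature X' Γ' (Ψ z) e f k l ^ 2 := fun k =>
          Finset.sum_comm.trans (Finset.sum_congr rfl fun e _ => Finset.sum_comm)
        simp only [h3]
        exact Finset.sum_comm.trans (Finset.sum_congr rfl fun e _ => Finset.sum_comm)

end Frames

end


noncomputable section

/-! ### The algebra of the curvature of cohomogeneity one metrics -/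

/-- The index set of the frames: `none` is `∂_t`. -/
abbrev FrameIx : Type := Option (Fin 2 × Fin 3)

/-- The structure constants of the cross product. -/
def eps : Fin 3 → Fin 3 → Fin 3 → ℝ :=
  ![![![0, 0, 0], ![0, 0, 1], ![0, -1, 0]], ![![0, 0, -1], ![0, 0, 0], ![1, 0, 0]],
    ![![0, 1, 0], ![-1, 0, 0], ![0, 0, 0]]]

/-- The Kronecker symbol. -/
def dl (i j : Fin 3) : ℝ := if i = j then 1 else 0

theorem dl_comm (i j : Fin 3) : dl i j = dl j i := by simp [dl, eq_comm]

theorem eps_swap (i j k : Fin 3) : eps i k j = -eps i j k := by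
  fin_cases i <;> fin_cases j <;> fin_cases k <;> simp [eps]

theorem eps_swap' (i j k : Fin 3) : eps j i k = -eps i j k := by
  fin_cases i <;> fin_cases j <;> fin_cases k <;> simp [eps]

/-- The three pairings of four indices have squared norm 9, and any two of them have inner product
3. -/
theorem sum_dl_dl_sq (A B C : ℝ) :
    ∑ i, ∑ k, ∑ j, ∑ l, (dl i j * dl k l * A + dl i l * dl k j * B + dl i k * dl j l * C) ^ 2
      = 9 * (A ^ 2 + B ^ 2 + C ^ 2) + 6 * (A * B + B * C + C * A) := by
  simp [dl, Fin.sum_univ_three]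
  ring

/-- The connection forms determined by the connection `G` of the orbits, the shape operator `S` and
the rotation `H` of the frame. -/
def conn (G : Fin 2 → Fin 2 → Fin 2 → ℝ) (S H : Fin 2 → Fin 2 → ℝ) : FrameIx → FrameIx → FrameIx → ℝ
  | none, some (Q, j), some (P, i) => dl i j * H Q P
  | some (P, i), some (Q, j), none => dl i j * S P Q
  | some (P, i), none, some (Q, j) => -(dl i j * S P Q)
  | some (P, i), some (R, k), some (Q, j) => eps i j k * G P Q R
  | _, _, _ => 0

/-- The curvature determined by the connection forms `g` and their derivatives `g'` in the direction
`none`. -/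
def curvAlg (g g' : FrameIx → FrameIx → FrameIx → ℝ) (c a i j : FrameIx) : ℝ :=
  (if c = none then g' a i j else 0) - (if a = none then g' c i j else 0)
    + ∑ k, (g c i k * g a k j - g a i k * g c k j) - ∑ d, (g c d a - g a d c) * g d i j

theorem curvAlg_swap (g g' : FrameIx → FrameIx → FrameIx → ℝ) (c a i j : FrameIx) :
    curvAlg g g' c a i j = -curvAlg g g' a c i j := by
  have h1 : ∑ k, (g c i k * g a k j - g a i k * g c k j)
      = -∑ k, (g a i k * g c k j - g c i k * g a k j) := by
    simp
  have h2 : ∑ d, (g c d a - g a d c) * g d i j = -∑ d, (g a d c - g c d a) * g d i j := by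
    rw [← Finset.sum_neg_distrib]
    exact Finset.sum_congr rfl fun d _ => by ring
  rw [curvAlg, curvAlg, h1, h2]
  ring

theorem curvAlg_skew {g g' : FrameIx → FrameIx → FrameIx → ℝ} (hg : ∀ a i j, g a i j = -g a j i)
    (hg' : ∀ a i j, g' a i j = -g' a j i) (c a i j : FrameIx) :
    curvAlg g g' c a i j = -curvAlg g g' c a j i := by
  have h1 : ∑ k, (g c i k * g a k j - g a i k * g c k j)
      = -∑ k, (g c j k * g a k i - g a j k * g c k i) := by
    rw [← Finset.sum_neg_distrib]
    refine Finset.sum_congr rfl fun k _ => ?_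
    rw [hg c i k, hg a k j, hg a i k, hg c k j]
    ring
  have h2 : ∑ d, (g c d a - g a d c) * g d i j = -∑ d, (g c d a - g a d c) * g d j i := by
    rw [← Finset.sum_neg_distrib]
    refine Finset.sum_congr rfl fun d _ => ?_
    rw [hg d i j]
    ring
  rw [curvAlg, curvAlg, h1, h2, hg' a i j, hg' c i j]
  split_ifs <;> ring

/-! ### Curvature components by type, as multiples of the SO(3)-invariant tensors -/

section Blocks

variable (G G' : Fin 2 → Fin 2 → Fin 2 → ℝ) (S H S' H' : Fin 2 → Fin 2 → ℝ)

/-- The frame space is ℝ ⊕ ℝ² ⊗ ℝ³ with SO(3) acting on ℝ³. Invariance forces each block to be a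
Kronecker symbol, the cross product tensor or a sum of products of two Kronecker symbols, with
coefficients in the ℝ² indices. This and the next three lemmas find them. -/
theorem curvAlg_none_some_some_none (R P : Fin 2) (k m : Fin 3) :
    curvAlg (conn G S H) (conn G' S' H') none (some (R, k)) (some (P, m)) none
      = dl k m * (S' R P + ∑ E, H P E * S R E - ∑ E, (H E R - S R E) * S E P) := by
  simp only [curvAlg, conn, Fintype.sum_option, Fintype.sum_prod_type, reduceCtorEq, if_false,
    if_true, Fin.sum_univ_two, Fin.sum_univ_three]
  fin_cases k <;> fin_cases m <;> simp [dl, eps]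

theorem curvAlg_none_some_some_some (R P Q : Fin 2) (k m n : Fin 3) :
    curvAlg (conn G S H) (conn G' S' H') none (some (R, k)) (some (P, m)) (some (Q, n))
      = eps k n m * (G' R Q P + ∑ E, H P E * G R Q E - ∑ E, G R E P * H E Q
        - ∑ E, (H E R - S R E) * G E Q P) := by
  simp only [curvAlg, conn, Fintype.sum_option, Fintype.sum_prod_type, reduceCtorEq, if_false,
    if_true, Fin.sum_univ_two, Fin.sum_univ_three]
  fin_cases k <;> fin_cases m <;> fin_cases n <;> simp [dl, eps] <;> ring

theorem curvAlg_some_some_some_none (P R Q : Fin 2) (i k j : Fin 3) :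
    curvAlg (conn G S H) (conn G' S' H') (some (P, i)) (some (R, k)) (some (Q, j)) none
      = eps i k j * (∑ M, G P M Q * S R M + ∑ M, G R M Q * S P M
        - ∑ M, (G P R M + G R P M) * S M Q) := by
  simp only [curvAlg, conn, Fintype.sum_option, Fintype.sum_prod_type, reduceCtorEq, if_false,
    Fin.sum_univ_two, Fin.sum_univ_three]
  fin_cases k <;> fin_cases i <;> fin_cases j <;> simp [dl, eps] <;> ring

theorem curvAlg_some_some_some_some (P R Q L : Fin 2) (i k j l : Fin 3) :
    curvAlg (conn G S H) (conn G' S' H') (some (P, i)) (some (R, k)) (some (Q, j)) (some (L, l))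
      = dl i j * dl k l * (- S P Q * S R L - ∑ M, G R M Q * G P L M
          + ∑ M, (G P R M + G R P M) * G M L Q)
       + dl i l * dl k j * (S R Q * S P L + ∑ M, G P M Q * G R L M
          - ∑ M, (G P R M + G R P M) * G M L Q)
       + dl i k * dl j l * (-∑ M, G P M Q * G R L M + ∑ M, G R M Q * G P L M
          + (S P R - S R P) * H Q L) := by
  simp only [curvAlg, conn, Fintype.sum_option, Fintype.sum_prod_type, reduceCtorEq, if_false,
    Fin.sum_univ_two, Fin.sum_univ_three]
  fin_cases k <;> fin_cases i <;> fin_cases j <;> fin_cases l <;> simp [dl, eps] <;> ring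

variable {G G' S S' H H'}

theorem conn_skew (hG : ∀ P Q R, G P Q R = G P R Q) (hH : ∀ P Q, H P Q = -H Q P)
    (a i j : FrameIx) : conn G S H a i j = -conn G S H a j i := by
  rcases a with _ | ⟨P, a⟩ <;> rcases i with _ | ⟨R, i⟩ <;> rcases j with _ | ⟨Q, j⟩ <;>
    simp only [conn, neg_zero, neg_neg]
  · rw [hH, dl_comm]
    ring
  · rw [hG, eps_swap]
    ring

theorem sum_dl_block (Y : Fin 2 → Fin 2 → ℝ) :
    ∑ x : Fin 2 × Fin 3, ∑ y : Fin 2 × Fin 3, (dl x.2 y.2 * Y x.1 y.1) ^ 2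
      = 3 * ∑ P, ∑ R, Y P R ^ 2 := by
  simp only [Fintype.sum_prod_type, Fin.sum_univ_two, Fin.sum_univ_three]
  simp [dl]
  ring

theorem sum_eps_block (X : Fin 2 → Fin 2 → Fin 2 → ℝ) :
    ∑ x : Fin 2 × Fin 3, ∑ y : Fin 2 × Fin 3, ∑ z : Fin 2 × Fin 3,
      (eps x.2 y.2 z.2 * X x.1 y.1 z.1) ^ 2 = 6 * ∑ P, ∑ Q, ∑ R, X P Q R ^ 2 := by
  simp only [Fintype.sum_prod_type, Fin.sum_univ_two, Fin.sum_univ_three]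
  simp [eps]
  ring

theorem sum_dl_dl_block (A B C : Fin 2 → Fin 2 → Fin 2 → Fin 2 → ℝ) :
    ∑ x : Fin 2 × Fin 3, ∑ y : Fin 2 × Fin 3, ∑ z : Fin 2 × Fin 3, ∑ w : Fin 2 × Fin 3,
      (dl x.2 z.2 * dl y.2 w.2 * A x.1 y.1 z.1 w.1 + dl x.2 w.2 * dl y.2 z.2 * B x.1 y.1 z.1 w.1
        + dl x.2 y.2 * dl z.2 w.2 * C x.1 y.1 z.1 w.1) ^ 2
      = ∑ P, ∑ R, ∑ Q, ∑ L, (9 * (A P R Q L ^ 2 + B P R Q L ^ 2 + C P R Q L ^ 2)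
        + 6 * (A P R Q L * B P R Q L + B P R Q L * C P R Q L + C P R Q L * A P R Q L)) := by
  simp only [Fintype.sum_prod_type, Fin.sum_univ_two, Finset.sum_add_distrib, sum_dl_dl_sq]
  ring

variable (G G' S S' H H')

/-- The blocks of the curvature. -/
def curvY (R P : Fin 2) : ℝ := S' R P + ∑ E, H P E * S R E - ∑ E, (H E R - S R E) * S E P

/-- The blocks of the curvature. See `curvY`. -/
def curvX (R Q P : Fin 2) : ℝ := G' R Q P + ∑ E, H P E * G R Q E - ∑ E, G R E P * H E Q
  - ∑ E, (H E R - S R E) * G E Q P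

/-- The blocks of the curvature. See `curvY`. -/
def curvZ (P R Q : Fin 2) : ℝ := ∑ M, G P M Q * S R M + ∑ M, G R M Q * S P M
  - ∑ M, (G P R M + G R P M) * S M Q

/-- The blocks of the curvature. See `curvY`. -/
def curvA (P R Q L : Fin 2) : ℝ := - S P Q * S R L - ∑ M, G R M Q * G P L M
  + ∑ M, (G P R M + G R P M) * G M L Q

/-- The blocks of the curvature. See `curvY`. -/
def curvB (P R Q L : Fin 2) : ℝ := S R Q * S P L + ∑ M, G P M Q * G R L M
  - ∑ M, (G P R M + G R P M) * G M L Q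

/-- The blocks of the curvature. See `curvY`. -/
def curvC (P R Q L : Fin 2) : ℝ := -∑ M, G P M Q * G R L M + ∑ M, G R M Q * G P L M
  + (S P R - S R P) * H Q L

variable {G G' S S' H H'}

/-- The factors 12 count positions times tensor norms. Block Y occurs in 4 places, with `none` once
in each index pair, and the Kronecker symbol has squared norm 3. Blocks X and Z occur in 2 places
each, and the cross product tensor has squared norm 6. -/
theorem sum_curvAlg_sq (hG : ∀ P Q R, G P Q R = G P R Q) (hG' : ∀ P Q R, G' P Q R = G' P R Q)
    (hH : ∀ P Q, H P Q = -H Q P) (hH' : ∀ P Q, H' P Q = -H' Q P) :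
    ∑ c, ∑ a, ∑ i, ∑ j, curvAlg (conn G S H) (conn G' S' H') c a i j ^ 2
      = 12 * ∑ P, ∑ R, curvY S H S' P R ^ 2 + 12 * ∑ P, ∑ Q, ∑ R, curvX G G' S H P Q R ^ 2
        + 12 * ∑ P, ∑ Q, ∑ R, curvZ G S P Q R ^ 2
        + ∑ P, ∑ R, ∑ Q, ∑ L, (9 * (curvA G S P R Q L ^ 2 + curvB G S P R Q L ^ 2
          + curvC G S H P R Q L ^ 2) + 6 * (curvA G S P R Q L * curvB G S P R Q L
          + curvB G S P R Q L * curvC G S H P R Q L + curvC G S H P R Q L * curvA G S P R Q L)) := by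
  have h1 := curvAlg_swap (conn G S H) (conn G' S' H')
  have h2 := curvAlg_skew (conn_skew (S := S) hG hH) (conn_skew (S := S') hG' hH')
  have h3 : ∀ c i, curvAlg (conn G S H) (conn G' S' H') none none i c = 0 := fun c i => by
    linarith [h1 none none i c]
  have h4 : ∀ c a i, curvAlg (conn G S H) (conn G' S' H') c a i i = 0 := fun c a i => by
    linarith [h2 c a i i]
  have h5 : ∀ c i j, curvAlg (conn G S H) (conn G' S' H') (some c) none i j ^ 2 =
    curvAlg (conn G S H) (conn G' S' H') none (some c) i j ^ 2 := fun c i j => by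
    rw [h1 (some c) none, neg_sq]
  have h6 : ∀ c a i, curvAlg (conn G S H) (conn G' S' H') c a none i ^ 2 =
    curvAlg (conn G S H) (conn G' S' H') c a i none ^ 2 := fun c a i => by
    rw [h2 c a none, neg_sq]
  have hY : ∀ x y : Fin 2 × Fin 3, curvAlg (conn G S H) (conn G' S' H') none (some x) (some y) none
      = dl x.2 y.2 * curvY S H S' x.1 y.1 := fun x y => curvAlg_none_some_some_none ..
  have hX : ∀ x y z : Fin 2 × Fin 3,
      curvAlg (conn G S H) (conn G' S' H') none (some x) (some z) (some y)
      = eps x.2 y.2 z.2 * curvX G G' S H x.1 y.1 z.1 :=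
    fun x y z => curvAlg_none_some_some_some ..
  have hZ : ∀ x y z : Fin 2 × Fin 3,
      curvAlg (conn G S H) (conn G' S' H') (some x) (some y) (some z) none
      = eps x.2 y.2 z.2 * curvZ G S x.1 y.1 z.1 :=
    fun x y z => curvAlg_some_some_some_none ..
  have hA : ∀ x y z w : Fin 2 × Fin 3,
      curvAlg (conn G S H) (conn G' S' H') (some x) (some y) (some z) (some w)
      = dl x.2 z.2 * dl y.2 w.2 * curvA G S x.1 y.1 z.1 w.1
        + dl x.2 w.2 * dl y.2 z.2 * curvB G S x.1 y.1 z.1 w.1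
        + dl x.2 y.2 * dl z.2 w.2 * curvC G S H x.1 y.1 z.1 w.1 :=
    fun x y z w => curvAlg_some_some_some_some ..
  have hX' : ∑ x : Fin 2 × Fin 3, ∑ y : Fin 2 × Fin 3, ∑ z : Fin 2 × Fin 3,
      curvAlg (conn G S H) (conn G' S' H') none (some x) (some y) (some z) ^ 2
      = 6 * ∑ P, ∑ Q, ∑ R, curvX G G' S H P Q R ^ 2 := by
    rw [← sum_eps_block]
    refine Finset.sum_congr rfl fun x _ => ?_
    rw [Finset.sum_comm]
    simp only [hX]
  rw [← sum_dl_dl_block (curvA G S) (curvB G S) (curvC G S H)]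
  simp only [Fintype.sum_option, h3, h4, h5, h6, Finset.sum_add_distrib, hX']
  simp only [hY, hZ, hA, sum_dl_block, sum_eps_block]
  simp only [ne_eq, OfNat.ofNat_ne_zero, not_false_eq_true, zero_pow, Finset.sum_const_zero]
  ring

end Blocks

/-- The connection of the orbits. -/
def orbitConn (U V W K : ℝ) : Fin 2 → Fin 2 → Fin 2 → ℝ :=
  ![![![U / 2, 0], ![0, -K / 2]], ![![-V, K / 2], ![K / 2, W / 2]]]

/-- The shape operator of the orbits. -/
def shapeOp (α β σ : ℝ) : Fin 2 → Fin 2 → ℝ := ![![α, σ], ![σ, β]]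

/-- The rotation of the frame. -/
def rotOp (σ : ℝ) : Fin 2 → Fin 2 → ℝ := ![![0, -σ], ![σ, 0]]

/-! ### The squared norm of the curvature in terms of the structure constants -/

section CurvatureNorm

variable (U V W K α β σ U' V' W' K' α' β' σ' : ℝ)

/-- The connection forms of the orthonormal frame. -/
abbrev frameConn : FrameIx → FrameIx → FrameIx → ℝ :=
  conn (orbitConn U V W K) (shapeOp α β σ) (rotOp σ)

theorem orbitConn_symm (P Q R : Fin 2) : orbitConn U V W K P Q R = orbitConn U V W K P R Q := by
  fin_cases P <;> fin_cases Q <;> fin_cases R <;> rfl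

theorem rotOp_skew (P Q : Fin 2) : rotOp σ P Q = -rotOp σ Q P := by
  fin_cases P <;> fin_cases Q <;> simp [rotOp]

/-- The relation K U = V (V + W) is the bracket equation for two fields of the second type, read on
the first sphere. -/
theorem sum_frameConn_sq (hU : U' = -α * U) (hV : V' = 2 * σ * U - β * V) (hW : W' = -β * W)
    (hK : K' = (α - 2 * β) * K + 2 * σ * (2 * V + W)) (hKU : K * U = V * (V + W)) :
    ∑ c, ∑ a, ∑ i, ∑ j, curvAlg (frameConn U V W K α β σ)
      (frameConn U' V' W' K' α' β' σ') c a i j ^ 2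
    = 12 * ((-α ^ 2 - α' + σ ^ 2) ^ 2 + 2 * (-2 * α * σ - σ') ^ 2 + (-β ^ 2 - β' - 3 * σ ^ 2) ^ 2
      + (-α * β + σ ^ 2) ^ 2 + 2 * (-K * (K + U) / 4) ^ 2 + (U ^ 2 / 4 - α ^ 2) ^ 2
      + 4 * (-α * σ) ^ 2 + 2 * (-K ^ 2 / 4 - K * U / 2 - σ ^ 2) ^ 2 + 2 * (K ^ 2 / 4 - α * β) ^ 2
      + 2 * (-K * U / 4 - σ ^ 2) ^ 2 + 4 * (K * V / 2 + K * W / 4 - β * σ) ^ 2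
      + (-3 * K ^ 2 / 4 + W ^ 2 / 4 - β ^ 2) ^ 2 + 12 * (σ * (K + U) / 2) ^ 2
      + 3 * (K * (α - β) + 2 * V * σ + W * σ) ^ 2) := by
  rw [sum_curvAlg_sq (orbitConn_symm _ _ _ _) (orbitConn_symm _ _ _ _) (rotOp_skew _)
    (rotOp_skew _)]
  simp only [curvY, curvX, curvZ, curvA, curvB, curvC, Fin.sum_univ_two, orbitConn, shapeOp, rotOp,
    Matrix.cons_val_zero, Matrix.cons_val_one, hU, hV, hW, hK]
  linear_combination (12 * (-K ^ 2 / 2 - V ^ 2 - V * W - 2 * σ ^ 2)) * hKU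

end CurvatureNorm

end


noncomputable section

/-! ### The curvature invariant along solutions -/

section Invariant

/-- `y' / (2 y)`. -/
def eShape (p x y : ℝ) : ℝ :=
  (p * (bb x y ^ 2 + aa x y * cc x y) - (aa x y * bb x y - bb x y * cc x y)) / qq x y

/-- `x' / (2 y)`. -/
def fShape (p x y : ℝ) : ℝ :=
  (p * (aa x y * bb x y - bb x y * cc x y) + (bb x y ^ 2 + aa x y * cc x y)) / qq x y

theorem yDot_eq (p x y : ℝ) : yDot p x y = 2 * y * eShape p x y := by
  unfold yDot eShape
  ring

theorem xDot_eq (p x y : ℝ) : xDot p x y = 2 * y * fShape p x y := by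
  unfold xDot fShape
  ring

/-- The two-squares identity (b² + ac)² + (ab − bc)² = (a² + b²)(b² + c²). E and F are the entries
of the traceless part of the shape operator on ℝ²; hence the role of M. -/
theorem eShape_sq_add_fShape_sq (p : ℝ) {x y : ℝ} (h0 : 0 < y) :
    eShape p x y ^ 2 + fShape p x y ^ 2 = (1 + p ^ 2) * shapeRatio x y := by
  have h2 : qq x y ≠ 0 := (qq_pos h0).ne'
  simp only [eShape, fShape, shapeRatio]
  field_simp
  rw [qq_eq]
  ring

/-- The components of the Weyl curvature. -/
def wZero (p x y : ℝ) : ℝ := (1 + p ^ 2) * (1 - shapeRatio x y)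

/-- The components of the Weyl curvature. See `wZero`. -/
def wRe (p x y : ℝ) : ℝ :=
  (1 + p ^ 2) * (bb x y ^ 2 - cc x y ^ 2) / qq x y + fShape p x y - p * eShape p x y

/-- The components of the Weyl curvature. See `wZero`. -/
def wIm (p x y : ℝ) : ℝ :=
  -(2 * (1 + p ^ 2) * bb x y * cc x y) / qq x y + eShape p x y + p * fShape p x y

/-- The squared norm of the curvature. -/
def curvInvariant (p x y : ℝ) : ℝ :=
  84 + 120 * wZero p x y ^ 2 + 288 * (wRe p x y ^ 2 + wIm p x y ^ 2)

/-- The derivative of `eShape` along a solution. -/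
def eDot (p x y : ℝ) : ℝ :=
  (p - eShape p x y) ^ 2 - fShape p x y ^ 2 + 1 + 2 * wRe p x y + pDot p x y

/-- The derivative of `fShape` along a solution. -/
def fDot (p x y : ℝ) : ℝ := -2 * (p - eShape p x y) * fShape p x y - 2 * wIm p x y

variable {p x y : ℝ → ℝ} {t : ℝ}

/-- With `hasDerivAt_fShape` this is the traceless part of the Riccati equation S' + S² + R = 0 for
the shape operator, the curvature term being expressed through the Weyl components. -/
theorem hasDerivAt_eShape (hp : HasDerivAt p (pDot (p t) (x t) (y t)) t)
    (hx : HasDerivAt x (xDot (p t) (x t) (y t)) t) (hy : HasDerivAt y (yDot (p t) (x t) (y t)) t)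
    (h0 : 0 < y t) :
    HasDerivAt (fun s => eShape (p s) (x s) (y s)) (eDot (p t) (x t) (y t)) t := by
  have hq := hasDerivAt_qq hx hy
  have ha := ((hx.pow 2).add hx).sub (hy.pow 2)
  have hb := hy.mul ((hx.const_mul 2).add_const 1)
  have hc := (((hx.pow 2).add hx).const_mul 3).add (hy.pow 2)
  have h2 : qq (x t) (y t) ≠ 0 := (qq_pos h0).ne'
  refine (((hp.mul ((hb.pow 2).add (ha.mul hc))).sub ((ha.mul hb).sub (hb.mul hc))).div
    hq h2).congr_deriv ?_
  simp only [eDot, wRe, eShape, fShape, pDot, xDot, yDot, shapeRatio, Pi.pow_apply, Pi.mul_apply,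
    Pi.add_apply, Pi.sub_apply]
  generalize p t = P at *
  generalize x t = X at *
  generalize y t = Y at *
  have h0' : Y ≠ 0 := h0.ne'
  field_simp
  simp only [aa, bb, cc, qq]
  ring

theorem hasDerivAt_fShape (hp : HasDerivAt p (pDot (p t) (x t) (y t)) t)
    (hx : HasDerivAt x (xDot (p t) (x t) (y t)) t) (hy : HasDerivAt y (yDot (p t) (x t) (y t)) t)
    (h0 : 0 < y t) :
    HasDerivAt (fun s => fShape (p s) (x s) (y s)) (fDot (p t) (x t) (y t)) t := by
  have hq := hasDerivAt_qq hx hy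
  have ha := ((hx.pow 2).add hx).sub (hy.pow 2)
  have hb := hy.mul ((hx.const_mul 2).add_const 1)
  have hc := (((hx.pow 2).add hx).const_mul 3).add (hy.pow 2)
  have h2 : qq (x t) (y t) ≠ 0 := (qq_pos h0).ne'
  refine (((hp.mul ((ha.mul hb).sub (hb.mul hc))).add ((hb.pow 2).add (ha.mul hc))).div
    hq h2).congr_deriv ?_
  simp only [fDot, wIm, eShape, fShape, pDot, xDot, yDot, shapeRatio, Pi.pow_apply, Pi.mul_apply,
    Pi.add_apply, Pi.sub_apply]
  generalize p t = P at *
  generalize x t = X at *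
  generalize y t = Y at *
  have h0' : Y ≠ 0 := h0.ne'
  field_simp
  simp only [aa, bb, cc, qq]
  ring

/-- The scale `r`, the norm of `ξ`. -/
def orbitU (p x y : ℝ) : ℝ := 2 * √(y / areaD p x y)

/-- Since |ξ|² = D/y, U equals 2/|ξ|; here D is eliminated to leave a rational function. -/
theorem orbitU_sq (p : ℝ) {x y : ℝ} (h0 : 0 < y) :
    orbitU p x y ^ 2 = 16 * y ^ 4 * (1 + p ^ 2) / qq x y := by
  have h1 := areaD_pos (p := p) (x := x) h0
  have h2 : qq x y ≠ 0 := (qq_pos h0).ne'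
  rw [orbitU, mul_pow, Real.sq_sqrt (by positivity), areaD]
  field_simp
  norm_num

theorem orbitU_pos (p x : ℝ) {y : ℝ} (h0 : 0 < y) : 0 < orbitU p x y := by
  have h1 := areaD_pos (p := p) (x := x) h0
  unfold orbitU
  positivity

theorem hasDerivAt_orbitU (hp : HasDerivAt p (pDot (p t) (x t) (y t)) t)
    (hx : HasDerivAt x (xDot (p t) (x t) (y t)) t) (hy : HasDerivAt y (yDot (p t) (x t) (y t)) t)
    (h0 : 0 < y t) :
    HasDerivAt (fun s => orbitU (p s) (x s) (y s))
      (-(p t - eShape (p t) (x t) (y t)) * orbitU (p t) (x t) (y t)) t := by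
  have hD := hasDerivAt_areaD hp hx hy h0
  have h1 := areaD_pos (p := p t) (x := x t) h0
  have h := ((hy.div hD h1.ne').sqrt (div_pos h0 h1).ne').const_mul 2
  refine h.congr_deriv ?_
  have h3 : 0 < √(y t / areaD (p t) (x t) (y t)) := Real.sqrt_pos.2 (div_pos h0 h1)
  have h4 := Real.sq_sqrt (div_pos h0 h1).le
  rw [orbitU, yDot_eq]
  simp only [Pi.div_apply]
  generalize √(y t / areaD (p t) (x t) (y t)) = r at *
  generalize areaD (p t) (x t) (y t) = D at *
  field_simp at h4 ⊢
  rw [h4]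
  ring

/-- The constant terms 1 are the round curvature and the rest is linear in the Weyl components and
two auxiliary quantities g, h. These are not determined by the Weyl components, but the seventh
identity places a translate of (g, h) on a circle whose radius they determine. -/
theorem curvature_components (p : ℝ) {x y U α β σ V W K g h : ℝ} (h0 : 0 < y)
    (hU : U ^ 2 = 16 * y ^ 4 * (1 + p ^ 2) / qq x y) (hα : α = p - eShape p x y)
    (hβ : β = p + eShape p x y) (hσ : σ = fShape p x y) (hV : V = U * x / y) (hW : W = U / y)
    (hK : K = U * (x ^ 2 + x) / y ^ 2) (hg : g = -K * U / 4 - σ ^ 2) (hh : h = -α * σ) :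
    -K * (K + U) / 4 = wZero p x y / 2 ∧
    U ^ 2 / 4 - α ^ 2 = 1 + 2 * wZero p x y - wRe p x y - g ∧
    -K ^ 2 / 4 - K * U / 2 - σ ^ 2 = g + wZero p x y / 2 ∧
    K ^ 2 / 4 - α * β = g + 1 - 3 / 2 * wZero p x y ∧
    -3 * K ^ 2 / 4 + W ^ 2 / 4 - β ^ 2 = 1 + 2 * wZero p x y + wRe p x y - g ∧
    K * V / 2 + K * W / 4 - β * σ = -wIm p x y - h ∧
    (g - 3 / 4 * wZero p x y) ^ 2 + (h + wIm p x y / 2) ^ 2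
      = (wRe p x y ^ 2 + wIm p x y ^ 2) / 4 ∧
    12 * (σ * (K + U) / 2) ^ 2 + 3 * (K * (α - β) + 2 * V * σ + W * σ) ^ 2
      = 12 * (wRe p x y ^ 2 + wIm p x y ^ 2) := by
  have h2 : qq x y ≠ 0 := (qq_pos h0).ne'
  have h0' : y ≠ 0 := h0.ne'
  have hKU : K * U = (x ^ 2 + x) / y ^ 2 * U ^ 2 := by
    rw [hK]
    ring
  -- U involves a square root. All quantities below are even in U, so rewriting them through U²
  -- makes the identities rational in (p, x, y).
  have hKK : K ^ 2 = ((x ^ 2 + x) / y ^ 2) ^ 2 * U ^ 2 := by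
    rw [hK]
    ring
  have hWW : W ^ 2 = U ^ 2 / y ^ 2 := by
    rw [hW]
    ring
  have hKV : K * V / 2 + K * W / 4 = (x ^ 2 + x) * (2 * x + 1) / (4 * y ^ 3) * U ^ 2 := by
    rw [hK, hV, hW]
    field_simp
    ring
  have hO : 12 * (σ * (K + U) / 2) ^ 2 + 3 * (K * (α - β) + 2 * V * σ + W * σ) ^ 2
      = U ^ 2 * (3 * (σ * (x ^ 2 + x + y ^ 2) / y ^ 2) ^ 2
        + 3 * ((x ^ 2 + x) / y ^ 2 * (α - β) + (2 * x + 1) / y * σ) ^ 2) := by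
    rw [hK, hV, hW]
    field_simp
    ring
  have e2 : -K * (K + U) / 4 = -(K ^ 2 + K * U) / 4 := by ring
  refine ⟨?_, ?_, ?_, ?_, ?_, ?_, ?_, ?_⟩
  · rw [e2, hKU, hKK, hU, wZero, shapeRatio]
    field_simp
    simp only [qq_eq, aa, bb, cc]
    ring
  · simp only [hg, neg_mul, hKU, hU, hα, hσ, wZero, shapeRatio, wRe, eShape, fShape]
    field_simp
    simp only [qq, aa, bb, cc]
    ring
  · simp only [hg, neg_mul, hKU, hKK, hU, wZero, shapeRatio, hσ]
    field_simp
    simp only [qq, bb, cc]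
    ring
  · simp only [hg, neg_mul, hKU, hKK, hU, hα, hβ, hσ, wZero, shapeRatio, eShape, fShape]
    field_simp
    simp only [qq, aa, bb, cc]
    ring
  · simp only [hg, neg_mul, hKU, hKK, hWW, hU, hβ, hσ, wZero, shapeRatio, wRe, eShape, fShape]
    field_simp
    simp only [qq, aa, bb, cc]
    ring
  · rw [hKV, hU]
    simp only [hh, hα, hβ, hσ, wIm, eShape, fShape]
    field_simp
    simp only [qq, aa, bb, cc]
    ring
  · simp only [hg, hh, neg_mul, hKU, hU, hα, hσ, wZero, shapeRatio, wRe, wIm, eShape, fShape]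
    field_simp
    simp only [qq, aa, bb, cc]
    ring
  · rw [hO, hU]
    simp only [hα, hβ, hσ, wRe, wIm, eShape, fShape]
    field_simp
    simp only [qq, aa, bb, cc]
    ring

/-- In the total, g and h occur only through the quadratic combination fixed by
`curvature_components`. What remains is 84, the round value, plus the contribution of the Weyl
tensor. -/
theorem sum_frameConn_sq_state (p : ℝ) {x y U : ℝ} (h0 : 0 < y)
    (hU : U ^ 2 = 16 * y ^ 4 * (1 + p ^ 2) / qq x y) {α β σ V W K U' V' W' K' α' β' σ' : ℝ}
    (hα : α = p - eShape p x y) (hβ : β = p + eShape p x y) (hσ : σ = fShape p x y)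
    (hV : V = U * x / y) (hW : W = U / y) (hK : K = U * (x ^ 2 + x) / y ^ 2)
    (hU' : U' = -α * U) (hV' : V' = 2 * σ * U - β * V) (hW' : W' = -β * W)
    (hK' : K' = (α - 2 * β) * K + 2 * σ * (2 * V + W))
    (hα' : α' = pDot p x y - eDot p x y) (hβ' : β' = pDot p x y + eDot p x y)
    (hσ' : σ' = fDot p x y) :
    ∑ c, ∑ a, ∑ i, ∑ j, curvAlg (frameConn U V W K α β σ)
      (frameConn U' V' W' K' α' β' σ') c a i j ^ 2 = curvInvariant p x y := by
  have hKU : K * U = V * (V + W) := by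
    rw [hK, hV, hW]
    field_simp
  have hEF := eShape_sq_add_fShape_sq p (x := x) h0
  obtain ⟨h1, h2, h3, h4, h5, h6, h7, h8⟩ := curvature_components p h0 hU hα hβ hσ hV hW hK rfl rfl
  rw [sum_frameConn_sq _ _ _ _ _ _ _ _ _ _ _ _ _ _ hU' hV' hW' hK' hKU]
  -- The radial curvatures, from the Riccati equation; for `d3` the traceless norm E² + F² is needed
  -- as well.
  have d1 : -α ^ 2 - α' + σ ^ 2 = 1 + 2 * wRe p x y := by
    rw [hα', eDot, ← hσ, ← hα]
    ring
  have d2 : -2 * α * σ - σ' = 2 * wIm p x y := by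
    rw [hσ', fDot, ← hσ, ← hα]
    ring
  have d3 : -β ^ 2 - β' - 3 * σ ^ 2 = 1 - 2 * wRe p x y := by
    rw [hβ', eDot, pDot, hβ]
    rw [hσ]
    linear_combination (-2) * hEF
  have e1 : -α * β + σ ^ 2 = 1 - wZero p x y := by
    rw [hα, hβ, hσ, wZero]
    linear_combination hEF
  rw [d1, d2, d3, e1, h1, h2, h3, h4, h5, h6, curvInvariant]
  linear_combination 12 * h8 + 96 * h7

end Invariant

end


noncomputable section

/-! ### Invariant frames on the ambient space -/

section TubeFrame

/-- The frame `∂_t`, `f_P p e_i + g_P q e_i`, where `p`, `q` are the two quaternions. -/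
def tubeFrame (f g : Fin 2 → ℝ → ℝ) : FrameIx → Amb → Amb
  | none, _ => (1, 0, 0)
  | some (P, i), z => (0, f P z.1 • (z.2.1 * sp1Basis i), g P z.1 • (z.2.2 * sp1Basis i))

theorem tubeFrame_fst (f g : Fin 2 → ℝ → ℝ) (c : FrameIx) (z : Amb) :
    (tubeFrame f g c z).1 = if c = none then 1 else 0 := by
  rcases c with _ | ⟨P, i⟩ <;> simp [tubeFrame]

/-- The components of the imaginary part of a quaternion. -/
def imPart (i : Fin 3) : ℍ[ℝ] →ₗ[ℝ] ℝ where
  toFun q := ![q.imI, q.imJ, q.imK] i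
  map_add' p q := by fin_cases i <;> simp
  map_smul' r q := by fin_cases i <;> simp

/-- The coframe dual to `tubeFrame`. -/
def tubeCoframe (f g : Fin 2 → ℝ → ℝ) (z v : Amb) : FrameIx → ℝ
  | none => v.1
  | some (P, i) =>
    ((Quaternion.normSq z.2.1)⁻¹ * imPart i (star z.2.1 * v.2.1) * ![g 1 z.1, -g 0 z.1] P
      + (Quaternion.normSq z.2.2)⁻¹ * imPart i (star z.2.2 * v.2.2) * ![-f 1 z.1, f 0 z.1] P)
      / (f 0 z.1 * g 1 z.1 - f 1 z.1 * g 0 z.1)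

theorem tubeCoframe_sum {ι : Type*} (s : Finset ι) (f g : Fin 2 → ℝ → ℝ) (z : Amb) (r : ι → ℝ)
    (v : ι → Amb) (b : FrameIx) :
    tubeCoframe f g z (∑ a ∈ s, r a • v a) b = ∑ a ∈ s, r a * tubeCoframe f g z (v a) b := by
  rcases b with _ | ⟨P, i⟩
  · simp [tubeCoframe, Prod.fst_sum]
  · simp only [tubeCoframe, Prod.snd_sum, Prod.fst_sum, Finset.mul_sum, map_sum, Prod.smul_snd,
      Prod.smul_fst, mul_smul_comm, map_smul, Finset.sum_mul, ← Finset.sum_add_distrib,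
      Finset.sum_div, smul_eq_mul]
    exact Finset.sum_congr rfl fun a _ => by ring

variable {f g : Fin 2 → ℝ → ℝ} {z : Amb}

theorem star_mul_mul_sp1Basis (q : ℍ[ℝ]) (i : Fin 3) :
    star q * (q * sp1Basis i) = Quaternion.normSq q • sp1Basis i := by
  rw [← mul_assoc, Quaternion.star_mul_self, Quaternion.coe_mul_eq_smul]

theorem re_sp1Basis (i : Fin 3) : (sp1Basis i).re = 0 := by
  fin_cases i <;> rfl

theorem imI_sp1Basis (i : Fin 3) : (sp1Basis i).imI = ![1, 0, 0] i := by
  fin_cases i <;> rfl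

theorem imJ_sp1Basis (i : Fin 3) : (sp1Basis i).imJ = ![0, 1, 0] i := by
  fin_cases i <;> rfl

theorem imK_sp1Basis (i : Fin 3) : (sp1Basis i).imK = ![0, 0, 1] i := by
  fin_cases i <;> rfl

theorem imPart_sp1Basis (i k : Fin 3) : imPart k (sp1Basis i) = if k = i then 1 else 0 := by
  change ![(sp1Basis i).imI, (sp1Basis i).imJ, (sp1Basis i).imK] k = _
  rw [imI_sp1Basis, imJ_sp1Basis, imK_sp1Basis]
  fin_cases i <;> fin_cases k <;> simp

theorem eq_sum_imPart {q : ℍ[ℝ]} (h : q.re = 0) : q = ∑ i, imPart i q • sp1Basis i := by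
  ext <;> simp [Fin.sum_univ_three, re_sp1Basis, imI_sp1Basis, imJ_sp1Basis, imK_sp1Basis, h,
    imPart]

theorem tubeCoframe_tubeFrame (hz : z ∈ punctured)
    (hd : f 0 z.1 * g 1 z.1 - f 1 z.1 * g 0 z.1 ≠ 0) (a b : FrameIx) :
    tubeCoframe f g z (tubeFrame f g a z) b = if b = a then 1 else 0 := by
  have h1 : Quaternion.normSq z.2.1 ≠ 0 := Quaternion.normSq_ne_zero.2 hz.1
  have h2 : Quaternion.normSq z.2.2 ≠ 0 := Quaternion.normSq_ne_zero.2 hz.2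
  rcases a with _ | ⟨P, i⟩ <;> rcases b with _ | ⟨Q, k⟩
  · simp [tubeCoframe, tubeFrame]
  · simp [tubeCoframe, tubeFrame]
  · simp [tubeCoframe, tubeFrame]
  · simp only [tubeCoframe, tubeFrame, mul_smul_comm, star_mul_mul_sp1Basis, map_smul,
      imPart_sp1Basis, smul_eq_mul]
    rw [div_eq_iff hd]
    by_cases hk : k = i
    · simp only [hk, if_true]
      fin_cases P <;> fin_cases Q <;> simp <;> field_simp <;> ring
    · have : ¬ (Q = P ∧ k = i) := fun h => hk h.2
      simp [hk]

theorem linearIndependent_tubeFrame (hz : z ∈ punctured)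
    (hd : f 0 z.1 * g 1 z.1 - f 1 z.1 * g 0 z.1 ≠ 0) :
    LinearIndependent ℝ fun a => tubeFrame f g a z := by
  rw [Fintype.linearIndependent_iff]
  intro r hr b
  have h := congrArg (fun v => tubeCoframe f g z v b) hr
  simp only [tubeCoframe_sum, tubeCoframe_tubeFrame hz hd] at h
  simp at h
  rw [h]
  rcases b with _ | ⟨P, i⟩ <;> simp [tubeCoframe]

theorem sum_smul_tubeFrame (f g : Fin 2 → ℝ → ℝ) (z : Amb) (r : FrameIx → ℝ) :
    ∑ d, r d • tubeFrame f g d z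
      = (r none, z.2.1 * ∑ m, (∑ P, r (some (P, m)) * f P z.1) • sp1Basis m,
        z.2.2 * ∑ m, (∑ P, r (some (P, m)) * g P z.1) • sp1Basis m) := by
  simp only [Fintype.sum_option, Fintype.sum_prod_type, tubeFrame]
  refine Prod.ext ?_ (Prod.ext ?_ ?_)
  · simp [Prod.fst_sum]
  · simp only [Prod.snd_add, Prod.snd_sum, Prod.smul_snd, Prod.fst_add, Prod.fst_sum, Prod.smul_fst,
      smul_zero, zero_add, Finset.mul_sum, mul_smul_comm, Finset.sum_smul, smul_smul]
    exact Finset.sum_comm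
  · simp only [Prod.snd_add, Prod.snd_sum, Prod.smul_snd,
      smul_zero, zero_add, Finset.mul_sum, mul_smul_comm, Finset.sum_smul, smul_smul]
    exact Finset.sum_comm

/-- The ambient space has dimension 9, and the seven fields span only the vectors tangent to the
product of spheres through z. The two hypotheses on real parts state this tangency. -/
theorem sum_tubeCoframe_smul {v : Amb} (hz : z ∈ punctured)
    (hd : f 0 z.1 * g 1 z.1 - f 1 z.1 * g 0 z.1 ≠ 0) (h1 : (star z.2.1 * v.2.1).re = 0)
    (h2 : (star z.2.2 * v.2.2).re = 0) :
    ∑ b, tubeCoframe f g z v b • tubeFrame f g b z = v := by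
  have n1 : Quaternion.normSq z.2.1 ≠ 0 := Quaternion.normSq_ne_zero.2 hz.1
  have n2 : Quaternion.normSq z.2.2 ≠ 0 := Quaternion.normSq_ne_zero.2 hz.2
  have key : ∀ p w : ℍ[ℝ], Quaternion.normSq p ≠ 0 → (star p * w).re = 0 →
      p * ∑ m, ((Quaternion.normSq p)⁻¹ * imPart m (star p * w)) • sp1Basis m = w := by
    intro p w hp hw
    simp only [← smul_smul]
    rw [← Finset.smul_sum, ← eq_sum_imPart hw, mul_smul_comm, ← mul_assoc, Quaternion.self_mul_star,
      Quaternion.coe_mul_eq_smul, smul_smul, inv_mul_cancel₀ hp, one_smul]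
  rw [sum_smul_tubeFrame]
  refine Prod.ext rfl (Prod.ext ?_ ?_)
  · refine (congrArg (z.2.1 * ·) (Finset.sum_congr rfl fun m _ => ?_)).trans
      (key z.2.1 v.2.1 n1 h1)
    congr 1
    simp only [tubeCoframe, Fin.sum_univ_two]
    rw [div_mul_eq_mul_div, div_mul_eq_mul_div, ← add_div, div_eq_iff hd]
    simp
    ring
  · refine (congrArg (z.2.2 * ·) (Finset.sum_congr rfl fun m _ => ?_)).trans
      (key z.2.2 v.2.2 n2 h2)
    congr 1
    simp only [tubeCoframe, Fin.sum_univ_two]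
    rw [div_mul_eq_mul_div, div_mul_eq_mul_div, ← add_div, div_eq_iff hd]
    simp
    ring

theorem hasFDerivAt_smul_mul_const {f : ℝ → ℝ} {f' : ℝ} {L : Amb →L[ℝ] ℍ[ℝ]} (e : ℍ[ℝ])
    (hf : HasDerivAt f f' z.1) :
    HasFDerivAt (fun z : Amb => f z.1 • (L z * e))
      (f z.1 • ((ContinuousLinearMap.mul ℝ ℍ[ℝ]).flip e ∘L L)
        + (f' • ContinuousLinearMap.fst ℝ ℝ (ℍ[ℝ] × ℍ[ℝ])).smulRight (L z * e)) z := by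
  have h1 : HasFDerivAt (fun z : Amb => f z.1) (f' • ContinuousLinearMap.fst ℝ ℝ (ℍ[ℝ] × ℍ[ℝ])) z :=
    hf.comp_hasFDerivAt z hasFDerivAt_fst
  have h2 : HasFDerivAt (fun z : Amb => L z * e) ((ContinuousLinearMap.mul ℝ ℍ[ℝ]).flip e ∘L L) z :=
    ((ContinuousLinearMap.mul ℝ ℍ[ℝ]).flip e ∘L L).hasFDerivAt
  exact h1.smul h2

theorem hasFDerivAt_tubeFrame_some {f' g' : Fin 2 → ℝ} (P : Fin 2) (i : Fin 3)
    (hf : HasDerivAt (f P) (f' P) z.1) (hg : HasDerivAt (g P) (g' P) z.1) :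
    ∃ D : Amb →L[ℝ] Amb, HasFDerivAt (tubeFrame f g (some (P, i))) D z ∧
      ∀ v, D v = (0, f P z.1 • (v.2.1 * sp1Basis i) + (f' P * v.1) • (z.2.1 * sp1Basis i),
        g P z.1 • (v.2.2 * sp1Basis i) + (g' P * v.1) • (z.2.2 * sp1Basis i)) := by
  have h1 := hasFDerivAt_smul_mul_const
    (L := ContinuousLinearMap.fst ℝ ℍ[ℝ] ℍ[ℝ] ∘L ContinuousLinearMap.snd ℝ ℝ (ℍ[ℝ] × ℍ[ℝ]))
    (sp1Basis i) hf
  have h2 := hasFDerivAt_smul_mul_const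
    (L := ContinuousLinearMap.snd ℝ ℍ[ℝ] ℍ[ℝ] ∘L ContinuousLinearMap.snd ℝ ℝ (ℍ[ℝ] × ℍ[ℝ]))
    (sp1Basis i) hg
  refine ⟨_, (hasFDerivAt_const (0 : ℝ) z).prodMk (h1.prodMk h2), fun v => ?_⟩
  simp

theorem hasDerivAt_conn {G : Fin 2 → Fin 2 → Fin 2 → ℝ → ℝ} {S H : Fin 2 → Fin 2 → ℝ → ℝ}
    {G' : Fin 2 → Fin 2 → Fin 2 → ℝ} {S' H' : Fin 2 → Fin 2 → ℝ} {t : ℝ}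
    (hG : ∀ P Q R, HasDerivAt (G P Q R) (G' P Q R) t) (hS : ∀ P Q, HasDerivAt (S P Q) (S' P Q) t)
    (hH : ∀ P Q, HasDerivAt (H P Q) (H' P Q) t) (a i j : FrameIx) :
    HasDerivAt (fun s => conn (fun P Q R => G P Q R s) (fun P Q => S P Q s) (fun P Q => H P Q s) a i j)
      (conn G' S' H' a i j) t := by
  rcases a with _ | ⟨P, a⟩ <;> rcases i with _ | ⟨R, i⟩ <;> rcases j with _ | ⟨Q, j⟩ <;>
    simp only [conn]
  all_goals first
    | exact hasDerivAt_const _ _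
    | exact (hH _ _).const_mul _
    | exact (hS _ _).const_mul _
    | exact ((hS _ _).const_mul _).neg
    | exact (hG _ _ _).const_mul _

theorem sp1Basis_commutator (i k : Fin 3) :
    sp1Basis i * sp1Basis k - sp1Basis k * sp1Basis i = ∑ m, (2 * eps i k m) • sp1Basis m := by
  fin_cases i <;> fin_cases k <;> ext <;>
    simp [re_sp1Basis, imI_sp1Basis, imJ_sp1Basis, imK_sp1Basis, eps, Fin.sum_univ_three] <;> norm_num

theorem sum_dl_smul (k : Fin 3) (r : ℝ) : ∑ m, (dl k m * r) • sp1Basis m = r • sp1Basis k := by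
  simp [dl, ite_mul, ite_smul]

theorem sum_eps_smul (i k : Fin 3) (r : ℝ) : ∑ m, (eps i k m * (2 * r)) • sp1Basis m
    = r • (sp1Basis i * sp1Basis k - sp1Basis k * sp1Basis i) := by
  rw [sp1Basis_commutator, Finset.smul_sum]
  refine Finset.sum_congr rfl fun m _ => ?_
  rw [smul_smul]
  congr 1
  ring

variable {G : Fin 2 → Fin 2 → Fin 2 → ℝ → ℝ} {S H : Fin 2 → Fin 2 → ℝ → ℝ}
    {G' : Fin 2 → Fin 2 → Fin 2 → ℝ → ℝ} {S' H' : Fin 2 → Fin 2 → ℝ → ℝ} {J : Set ℝ}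

/-- The connection forms as functions on the ambient space. -/
def tubeConn (G : Fin 2 → Fin 2 → Fin 2 → ℝ → ℝ) (S H : Fin 2 → Fin 2 → ℝ → ℝ) (a i j : FrameIx)
    (z : Amb) : ℝ :=
  conn (fun P Q R => G P Q R z.1) (fun P Q => S P Q z.1) (fun P Q => H P Q z.1) a i j

/-- The ambient open set over `J`. -/
def puncturedOver (J : Set ℝ) : Set Amb := punctured ∩ Prod.fst ⁻¹' J

/-- The structure equations of an invariant frame. -/
structure IsInvariantFrame (f g : Fin 2 → ℝ → ℝ) (G G' : Fin 2 → Fin 2 → Fin 2 → ℝ → ℝ)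
    (S H S' H' : Fin 2 → Fin 2 → ℝ → ℝ) (J : Set ℝ) : Prop where
  deriv_f : ∀ t ∈ J, ∀ P, HasDerivAt (f P) (∑ D, (H D P t - S P D t) * f D t) t
  deriv_g : ∀ t ∈ J, ∀ P, HasDerivAt (g P) (∑ D, (H D P t - S P D t) * g D t) t
  mul_f : ∀ t ∈ J, ∀ P R, ∑ D, (G P R D t + G R P D t) * f D t = 2 * (f P t * f R t)
  mul_g : ∀ t ∈ J, ∀ P R, ∑ D, (G P R D t + G R P D t) * g D t = 2 * (g P t * g R t)
  det_ne : ∀ t ∈ J, f 0 t * g 1 t - f 1 t * g 0 t ≠ 0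
  symm_S : ∀ t ∈ J, ∀ P Q, S P Q t = S Q P t
  skew_H : ∀ t ∈ J, ∀ P Q, H P Q t = -H Q P t
  symm_G : ∀ t ∈ J, ∀ P Q R, G P Q R t = G P R Q t
  deriv_G : ∀ t ∈ J, ∀ P Q R, HasDerivAt (G P Q R) (G' P Q R t) t
  deriv_S : ∀ t ∈ J, ∀ P Q, HasDerivAt (S P Q) (S' P Q t) t
  deriv_H : ∀ t ∈ J, ∀ P Q, HasDerivAt (H P Q) (H' P Q t) t

theorem IsInvariantFrame.hasFDerivAt_tubeConn (h : IsInvariantFrame f g G G' S H S' H' J)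
    (hz : z.1 ∈ J) (a i j : FrameIx) : HasFDerivAt (tubeConn G S H a i j)
      (tubeConn G' S' H' a i j z • ContinuousLinearMap.fst ℝ ℝ (ℍ[ℝ] × ℍ[ℝ])) z :=
  (hasDerivAt_conn (h.deriv_G _ hz) (h.deriv_S _ hz) (h.deriv_H _ hz) a i j).comp_hasFDerivAt z
    hasFDerivAt_fst

/-- Only the brackets have to be checked. Those with ∂_t differentiate the coefficients f, g; those
of two orbit fields come from the commutator in sp(1), with structure tensor 2 `eps`. Symmetry of S
removes the ∂_t component of the latter. -/
theorem IsInvariantFrame.isLeviCivita (h : IsInvariantFrame f g G G' S H S' H' J) :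
    IsLeviCivita (tubeFrame f g) (tubeConn G S H) (puncturedOver J) where
  differentiableAt z hz a := by
    rcases a with _ | ⟨P, i⟩
    · exact differentiableAt_const _
    · obtain ⟨D, hD, _⟩ := hasFDerivAt_tubeFrame_some (f' := fun P => _) (g' := fun P => _) P i
        (h.deriv_f _ hz.2 P) (h.deriv_g _ hz.2 P)
      exact hD.differentiableAt
  linearIndependent z hz := linearIndependent_tubeFrame hz.1 (h.det_ne _ hz.2)
  differentiableAt_conn z hz a i j := (h.hasFDerivAt_tubeConn hz.2 a i j).differentiableAt
  skew z hz := conn_skew (h.symm_G _ hz.2) (h.skew_H _ hz.2)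
  torsion z hz c a := by
    have hs : ∀ (P : Fin 2) (i : Fin 3) (v : Amb), fderiv ℝ (tubeFrame f g (some (P, i))) z v
        = (0, f P z.1 • (v.2.1 * sp1Basis i)
            + ((∑ D, (H D P z.1 - S P D z.1) * f D z.1) * v.1) • (z.2.1 * sp1Basis i),
          g P z.1 • (v.2.2 * sp1Basis i)
            + ((∑ D, (H D P z.1 - S P D z.1) * g D z.1) * v.1) • (z.2.2 * sp1Basis i)) := by
      intro P i v
      obtain ⟨D, hD, h'⟩ := hasFDerivAt_tubeFrame_some (f' := fun P => _) (g' := fun P => _) P i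
        (h.deriv_f _ hz.2 P) (h.deriv_g _ hz.2 P)
      rw [hD.fderiv, h']
    have hn : ∀ v : Amb, fderiv ℝ (tubeFrame f g none) z v = 0 := by
      intro v
      have : tubeFrame f g none = fun _ => ((1, 0, 0) : Amb) := rfl
      rw [this]
      simp
    rcases c with _ | ⟨P, i⟩ <;> rcases a with _ | ⟨R, k⟩
    · simp
    · rw [hs, hn, sum_smul_tubeFrame]
      have e : ∀ (u : Fin 2 → ℝ → ℝ) (m : Fin 3), ∑ P, (tubeConn G S H none (some (P, m)) (some (R, k)) z
          - tubeConn G S H (some (R, k)) (some (P, m)) none z) * u P z.1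
          = dl k m * ∑ D, (H D R z.1 - S R D z.1) * u D z.1 := by
        intro u m
        simp only [tubeConn, conn, Finset.mul_sum]
        exact Finset.sum_congr rfl fun P _ => by ring
      simp only [e, sum_dl_smul]
      simp [tubeFrame, tubeConn, conn]
    · rw [hs, hn, sum_smul_tubeFrame]
      have e : ∀ (u : Fin 2 → ℝ → ℝ) (m : Fin 3), ∑ Q, (tubeConn G S H (some (P, i)) (some (Q, m)) none z
          - tubeConn G S H none (some (Q, m)) (some (P, i)) z) * u Q z.1
          = dl i m * -∑ D, (H D P z.1 - S P D z.1) * u D z.1 := by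
        intro u m
        simp only [tubeConn, conn, Finset.mul_sum, ← Finset.sum_neg_distrib]
        exact Finset.sum_congr rfl fun P _ => by ring
      simp only [e, sum_dl_smul, neg_smul]
      simp [tubeFrame, tubeConn, conn, -Fin.sum_univ_two, -Fin.sum_univ_ofNat]
    · rw [hs, hs, sum_smul_tubeFrame]
      have e : ∀ (u : Fin 2 → ℝ → ℝ) (m : Fin 3),
          (∀ P R, ∑ D, (G P R D z.1 + G R P D z.1) * u D z.1 = 2 * (u P z.1 * u R z.1)) →
          ∑ Q, (tubeConn G S H (some (P, i)) (some (Q, m)) (some (R, k)) z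
          - tubeConn G S H (some (R, k)) (some (Q, m)) (some (P, i)) z) * u Q z.1
          = eps i k m * (2 * (u P z.1 * u R z.1)) := by
        intro u m hu
        rw [← hu, Finset.mul_sum]
        refine Finset.sum_congr rfl fun Q _ => ?_
        simp only [tubeConn, conn]
        rw [eps_swap' i k m]
        ring
      simp only [e f _ (h.mul_f _ hz.2), e g _ (h.mul_g _ hz.2), sum_eps_smul]
      refine Prod.ext ?_ (Prod.ext ?_ ?_)
      · simp [tubeConn, conn, h.symm_S _ hz.2 P R, dl_comm i k]
      · simp [tubeFrame, mul_assoc, mul_sub, smul_sub, smul_smul, mul_comm (f R z.1)]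
      · simp [tubeFrame, mul_assoc, mul_sub, smul_sub, smul_smul, mul_comm (g R z.1)]

/-- The connection forms depend on t alone, so only their derivatives in the direction `none`
survive and the curvature is purely algebraic. -/
theorem IsInvariantFrame.frameCurvatureSq_eq (h : IsInvariantFrame f g G G' S H S' H' J)
    (hz : z.1 ∈ J) : frameCurvatureSq (tubeFrame f g) (tubeConn G S H) z
      = ∑ c, ∑ a, ∑ i, ∑ j, curvAlg
        (conn (fun P Q R => G P Q R z.1) (fun P Q => S P Q z.1) (fun P Q => H P Q z.1))
        (conn (fun P Q R => G' P Q R z.1) (fun P Q => S' P Q z.1) (fun P Q => H' P Q z.1))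
        c a i j ^ 2 := by
  refine Finset.sum_congr rfl fun c _ => Finset.sum_congr rfl fun a _ =>
    Finset.sum_congr rfl fun i _ => Finset.sum_congr rfl fun j _ => ?_
  congr 1
  rw [frameCurvature, (h.hasFDerivAt_tubeConn hz a i j).fderiv,
    (h.hasFDerivAt_tubeConn hz c i j).fderiv]
  simp only [smul_apply, ContinuousLinearMap.coe_fst', tubeFrame_fst, curvAlg]
  simp [tubeConn]

end TubeFrame

end


noncomputable section

/-! ### The orthonormal frame of a solution -/

section SolutionFrame

/-- The structure constants of the orthonormal frame. -/
def stU (c : ℝ × ℝ × ℝ) : ℝ := orbitU c.1 c.2.1 c.2.2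

/-- The structure constants of the orthonormal frame. See `stU`. -/
def stV (c : ℝ × ℝ × ℝ) : ℝ := stU c * c.2.1 / c.2.2

/-- The structure constants of the orthonormal frame. See `stU`. -/
def stW (c : ℝ × ℝ × ℝ) : ℝ := stU c / c.2.2

/-- The structure constants of the orthonormal frame. See `stU`. -/
def stK (c : ℝ × ℝ × ℝ) : ℝ := stU c * (c.2.1 ^ 2 + c.2.1) / c.2.2 ^ 2

/-- The components of the shape operator of the orbits. -/
def stα (c : ℝ × ℝ × ℝ) : ℝ := c.1 - eShape c.1 c.2.1 c.2.2

/-- The components of the shape operator of the orbits. See `stα`. -/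
def stβ (c : ℝ × ℝ × ℝ) : ℝ := c.1 + eShape c.1 c.2.1 c.2.2

/-- The components of the shape operator of the orbits. See `stα`. -/
def stσ (c : ℝ × ℝ × ℝ) : ℝ := fShape c.1 c.2.1 c.2.2

/-- The coefficients of the orthonormal frame of a solution. -/
def solF (c : ℝ → ℝ × ℝ × ℝ) (P : Fin 2) (t : ℝ) : ℝ := ![stU (c t) / 2, -stV (c t) / 2] P

/-- The coefficients of the orthonormal frame of a solution. See `solF`. -/
def solG (c : ℝ → ℝ × ℝ × ℝ) (P : Fin 2) (t : ℝ) : ℝ := ![0, stW (c t) / 2] P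

/-- The orthonormal frame of a solution. -/
abbrev solFrame (c : ℝ → ℝ × ℝ × ℝ) : FrameIx → Amb → Amb := tubeFrame (solF c) (solG c)

/-- The Levi-Civita connection of a solution. -/
abbrev solConn (c : ℝ → ℝ × ℝ × ℝ) : FrameIx → FrameIx → FrameIx → Amb → ℝ :=
  tubeConn (fun P Q R t => orbitConn (stU (c t)) (stV (c t)) (stW (c t)) (stK (c t)) P Q R)
    (fun P Q t => shapeOp (stα (c t)) (stβ (c t)) (stσ (c t)) P Q)
    (fun P Q t => rotOp (stσ (c t)) P Q)

variable {c : ℝ → ℝ × ℝ × ℝ} {J : Set ℝ} {t : ℝ}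

theorem IsSolution.hasDerivAt_coords (hc : IsSolution c J) (ht : t ∈ J) :
    HasDerivAt (fun s => (c s).1) (pDot (c t).1 (c t).2.1 (c t).2.2) t ∧
    HasDerivAt (fun s => (c s).2.1) (xDot (c t).1 (c t).2.1 (c t).2.2) t ∧
    HasDerivAt (fun s => (c s).2.2) (yDot (c t).1 (c t).2.1 (c t).2.2) t :=
  hasDerivAt_triple (hc.deriv t ht)

theorem IsSolution.hasDerivAt_stU (hc : IsSolution c J) (ht : t ∈ J) :
    HasDerivAt (fun s => stU (c s)) (-stα (c t) * stU (c t)) t := by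
  obtain ⟨hp, hx, hy⟩ := hc.hasDerivAt_coords ht
  exact hasDerivAt_orbitU (p := fun s => (c s).1) (x := fun s => (c s).2.1)
    (y := fun s => (c s).2.2) hp hx hy (hc.pos t ht)

theorem IsSolution.hasDerivAt_stV (hc : IsSolution c J) (ht : t ∈ J) :
    HasDerivAt (fun s => stV (c s)) (2 * stσ (c t) * stU (c t) - stβ (c t) * stV (c t)) t := by
  obtain ⟨hp, hx, hy⟩ := hc.hasDerivAt_coords ht
  have h0 := (hc.pos t ht).ne'
  refine (((hc.hasDerivAt_stU ht).mul hx).div hy h0).congr_deriv ?_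
  rw [stV, yDot_eq, xDot_eq, stα, stβ, stσ]
  simp only [Pi.mul_apply]
  field_simp
  ring

theorem IsSolution.hasDerivAt_stW (hc : IsSolution c J) (ht : t ∈ J) :
    HasDerivAt (fun s => stW (c s)) (-stβ (c t) * stW (c t)) t := by
  obtain ⟨hp, hx, hy⟩ := hc.hasDerivAt_coords ht
  have h0 := (hc.pos t ht).ne'
  refine ((hc.hasDerivAt_stU ht).div hy h0).congr_deriv ?_
  rw [stW, yDot_eq, stα, stβ]
  field_simp
  ring

theorem IsSolution.hasDerivAt_stK (hc : IsSolution c J) (ht : t ∈ J) :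
    HasDerivAt (fun s => stK (c s)) ((stα (c t) - 2 * stβ (c t)) * stK (c t)
      + 2 * stσ (c t) * (2 * stV (c t) + stW (c t))) t := by
  obtain ⟨hp, hx, hy⟩ := hc.hasDerivAt_coords ht
  have h0 := (hc.pos t ht).ne'
  refine (((hc.hasDerivAt_stU ht).mul ((hx.pow 2).add hx)).div (hy.pow 2)
    (pow_ne_zero 2 h0)).congr_deriv ?_
  rw [stK, stV, stW, yDot_eq, xDot_eq, stα, stβ, stσ]
  simp only [Pi.mul_apply, Pi.pow_apply, Pi.add_apply]
  field_simp
  ring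

/-- The derivatives of the components of the shape operator. -/
def stα' (c : ℝ × ℝ × ℝ) : ℝ := pDot c.1 c.2.1 c.2.2 - eDot c.1 c.2.1 c.2.2

/-- The derivatives of the components of the shape operator. See `stα'`. -/
def stβ' (c : ℝ × ℝ × ℝ) : ℝ := pDot c.1 c.2.1 c.2.2 + eDot c.1 c.2.1 c.2.2

/-- The derivatives of the components of the shape operator. See `stα'`. -/
def stσ' (c : ℝ × ℝ × ℝ) : ℝ := fDot c.1 c.2.1 c.2.2

theorem IsSolution.hasDerivAt_shape (hc : IsSolution c J) (ht : t ∈ J) :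
    HasDerivAt (fun s => stα (c s)) (stα' (c t)) t ∧
    HasDerivAt (fun s => stβ (c s)) (stβ' (c t)) t ∧
    HasDerivAt (fun s => stσ (c s)) (stσ' (c t)) t := by
  obtain ⟨hp, hx, hy⟩ := hc.hasDerivAt_coords ht
  have hE := hasDerivAt_eShape (p := fun s => (c s).1) (x := fun s => (c s).2.1)
    (y := fun s => (c s).2.2) hp hx hy (hc.pos t ht)
  have hF := hasDerivAt_fShape (p := fun s => (c s).1) (x := fun s => (c s).2.1)
    (y := fun s => (c s).2.2) hp hx hy (hc.pos t ht)
  exact ⟨hp.fun_sub hE, hp.fun_add hE, hF⟩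

theorem stU_pos {c : ℝ × ℝ × ℝ} (h : 0 < c.2.2) : 0 < stU c := orbitU_pos _ _ h

/-- The frame is triangular: its first triple is tangent to the first sphere. It depends only on |ξ|
and τ and hence is smooth in t without a choice of the cube root ξ. The equations for f and g are
the evolution equations of U, V, W. -/
theorem IsSolution.isInvariantFrame (hc : IsSolution c J) :
    IsInvariantFrame (solF c) (solG c)
      (fun P Q R t => orbitConn (stU (c t)) (stV (c t)) (stW (c t)) (stK (c t)) P Q R)
      (fun P Q R t => orbitConn (-stα (c t) * stU (c t))
        (2 * stσ (c t) * stU (c t) - stβ (c t) * stV (c t)) (-stβ (c t) * stW (c t))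
        ((stα (c t) - 2 * stβ (c t)) * stK (c t) + 2 * stσ (c t) * (2 * stV (c t) + stW (c t)))
        P Q R)
      (fun P Q t => shapeOp (stα (c t)) (stβ (c t)) (stσ (c t)) P Q)
      (fun P Q t => rotOp (stσ (c t)) P Q)
      (fun P Q t => shapeOp (stα' (c t)) (stβ' (c t)) (stσ' (c t)) P Q)
      (fun P Q t => rotOp (stσ' (c t)) P Q) J where
  deriv_f t ht P := by
    fin_cases P
    · refine ((hc.hasDerivAt_stU ht).div_const 2).congr_deriv ?_
      simp [rotOp, shapeOp, solF]
      ring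
    · refine ((hc.hasDerivAt_stV ht).neg.div_const 2).congr_deriv ?_
      simp [rotOp, shapeOp, solF]
      ring
  deriv_g t ht P := by
    fin_cases P
    · refine (hasDerivAt_const t (0 : ℝ)).congr_deriv ?_
      simp [rotOp, shapeOp, solG]
    · refine ((hc.hasDerivAt_stW ht).div_const 2).congr_deriv ?_
      simp [rotOp, shapeOp, solG]
      ring
  mul_f t ht P R := by
    have h0 := (hc.pos t ht).ne'
    fin_cases P <;> fin_cases R <;> simp [orbitConn, solF, stK, stV, stW] <;> field_simp <;> ring
  mul_g t ht P R := by
    have h0 := (hc.pos t ht).ne'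
    fin_cases P <;> fin_cases R <;> simp [orbitConn, solG, stK, stV, stW] <;> field_simp <;>
      (left; ring1)
  det_ne t ht := by
    have h0 := (hc.pos t ht)
    have h1 := stU_pos h0
    have : 0 < stU (c t) / 2 * (stW (c t) / 2) := by
      rw [stW]
      positivity
    simpa [solF, solG] using this.ne'
  symm_S t ht P Q := by
    fin_cases P <;> fin_cases Q <;> rfl
  skew_H t ht := rotOp_skew _
  symm_G t ht := orbitConn_symm _ _ _ _
  deriv_G t ht P Q R := by
    have hU := hc.hasDerivAt_stU ht
    have hV := hc.hasDerivAt_stV ht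
    have hW := hc.hasDerivAt_stW ht
    have hK := hc.hasDerivAt_stK ht
    fin_cases P <;> fin_cases Q <;> fin_cases R
    exacts [hU.div_const 2, hasDerivAt_const _ _, hasDerivAt_const _ _, hK.neg.div_const 2, hV.neg,
      hK.div_const 2, hK.div_const 2, hW.div_const 2]
  deriv_S t ht P Q := by
    obtain ⟨h1, h2, h3⟩ := hc.hasDerivAt_shape ht
    fin_cases P <;> fin_cases Q
    exacts [h1, h3, h3, h2]
  deriv_H t ht P Q := by
    obtain ⟨h1, h2, h3⟩ := hc.hasDerivAt_shape ht
    fin_cases P <;> fin_cases Q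
    exacts [hasDerivAt_const _ _, h3.neg, h3, hasDerivAt_const _ _]

theorem IsSolution.isLeviCivita (hc : IsSolution c J) :
    IsLeviCivita (solFrame c) (solConn c) (puncturedOver J) :=
  hc.isInvariantFrame.isLeviCivita

/-- The curvature invariant as a function of the state. -/
def stateInvariant (c : ℝ × ℝ × ℝ) : ℝ := curvInvariant c.1 c.2.1 c.2.2

theorem IsSolution.frameCurvatureSq_eq (hc : IsSolution c J) {z : Amb} (hz : z.1 ∈ J) :
    frameCurvatureSq (solFrame c) (solConn c) z = stateInvariant (c z.1) := by
  rw [hc.isInvariantFrame.frameCurvatureSq_eq hz]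
  exact sum_frameConn_sq_state (c z.1).1 (hc.pos _ hz) (orbitU_sq (c z.1).1 (hc.pos _ hz)) rfl rfl
    rfl rfl rfl rfl rfl rfl rfl rfl rfl rfl rfl

theorem contDiffOn_stU : ContDiffOn ℝ ∞ stU {c : ℝ × ℝ × ℝ | 0 < c.2.2} := by
  have hD : ContDiffOn ℝ ∞ (fun c : ℝ × ℝ × ℝ => areaD c.1 c.2.1 c.2.2) {c | 0 < c.2.2} := by
    unfold areaD qq
    refine ContDiffOn.div (by fun_prop) (by fun_prop) fun c (hc : 0 < c.2.2) => ?_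
    positivity
  refine contDiffOn_const.mul (ContDiffOn.sqrt (ContDiffOn.div (by fun_prop) hD ?_) ?_)
  · intro c hc
    exact (areaD_pos hc).ne'
  · intro c hc
    exact (div_pos hc (areaD_pos hc)).ne'

theorem IsSolution.contDiffOn_solF (hc : IsSolution c J) (P : Fin 2) :
    ContDiffOn ℝ ∞ (solF c P) J ∧ ContDiffOn ℝ ∞ (solG c P) J := by
  have hU : ContDiffOn ℝ ∞ (fun t => stU (c t)) J := contDiffOn_stU.comp hc.smooth hc.pos
  have hx : ContDiffOn ℝ ∞ (fun t => (c t).2.1) J := hc.smooth.snd.fst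
  have hy : ContDiffOn ℝ ∞ (fun t => (c t).2.2) J := hc.smooth.snd.snd
  have h0 : ∀ t ∈ J, (c t).2.2 ≠ 0 := fun t ht => (hc.pos t ht).ne'
  fin_cases P
  · exact ⟨hU.div_const 2, contDiffOn_const⟩
  · exact ⟨((hU.mul hx).div hy h0).neg.div_const 2, (hU.div hy h0).div_const 2⟩

end SolutionFrame

end


noncomputable section

/-! ### Maps preserving the forms are isometries -/

section Lift

/-- The matrix of the adapted coframe in the orthonormal frame. -/
def rotMatrix (u v : ℝ) : Matrix (Fin 7) FrameIx ℝ
  | k, none => ![1, 0, 0, 0, 0, 0, 0] k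
  | k, some (P, i) => ![![0, ![u, -v] P, ![v, u] P, 0, 0, 0, 0],
      ![0, 0, 0, ![u, -v] P, ![v, u] P, 0, 0], ![0, 0, 0, 0, 0, ![u, -v] P, ![v, u] P]] i k

theorem transpose_mul_rotMatrix {u v : ℝ} (h : u ^ 2 + v ^ 2 = 1) :
    (rotMatrix u v).transpose * rotMatrix u v = 1 := by
  ext a b
  rw [Matrix.mul_apply]
  rcases a with _ | ⟨P, i⟩ <;> rcases b with _ | ⟨Q, k⟩
  · simp [rotMatrix, Fin.sum_univ_seven]
  · fin_cases k <;> simp [rotMatrix, Fin.sum_univ_seven]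
  · fin_cases i <;> simp [rotMatrix, Fin.sum_univ_seven]
  · simp only [Matrix.transpose_apply, rotMatrix, Fin.sum_univ_seven, Matrix.one_apply]
    fin_cases P <;> fin_cases Q <;> fin_cases i <;> fin_cases k <;> simp <;> linarith

theorem rotMatrix_mul_transpose {u v : ℝ} (h : u ^ 2 + v ^ 2 = 1) :
    rotMatrix u v * (rotMatrix u v).transpose = 1 :=
  (Matrix.mul_eq_one_comm_of_card_eq FrameIx (Fin 7) ℝ (by simp)).1
    (transpose_mul_rotMatrix h)

theorem mcCoord_tubeFrame_none (f g : Fin 2 → ℝ → ℝ) (z : Amb) :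
    mcCoord z (tubeFrame f g none z) = ![1, 0, 0, 0, 0, 0, 0] := by
  simp [mcCoord_apply, tubeFrame]

theorem mcCoord_tubeFrame_some (f g : Fin 2 → ℝ → ℝ) (p : Tube) (P : Fin 2) (i : Fin 3) :
    mcCoord (tubeIncl p) (tubeFrame f g (some (P, i)) (tubeIncl p)) =
      ![![0, f P p.1, g P p.1, 0, 0, 0, 0], ![0, 0, 0, f P p.1, g P p.1, 0, 0],
        ![0, 0, 0, 0, 0, f P p.1, g P p.1]] i := by
  have h : ∀ q : Sp1, Quaternion.normSq (q : ℍ[ℝ]) = 1 := fun q => by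
    rw [Quaternion.normSq_eq_norm_mul_self, norm_coe_sp1, mul_one]
  simp only [mcCoord_apply, tubeFrame, mul_smul_comm, star_mul_mul_sp1Basis, tubeIncl, h, one_smul,
    Quaternion.imI_smul, Quaternion.imJ_smul, Quaternion.imK_smul, imI_sp1Basis, imJ_sp1Basis,
    imK_sp1Basis]
  fin_cases i <;> simp

/-- On the two orbit triples z_k takes the values ζ and iζ with ζ = ξ/|ξ| = u + iv. Thus the adapted
coframe differs from the orthonormal frame by the phase of ξ alone, and φ is the model form after
this rotation. -/
theorem exists_rotMatrix (c : ℝ → ℝ × ℝ × ℝ) (p : Tube) (h0 : 0 < (c p.1).2.2) :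
    ∃ u v : ℝ, u ^ 2 + v ^ 2 = 1 ∧ ∀ (r : Fin 3 → FrameIx → ℝ) (V : Fin 3 → TangentSpace tubeModel p),
      (∀ i, dIncl p (V i) = ∑ a, r i a • solFrame c a (tubeIncl p)) →
      solutionForm c p V = phi0 ((rotMatrix u v).mulVec (r 0)) ((rotMatrix u v).mulVec (r 1))
        ((rotMatrix u v).mulVec (r 2)) := by
  obtain ⟨a, b, e, d, hD, hf, -, he, hd, hn⟩ := exists_adapted_numbers (c p.1) h0
  have hU : stU (c p.1) ^ 2 = 4 / (areaD (c p.1).1 (c p.1).2.1 (c p.1).2.2 / (c p.1).2.2) := by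
    rw [stU, orbitU, mul_pow, Real.sq_sqrt (div_pos h0 (areaD_pos h0)).le]
    have := (areaD_pos (p := (c p.1).1) (x := (c p.1).2.1) h0).ne'
    field_simp
    norm_num
  have hpos : 0 < areaD (c p.1).1 (c p.1).2.1 (c p.1).2.2 / (c p.1).2.2 :=
    div_pos (areaD_pos h0) h0
  have h1 : (a * (stU (c p.1) / 2)) ^ 2 + (b * (stU (c p.1) / 2)) ^ 2 = 1 := by
    have : (a * (stU (c p.1) / 2)) ^ 2 + (b * (stU (c p.1) / 2)) ^ 2
        = (a ^ 2 + b ^ 2) * stU (c p.1) ^ 2 / 4 := by ring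
    rw [this, hn, hU, mul_div_cancel₀ _ hpos.ne', div_self (by norm_num)]
  refine ⟨_, _, h1, fun r V hV => ?_⟩
  have h2 : ∀ x, adaptedCoord a b e d (mcCoord (tubeIncl p) (solFrame c x (tubeIncl p)))
      = fun k => rotMatrix (a * (stU (c p.1) / 2)) (b * (stU (c p.1) / 2)) k x := by
    intro x
    have hy := h0.ne'
    have hf1 : -(a * (stV (c p.1) / 2)) + e * (stW (c p.1) / 2) = -(b * (stU (c p.1) / 2)) := by
      rw [stV, stW, he]
      field_simp
      ring
    have hf2 : -(b * (stV (c p.1) / 2)) + d * (stW (c p.1) / 2) = a * (stU (c p.1) / 2) := by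
      rw [stV, stW, hd]
      field_simp
      ring
    rcases x with _ | ⟨P, i⟩
    · rw [mcCoord_tubeFrame_none, adaptedCoord_apply]
      ext k
      fin_cases k <;> simp [rotMatrix]
    · rw [mcCoord_tubeFrame_some, adaptedCoord_apply]
      ext k
      fin_cases P <;> fin_cases i <;> fin_cases k <;>
        simp [rotMatrix, solF, solG, hf1, hf2, neg_div]
  have h3 : ∀ i, adaptedCoord a b e d (mcCoord (tubeIncl p) (dIncl p (V i)))
      = (rotMatrix (a * (stU (c p.1) / 2)) (b * (stU (c p.1) / 2))).mulVec (r i) := by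
    intro i
    rw [hV i, map_sum, map_sum]
    simp only [map_smul, h2]
    ext k
    simp [Matrix.mulVec, dotProduct, Finset.sum_apply, mul_comm]
  rw [← h3, ← h3, ← h3, phi0_adaptedCoord, ← hf]
  exact ambForm_apply (fun t => stateCoeffs (c t)) (tubeIncl p) fun i => dIncl p (V i)

/-- After rotation by the two phases A becomes a matrix preserving φ₀, hence orthogonal. -/
theorem transpose_mul_self_of_phi0_rotMatrix {u v u' v' : ℝ} (h : u ^ 2 + v ^ 2 = 1)
    (h' : u' ^ 2 + v' ^ 2 = 1) (A : Matrix FrameIx FrameIx ℝ)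
    (hA : ∀ r s w : FrameIx → ℝ, phi0 ((rotMatrix u' v').mulVec (A.mulVec r))
      ((rotMatrix u' v').mulVec (A.mulVec s)) ((rotMatrix u' v').mulVec (A.mulVec w))
      = phi0 ((rotMatrix u v).mulVec r) ((rotMatrix u v).mulVec s) ((rotMatrix u v).mulVec w)) :
    A.transpose * A = 1 := by
  have h1 := transpose_mul_self_eq_one_of_phi0
    (rotMatrix u' v' * A * (rotMatrix u v).transpose) (fun x y w => by
      simp only [← Matrix.mulVec_mulVec, hA]
      simp only [Matrix.mulVec_mulVec, rotMatrix_mul_transpose h, Matrix.one_mulVec])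
  have e1 := transpose_mul_rotMatrix h
  have e2 := transpose_mul_rotMatrix h'
  have h2 : (rotMatrix u v).transpose * ((rotMatrix u' v' * A * (rotMatrix u v).transpose).transpose
      * (rotMatrix u' v' * A * (rotMatrix u v).transpose)) * rotMatrix u v = A.transpose * A := by
    simp only [Matrix.transpose_mul, Matrix.transpose_transpose]
    calc _ = ((rotMatrix u v).transpose * rotMatrix u v) * A.transpose
          * ((rotMatrix u' v').transpose * rotMatrix u' v') * A
          * ((rotMatrix u v).transpose * rotMatrix u v) := by simp only [Matrix.mul_assoc]
      _ = _ := by rw [e1, e2, Matrix.one_mul, Matrix.mul_one, Matrix.mul_one]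
  rw [← h2, h1, Matrix.mul_one, e1]

/-! ### The radial retraction -/

theorem hasFDerivAt_normalize {q : ℍ[ℝ]} (hq : q ≠ 0) : ∃ D : ℍ[ℝ] →L[ℝ] ℍ[ℝ],
    HasFDerivAt (fun q : ℍ[ℝ] => ‖q‖⁻¹ • q) D q ∧ ∀ v, inner ℝ q v = 0 → D v = ‖q‖⁻¹ • v := by
  have hn : ‖q‖ ^ 2 ≠ 0 := pow_ne_zero 2 (norm_ne_zero_iff.2 hq)
  have h1 := (hasStrictFDerivAt_norm_sq q).hasFDerivAt.sqrt hn
  have h2 : (fun x : ℍ[ℝ] => √(‖x‖ ^ 2)) = fun x => ‖x‖ := by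
    funext x
    simp
  rw [h2] at h1
  have h3 := (hasDerivAt_inv (norm_ne_zero_iff.2 hq)).comp_hasFDerivAt q h1
  refine ⟨_, h3.smul (hasFDerivAt_id q), fun v hv => ?_⟩
  simp [hv]

theorem inner_mul_sp1Basis (q : ℍ[ℝ]) (i : Fin 3) : inner ℝ q (q * sp1Basis i) = 0 := by
  rw [Quaternion.inner_def]
  simp only [star_mul, Quaternion.re_mul, Quaternion.imI_mul, Quaternion.imJ_mul,
    Quaternion.imK_mul, Quaternion.re_star, Quaternion.imI_star, Quaternion.imJ_star,
    Quaternion.imK_star, re_sp1Basis]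
  ring

/-- The orbit fields are tangent to the spheres and homogeneous of degree one in each quaternion,
while normalization scales tangent vectors by the inverse norm. -/
theorem fderiv_retract_tubeFrame (f g : Fin 2 → ℝ → ℝ) {z : Amb} (hz : z ∈ punctured)
    (a : FrameIx) : fderiv ℝ (tubeIncl ∘ tubeProj) z (tubeFrame f g a z)
      = tubeFrame f g a (tubeIncl (tubeProj z)) := by
  obtain ⟨D₁, hD₁, h₁⟩ := hasFDerivAt_normalize hz.1
  obtain ⟨D₂, hD₂, h₂⟩ := hasFDerivAt_normalize hz.2
  have e : tubeIncl ∘ tubeProj =ᶠ[𝓝 z] fun z => (z.1, ‖z.2.1‖⁻¹ • z.2.1, ‖z.2.2‖⁻¹ • z.2.2) := by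
    filter_upwards [isOpen_punctured.mem_nhds hz] with y hy
    simp [tubeIncl, tubeProj, coe_sphereProj hy.1, coe_sphereProj hy.2]
  have hd := (hasFDerivAt_fst (𝕜 := ℝ) (p := z)).prodMk
    ((hD₁.comp z (hasFDerivAt_snd (𝕜 := ℝ) (p := z)).fst).prodMk
      (hD₂.comp z (hasFDerivAt_snd (𝕜 := ℝ) (p := z)).snd))
  rw [e.fderiv_eq, HasFDerivAt.fderiv (f := fun z : Amb => (z.1, ‖z.2.1‖⁻¹ • z.2.1, ‖z.2.2‖⁻¹ • z.2.2)) hd]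
  have hi : ∀ (q : ℍ[ℝ]) (r : ℝ) (i : Fin 3), inner ℝ q (r • (q * sp1Basis i)) = 0 :=
    fun q r i => by rw [inner_smul_right, inner_mul_sp1Basis, mul_zero]
  rcases a with _ | ⟨P, i⟩
  · simp [tubeFrame]
  · simp [tubeFrame, h₁ _ (hi _ _ _), h₂ _ (hi _ _ _), tubeIncl, tubeProj, coe_sphereProj hz.1,
      coe_sphereProj hz.2]
    exact ⟨smul_comm _ _ _, smul_comm _ _ _⟩

/-! ### The lift of a map to the ambient space -/

/-- The lift of a map of the tube to the ambient space. -/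
def tubeLift (ψ : Tube → Tube) (z : Amb) : Amb := tubeIncl (ψ (tubeProj z))

/-- The matrix of the differential of the lift. -/
def liftMatrix (c c' : ℝ → ℝ × ℝ × ℝ) (ψ : Tube → Tube) (b a : FrameIx) (z : Amb) : ℝ :=
  tubeCoframe (solF c') (solG c') (tubeLift ψ z) (fderiv ℝ (tubeLift ψ) z (solFrame c a z)) b

variable {c c' : ℝ → ℝ × ℝ × ℝ} {J : Set ℝ} {ψ : OpenPartialHomeomorph Tube Tube}

theorem isOpen_lift (ψ : OpenPartialHomeomorph Tube Tube) :
    IsOpen (punctured ∩ tubeProj ⁻¹' ψ.source) := by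
  have : ContinuousOn tubeProj punctured := fun z hz =>
    (contMDiffAt_tubeProj hz).continuousAt.continuousWithinAt
  exact this.isOpen_inter_preimage isOpen_punctured ψ.open_source

theorem contDiffAt_tubeLift (hψ : ContMDiffOn tubeModel tubeModel ∞ ψ ψ.source) {z : Amb}
    (hz : z ∈ punctured ∩ tubeProj ⁻¹' ψ.source) : ContDiffAt ℝ ∞ (tubeLift ψ) z := by
  have h1 := (hψ.contMDiffAt (ψ.open_source.mem_nhds hz.2)).comp z (contMDiffAt_tubeProj hz.1)
  exact ((contMDiff_tubeIncl _).comp z h1).contDiffAt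

theorem fderiv_tubeLift (hψ : ContMDiffOn tubeModel tubeModel ∞ ψ ψ.source) {z : Amb}
    (hz : z ∈ punctured ∩ tubeProj ⁻¹' ψ.source) (v : Amb) : fderiv ℝ (tubeLift ψ) z v
      = dIncl (ψ (tubeProj z)) (mfderiv tubeModel tubeModel ψ (tubeProj z)
        (mfderiv 𝓘(ℝ, Amb) tubeModel tubeProj z v)) := by
  have h0 := (contMDiffAt_tubeProj hz.1).mdifferentiableAt (by simp)
  have h1 := (hψ.contMDiffAt (ψ.open_source.mem_nhds hz.2)).mdifferentiableAt (by simp)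
  have e1 := mfderiv_comp z h1 h0
  have e2 := mfderiv_comp z (mdifferentiableAt_tubeIncl (ψ (tubeProj z))) (h1.comp z h0)
  rw [e1] at e2
  rw [← mfderiv_eq_fderiv]
  exact DFunLike.congr_fun e2 v

theorem dIncl_mfderiv_tubeProj (f g : Fin 2 → ℝ → ℝ) {z : Amb} (hz : z ∈ punctured) (a : FrameIx) :
    dIncl (tubeProj z) (mfderiv 𝓘(ℝ, Amb) tubeModel tubeProj z (tubeFrame f g a z))
      = tubeFrame f g a (tubeIncl (tubeProj z)) := by
  have h0 := (contMDiffAt_tubeProj hz).mdifferentiableAt (by simp)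
  have e2 := mfderiv_comp z (mdifferentiableAt_tubeIncl (tubeProj z)) h0
  rw [← fderiv_retract_tubeFrame f g hz, ← mfderiv_eq_fderiv]
  exact (DFunLike.congr_fun e2 (tubeFrame f g a z)).symm

theorem sum_liftMatrix_smul (hc' : IsSolution c' J) (hψ : IsLocalIso tubeModel (solutionForm c)
    (solutionForm c') (tubeOver J) ψ) {z : Amb} (hz : z ∈ punctured ∩ tubeProj ⁻¹' ψ.source)
    (a : FrameIx) : ∑ b, liftMatrix c c' ψ b a z • solFrame c' b (tubeLift ψ z)
      = fderiv ℝ (tubeLift ψ) z (solFrame c a z) := by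
  have hJ : (ψ (tubeProj z)).1 ∈ J := (hψ.target_subset (ψ.map_source hz.2)).1
  refine sum_tubeCoframe_smul (tubeIncl_mem_punctured _) (hc'.isInvariantFrame.det_ne _ hJ) ?_ ?_
  all_goals rw [fderiv_tubeLift hψ.smooth hz]
  · exact (re_star_mul_dIncl _ _).1
  · exact (re_star_mul_dIncl _ _).2

/-- ψ carries one form to the other, so in the two frames its differential satisfies the hypothesis
of `transpose_mul_self_of_phi0_rotMatrix`. -/
theorem liftMatrix_orthogonal (hc : IsSolution c J) (hc' : IsSolution c' J)
    (hψ : IsLocalIso tubeModel (solutionForm c) (solutionForm c') (tubeOver J) ψ) {z : Amb}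
    (hz : z ∈ punctured ∩ tubeProj ⁻¹' ψ.source) (a e : FrameIx) :
    ∑ b, liftMatrix c c' ψ b a z * liftMatrix c c' ψ b e z = if a = e then 1 else 0 := by
  have hJ : (tubeProj z).1 ∈ J := (hψ.source_subset hz.2).1
  have hJ' : (ψ (tubeProj z)).1 ∈ J := (hψ.target_subset (ψ.map_source hz.2)).1
  obtain ⟨u, v, h, hu⟩ := exists_rotMatrix c (tubeProj z) (hc.pos _ hJ)
  obtain ⟨u', v', h', hu'⟩ := exists_rotMatrix c' (ψ (tubeProj z)) (hc'.pos _ hJ')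
  set A : Matrix FrameIx FrameIx ℝ := fun b a => liftMatrix c c' ψ b a z with hA
  have key := transpose_mul_self_of_phi0_rotMatrix h h' A fun r s w => by
    let V : Fin 3 → TangentSpace tubeModel (tubeProj z) := fun i =>
      ∑ a, ![r, s, w] i a • mfderiv 𝓘(ℝ, Amb) tubeModel tubeProj z (solFrame c a z)
    have e1 := hu ![r, s, w] V fun i => by
      rw [map_sum]
      refine Finset.sum_congr rfl fun a _ => ?_
      rw [map_smul]
      exact congrArg _ (dIncl_mfderiv_tubeProj _ _ hz.1 a)
    have e2 := hu' ![A.mulVec r, A.mulVec s, A.mulVec w]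
      (fun i => mfderiv tubeModel tubeModel ψ (tubeProj z) (V i)) fun i => by
      have e3 : dIncl (ψ (tubeProj z)) (mfderiv tubeModel tubeModel ψ (tubeProj z) (V i))
          = ∑ a, ![r, s, w] i a • ∑ b, A b a • solFrame c' b (tubeLift ψ z) := by
        simp only [V, map_sum, map_smul]
        refine Finset.sum_congr rfl fun a _ => ?_
        rw [hA, sum_liftMatrix_smul hc' hψ hz, fderiv_tubeLift hψ.smooth hz]
      rw [e3]
      have e4 : ∀ b, (![A.mulVec r, A.mulVec s, A.mulVec w] i) b = ∑ a, A b a * ![r, s, w] i a := by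
        intro b
        fin_cases i <;> rfl
      simp only [e4, Finset.sum_smul, Finset.smul_sum, smul_smul]
      rw [Finset.sum_comm]
      refine Finset.sum_congr rfl fun b _ => Finset.sum_congr rfl fun a _ => ?_
      rw [mul_comm]
      rfl
    have e5 : solutionForm c' (ψ (tubeProj z))
        (fun i => mfderiv tubeModel tubeModel ψ (tubeProj z) (V i)) = solutionForm c (tubeProj z) V :=
      DFunLike.congr_fun (hψ.pullback_eq _ hz.2) V
    rw [e1, e2] at e5
    exact e5
  have := congrFun (congrFun key a) e
  rw [Matrix.mul_apply, Matrix.one_apply] at this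
  exact this

theorem contDiffAt_star_mul {p q : Amb → ℍ[ℝ]} {z : Amb} (hp : ContDiffAt ℝ ∞ p z)
    (hq : ContDiffAt ℝ ∞ q z) (i : Fin 3) : ContDiffAt ℝ ∞ (fun z => imPart i (star (p z) * q z)) z :=
  (LinearMap.toContinuousLinearMap (imPart i)).contDiff.contDiffAt.comp z
    ((contDiff_star_quaternion.contDiffAt.comp z hp).mul hq)

theorem contDiffAt_normSq_inv {p : Amb → ℍ[ℝ]} {z : Amb} (hp : ContDiffAt ℝ ∞ p z) (h0 : p z ≠ 0) :
    ContDiffAt ℝ ∞ (fun z => (Quaternion.normSq (p z))⁻¹) z := by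
  have h : (fun z => (Quaternion.normSq (p z))⁻¹) = fun z => (‖p z‖ ^ 2)⁻¹ := by
    funext z
    rw [Quaternion.normSq_eq_norm_mul_self, sq]
  rw [h]
  exact (hp.norm_sq ℝ).inv (pow_ne_zero 2 (norm_ne_zero_iff.2 h0))

theorem contDiffAt_tubeCoframe (hJ : IsOpen J) {f g : Fin 2 → ℝ → ℝ} (hf : ∀ P, ContDiffOn ℝ ∞ (f P) J)
    (hg : ∀ P, ContDiffOn ℝ ∞ (g P) J) (hd : ∀ t ∈ J, f 0 t * g 1 t - f 1 t * g 0 t ≠ 0)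
    {y v : Amb → Amb} {z : Amb} (hy : ContDiffAt ℝ ∞ y z) (hv : ContDiffAt ℝ ∞ v z)
    (hz : y z ∈ puncturedOver J) (b : FrameIx) :
    ContDiffAt ℝ ∞ (fun z => tubeCoframe f g (y z) (v z) b) z := by
  have hf' : ∀ P, ContDiffAt ℝ ∞ (fun z => f P (y z).1) z := fun P =>
    ((hf P).contDiffAt (hJ.mem_nhds hz.2)).comp z hy.fst
  have hg' : ∀ P, ContDiffAt ℝ ∞ (fun z => g P (y z).1) z := fun P =>
    ((hg P).contDiffAt (hJ.mem_nhds hz.2)).comp z hy.fst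
  rcases b with _ | ⟨P, i⟩
  · exact hv.fst
  · have h1 := (contDiffAt_normSq_inv hy.snd.fst hz.1.1).mul
      (contDiffAt_star_mul hy.snd.fst hv.snd.fst i)
    have h2 := (contDiffAt_normSq_inv hy.snd.snd hz.1.2).mul
      (contDiffAt_star_mul hy.snd.snd hv.snd.snd i)
    have h3 := (((hf' 0).mul (hg' 1)).sub ((hf' 1).mul (hg' 0)))
    fin_cases P
    · exact ((h1.mul (hg' 1)).add (h2.mul (hf' 1).neg)).div h3 (hd _ hz.2)
    · exact ((h1.mul (hg' 0).neg).add (h2.mul (hf' 0))).div h3 (hd _ hz.2)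

theorem contDiffAt_tubeFrame (hJ : IsOpen J) {f g : Fin 2 → ℝ → ℝ} (hf : ∀ P, ContDiffOn ℝ ∞ (f P) J)
    (hg : ∀ P, ContDiffOn ℝ ∞ (g P) J) {z : Amb} (hz : z.1 ∈ J) (a : FrameIx) :
    ContDiffAt ℝ ∞ (tubeFrame f g a) z := by
  have h1 : ContDiffAt ℝ ∞ (fun z : Amb => z.1) z := contDiffAt_fst
  have h2 : ContDiffAt ℝ ∞ (fun z : Amb => z.2.1) z := contDiffAt_snd.fst
  have h3 : ContDiffAt ℝ ∞ (fun z : Amb => z.2.2) z := contDiffAt_snd.snd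
  rcases a with _ | ⟨P, i⟩
  · exact contDiffAt_const
  · exact contDiffAt_const.prodMk
      (((((hf P).contDiffAt (hJ.mem_nhds hz)).comp z h1).smul (h2.mul contDiffAt_const)).prodMk
        ((((hg P).contDiffAt (hJ.mem_nhds hz)).comp z h1).smul (h3.mul contDiffAt_const)))

theorem isFrameMap_tubeLift (hc : IsSolution c J) (hc' : IsSolution c' J)
    (hψ : IsLocalIso tubeModel (solutionForm c) (solutionForm c') (tubeOver J) ψ) :
    IsFrameMap (solFrame c) (solFrame c') (liftMatrix c c' ψ) (tubeLift ψ)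
      (punctured ∩ tubeProj ⁻¹' ψ.source) (puncturedOver J) where
  isOpen := isOpen_lift ψ
  mapsTo z hz := ⟨tubeIncl_mem_punctured _, (hψ.target_subset (ψ.map_source hz.2)).1⟩
  contDiffAt z hz := contDiffAt_tubeLift hψ.smooth hz
  contDiffAt_matrix z hz b a := by
    have h1 := contDiffAt_tubeLift hψ.smooth hz
    have h2 := contDiffAt_tubeFrame hc.isOpen (fun P => (hc.contDiffOn_solF P).1)
      (fun P => (hc.contDiffOn_solF P).2) (hψ.source_subset hz.2).1 a
    have h3 := (h1.fderiv_right (m := ∞) (by simp)).clm_apply h2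
    exact contDiffAt_tubeCoframe hc'.isOpen (fun P => (hc'.contDiffOn_solF P).1)
      (fun P => (hc'.contDiffOn_solF P).2) hc'.isInvariantFrame.det_ne h1 h3
      ⟨tubeIncl_mem_punctured _, (hψ.target_subset (ψ.map_source hz.2)).1⟩ b
  fderiv_apply z hz a := (sum_liftMatrix_smul hc' hψ hz a).symm

end Lift

end


noncomputable section

/-! ### Invariants of local equivalences -/

section Rigidity

theorem sum_mul_of_orthogonal {ι : Type*} [Fintype ι] [DecidableEq ι] {A : ι → ι → ℝ}
    (hA : ∀ a e, ∑ b, A b a * A b e = if a = e then 1 else 0) (a e : ι) :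
    ∑ b, A a b * A e b = if a = e then 1 else 0 := by
  have h : (Matrix.of A).transpose * Matrix.of A = 1 := by
    ext a e
    rw [Matrix.mul_apply, Matrix.one_apply]
    exact hA a e
  have h2 : Matrix.of A * (Matrix.of A).transpose = 1 := mul_eq_one_comm.1 h
  have h' := congrFun (congrFun h2 a) e
  rw [Matrix.mul_apply, Matrix.one_apply] at h'
  exact h'

/-- Conjugation by an orthogonal matrix preserves the trace and the norm. -/
theorem trace_of_conjugate {ι : Type*} [Fintype ι] [DecidableEq ι] {A N N' : ι → ι → ℝ}
    (hA : ∀ a e, ∑ b, A b a * A b e = if a = e then 1 else 0)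
    (hN : ∀ a j, N a j = ∑ k, (∑ b, A b a * N' b k) * A k j) :
    ∑ a, N a a = ∑ a, N' a a ∧ ∑ a, ∑ j, N a j ^ 2 = ∑ a, ∑ j, N' a j ^ 2 := by
  have h : (Matrix.of A).transpose * Matrix.of A = 1 := by
    ext a e
    rw [Matrix.mul_apply, Matrix.one_apply]
    exact hA a e
  have h' := mul_eq_one_comm.1 h
  have e : Matrix.of N = (Matrix.of A).transpose * Matrix.of N' * Matrix.of A := by
    ext a j
    rw [Matrix.mul_apply]
    simp only [Matrix.mul_apply]
    exact hN a j
  have hs : ∀ M : ι → ι → ℝ, ∑ a, ∑ j, M a j ^ 2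
      = Matrix.trace (Matrix.of M * (Matrix.of M).transpose) := by
    intro M
    simp [Matrix.trace, Matrix.mul_apply, sq]
  constructor
  · change Matrix.trace (Matrix.of N) = Matrix.trace (Matrix.of N')
    rw [e, Matrix.trace_mul_comm, ← Matrix.mul_assoc, h', Matrix.one_mul]
  · rw [hs, hs, e]
    simp only [Matrix.transpose_mul, Matrix.transpose_transpose]
    rw [Matrix.mul_assoc, ← Matrix.mul_assoc (Matrix.of A), h', Matrix.one_mul, Matrix.trace_mul_comm,
      ← Matrix.mul_assoc, Matrix.mul_assoc (Matrix.of N').transpose, h', Matrix.mul_one,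
      Matrix.trace_mul_comm]

variable {c c' : ℝ → ℝ × ℝ × ℝ} {J : Set ℝ} {ψ : OpenPartialHomeomorph Tube Tube}

theorem stateInvariant_tubeLift (hc : IsSolution c J) (hc' : IsSolution c' J)
    (hψ : IsLocalIso tubeModel (solutionForm c) (solutionForm c') (tubeOver J) ψ) {z : Amb}
    (hz : z ∈ punctured ∩ tubeProj ⁻¹' ψ.source) :
    stateInvariant (c z.1) = stateInvariant (c' (tubeLift ψ z).1) := by
  have hJ : z.1 ∈ J := (hψ.source_subset hz.2).1
  have hJ' : (tubeLift ψ z).1 ∈ J := (hψ.target_subset (ψ.map_source hz.2)).1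
  rw [← hc.frameCurvatureSq_eq hJ, ← hc'.frameCurvatureSq_eq hJ']
  have hX : IsLeviCivita (solFrame c) (solConn c) (punctured ∩ tubeProj ⁻¹' ψ.source) := by
    have hs : punctured ∩ tubeProj ⁻¹' ψ.source ⊆ puncturedOver J := fun y hy =>
      ⟨hy.1, (hψ.source_subset hy.2).1⟩
    have h := hc.isLeviCivita
    exact ⟨fun y hy => h.1 y (hs hy), fun y hy => h.2 y (hs hy), fun y hy => h.3 y (hs hy),
      fun y hy => h.4 y (hs hy), fun y hy => h.5 y (hs hy)⟩
  exact (isFrameMap_tubeLift hc hc' hψ).curvatureSq_eq hX hc'.isLeviCivita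
    (fun y hy => liftMatrix_orthogonal hc hc' hψ hy) hz

/-- ψ preserves the curvature norm, a function of t with nonzero derivative on either side.
Differentiating along the orbits shows that the row `none` has no orbit components. Orthogonality
leaves ±1 for the remaining entry. -/
theorem liftMatrix_none (hc : IsSolution c J) (hc' : IsSolution c' J)
    (hψ : IsLocalIso tubeModel (solutionForm c) (solutionForm c') (tubeOver J) ψ)
    (hI : ∀ t ∈ J, deriv (fun s => stateInvariant (c s)) t < 0)
    (hI' : ∀ t ∈ J, deriv (fun s => stateInvariant (c' s)) t < 0) {z : Amb}
    (hz : z ∈ punctured ∩ tubeProj ⁻¹' ψ.source) (a : FrameIx) :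
    liftMatrix c c' ψ none a z = if a = none then 1 else 0 := by
  have hJ : z.1 ∈ J := (hψ.source_subset hz.2).1
  have hJ' : (tubeLift ψ z).1 ∈ J := (hψ.target_subset (ψ.map_source hz.2)).1
  have h1 : ∀ a, deriv (fun s => stateInvariant (c s)) z.1 * (solFrame c a z).1
      = deriv (fun s => stateInvariant (c' s)) (tubeLift ψ z).1
        * (fderiv ℝ (tubeLift ψ) z (solFrame c a z)).1 := by
    intro a
    have e := (eventuallyEq_of_open (isOpen_lift ψ)
      (fun y hy => stateInvariant_tubeLift hc hc' hψ hy) hz).fderiv_eq (𝕜 := ℝ)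
    have d1 := (differentiableAt_of_deriv_ne_zero (hI _ hJ).ne).hasDerivAt.comp_hasFDerivAt z
      (hasFDerivAt_fst (𝕜 := ℝ) (p := z))
    have d2 := (differentiableAt_of_deriv_ne_zero (hI' _ hJ').ne).hasDerivAt.comp_hasFDerivAt z
      ((contDiffAt_tubeLift hψ.smooth hz).differentiableAt (by simp)).hasFDerivAt.fst
    have e1 := d1.fderiv
    have e2 := d2.fderiv
    simp only [Function.comp_def] at e1 e2
    rw [e1, e2] at e
    have := DFunLike.congr_fun e (solFrame c a z)
    simpa using this
  have h2 : ∀ a, (fderiv ℝ (tubeLift ψ) z (solFrame c a z)).1 = liftMatrix c c' ψ none a z :=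
    fun a => rfl
  simp only [tubeFrame_fst, h2] at h1
  have h3 : ∀ a, a ≠ none → liftMatrix c c' ψ none a z = 0 := by
    intro a ha
    have := h1 a
    rw [if_neg ha, mul_zero] at this
    exact (mul_eq_zero.1 this.symm).resolve_left (hI' _ hJ').ne
  by_cases ha : a = none
  · subst ha
    rw [if_pos rfl]
    have h4 := sum_mul_of_orthogonal (liftMatrix_orthogonal hc hc' hψ hz) none none
    rw [Fintype.sum_option, if_pos rfl] at h4
    have h5 : ∑ i : Fin 2 × Fin 3, liftMatrix c c' ψ none (some i) z
        * liftMatrix c c' ψ none (some i) z = 0 :=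
      Finset.sum_eq_zero fun i _ => by rw [h3 _ (by simp), mul_zero]
    rw [h5, add_zero] at h4
    have h6 := h1 none
    rw [if_pos rfl, mul_one] at h6
    -- The value −1 would give the two derivatives of the curvature norm opposite signs, but both
    -- are negative.
    rcases mul_self_eq_one_iff.1 h4 with h7 | h7
    · exact h7
    · rw [h7] at h6
      linarith [hI _ hJ, hI' _ hJ']
  · rw [if_neg ha, h3 a ha]

theorem trace_solConn (c : ℝ → ℝ × ℝ × ℝ) (z : Amb) :
    ∑ a, solConn c a none a z = -6 * (c z.1).1 := by
  simp [tubeConn, conn, Fintype.sum_option, Fintype.sum_prod_type, shapeOp, dl, stα, stβ]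
  ring

theorem norm_solConn (c : ℝ → ℝ × ℝ × ℝ) (z : Amb) (h : 0 < (c z.1).2.2) :
    ∑ a, ∑ j, solConn c a none j z ^ 2
      = 6 * ((c z.1).1 ^ 2 + (1 + (c z.1).1 ^ 2) * shapeRatio (c z.1).2.1 (c z.1).2.2) := by
  rw [← eShape_sq_add_fShape_sq _ h]
  simp [tubeConn, conn, Fintype.sum_option, Fintype.sum_prod_type, shapeOp, dl, stα, stβ, stσ,
    Fin.sum_univ_three]
  ring

/-- The three invariants that separate the members of the family. -/
def stateInvariants (c : ℝ × ℝ × ℝ) : ℝ × ℝ × ℝ := (c.1, shapeRatio c.2.1 c.2.2, stateInvariant c)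

/-- Since ψ sends ∂_t to ∂_t, the `none` row of the connection law is free of derivatives of A and
says that the shape operators are conjugate. Their traces give p, their norms then give M, and the
curvature norm gives the third entry. -/
theorem stateInvariants_eq (hc : IsSolution c J) (hc' : IsSolution c' J)
    (hψ : IsLocalIso tubeModel (solutionForm c) (solutionForm c') (tubeOver J) ψ)
    (hI : ∀ t ∈ J, deriv (fun s => stateInvariant (c s)) t < 0)
    (hI' : ∀ t ∈ J, deriv (fun s => stateInvariant (c' s)) t < 0) {p : Tube}
    (hp : p ∈ ψ.source) : stateInvariants (c p.1) = stateInvariants (c' (ψ p).1) := by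
  obtain ⟨z, hz, hzp, hzψ⟩ : ∃ z ∈ punctured ∩ tubeProj ⁻¹' ψ.source, z.1 = p.1 ∧
      (tubeLift ψ z).1 = (ψ p).1 := by
    refine ⟨tubeIncl p, ⟨tubeIncl_mem_punctured p, ?_⟩, rfl, ?_⟩
    · rwa [mem_preimage, tubeProj_tubeIncl]
    · rw [tubeLift, tubeProj_tubeIncl]
      rfl
  have hJ : z.1 ∈ J := (hψ.source_subset hz.2).1
  have hJ' : (tubeLift ψ z).1 ∈ J := (hψ.target_subset (ψ.map_source hz.2)).1
  have hs : punctured ∩ tubeProj ⁻¹' ψ.source ⊆ puncturedOver J := fun y hy =>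
      ⟨hy.1, (hψ.source_subset hy.2).1⟩
  have hX : IsLeviCivita (solFrame c) (solConn c) (punctured ∩ tubeProj ⁻¹' ψ.source) := by
    have h := hc.isLeviCivita
    exact ⟨fun y hy => h.1 y (hs hy), fun y hy => h.2 y (hs hy), fun y hy => h.3 y (hs hy),
      fun y hy => h.4 y (hs hy), fun y hy => h.5 y (hs hy)⟩
  have hA := fun y hy => liftMatrix_orthogonal hc hc' hψ (z := y) hy
  have hn : ∀ a j, solConn c a none j z
      = ∑ k, (∑ b, liftMatrix c c' ψ b a z * solConn c' b none k (tubeLift ψ z))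
        * liftMatrix c c' ψ k j z := by
    intro a j
    have h1 := (isFrameMap_tubeLift hc hc' hψ).fderiv_matrix hX hc'.isLeviCivita hA hz a none j
    have h2 := (eventuallyEq_of_open (isOpen_lift ψ)
      (fun y hy => liftMatrix_none hc hc' hψ hI hI' hy j) hz).fderiv_eq (𝕜 := ℝ)
    have h3 : ∑ k, liftMatrix c c' ψ none k z * solConn c a k j z = solConn c a none j z := by
      simp only [liftMatrix_none hc hc' hψ hI hI' hz]
      simp
    rw [h2, h3] at h1
    simp only [fderiv_fun_const, Pi.zero_apply, zero_apply] at h1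
    linarith
  obtain ⟨h1, h2⟩ := trace_of_conjugate (hA z hz) hn
  rw [trace_solConn, trace_solConn] at h1
  rw [norm_solConn c z (hc.pos _ hJ), norm_solConn c' _ (hc'.pos _ hJ')] at h2
  have h3 := stateInvariant_tubeLift hc hc' hψ hz
  have h4 : (c z.1).1 = (c' (tubeLift ψ z).1).1 := by linarith
  rw [← h4] at h2
  have h5 : shapeRatio (c z.1).2.1 (c z.1).2.2
      = shapeRatio (c' (tubeLift ψ z).1).2.1 (c' (tubeLift ψ z).1).2.2 := by
    have h6 : 0 < 1 + (c z.1).1 ^ 2 := by positivity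
    have h7 : (1 + (c z.1).1 ^ 2) * shapeRatio (c z.1).2.1 (c z.1).2.2
      = (1 + (c z.1).1 ^ 2) * shapeRatio (c' (tubeLift ψ z).1).2.1 (c' (tubeLift ψ z).1).2.2 := by
      linarith
    exact mul_left_cancel₀ h6.ne' h7
  rw [← hzp, ← hzψ]
  exact Prod.ext h4 (Prod.ext h5 h3)

end Rigidity

end


noncomputable section

/-! ### The invariants are local coordinates -/

section Nondegenerate

/-- The real part of `(b + i c)³ (a + i b)`. -/
def hRe (x y : ℝ) : ℝ :=
  (bb x y ^ 3 - 3 * bb x y * cc x y ^ 2) * aa x y - (3 * bb x y ^ 2 * cc x y - cc x y ^ 3) * bb x y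

/-- The imaginary part of `(b + i c)³ (a + i b)`. -/
def hIm (x y : ℝ) : ℝ :=
  (bb x y ^ 3 - 3 * bb x y * cc x y ^ 2) * bb x y + (3 * bb x y ^ 2 * cc x y - cc x y ^ 3) * aa x y

/-- Here q (`wRe` + i `wIm`) = (1 + p²)(b − ic)² + (1 + ip)²(a + ib)(c − ib). Because c − ib = −i(b
+ ic), the cross term of the squared modulus is governed by (b + ic)³(a + ib), which is `hRe` + i
`hIm`. -/
theorem curvInvariant_eq (p : ℝ) {x y : ℝ} (h0 : 0 < y) : curvInvariant p x y
    = 84 + 120 * ((1 + p ^ 2) * (1 - shapeRatio x y)) ^ 2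
      + 288 * ((1 + p ^ 2) ^ 2 * (shapeRatio x y ^ 2 + shapeRatio x y)
        + 2 * (1 + p ^ 2) * (2 * p * (hRe x y / qq x y ^ 2) + (1 - p ^ 2) * (hIm x y / qq x y ^ 2))) := by
  have h2 : qq x y ≠ 0 := (qq_pos h0).ne'
  simp only [curvInvariant, wZero, wRe, wIm, hRe, hIm, shapeRatio, eShape, fShape]
  field_simp
  rw [qq_eq]
  ring

/-- The derivative of `a`. -/
def aaDot (x y x' y' : ℝ) : ℝ := (2 * x + 1) * x' - 2 * y * y'

/-- The derivative of `b`. -/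
def bbDot (x y x' y' : ℝ) : ℝ := y' * (2 * x + 1) + 2 * y * x'

/-- The derivative of `3 (x² + x) + y²`. -/
def ccDot (x y x' y' : ℝ) : ℝ := 3 * (2 * x + 1) * x' + 2 * y * y'

/-- The derivative of `a² + b²`. -/
def qqDot (x y x' y' : ℝ) : ℝ := 2 * aa x y * aaDot x y x' y' + 2 * bb x y * bbDot x y x' y'

/-- The numerator of the derivative of `shapeRatio`. -/
def ratioNum (x y x' y' : ℝ) : ℝ :=
  (2 * bb x y * bbDot x y x' y' + 2 * cc x y * ccDot x y x' y') * qq x y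
    - (bb x y ^ 2 + cc x y ^ 2) * qqDot x y x' y'

/-- The numerator of the derivative of `hIm / qq²`. -/
def hNum (x y x' y' : ℝ) : ℝ :=
  (4 * bb x y ^ 3 * bbDot x y x' y' - 6 * bb x y * bbDot x y x' y' * cc x y ^ 2
    - 6 * bb x y ^ 2 * cc x y * ccDot x y x' y' + 3 * aaDot x y x' y' * bb x y ^ 2 * cc x y
    + 6 * aa x y * bb x y * bbDot x y x' y' * cc x y + 3 * aa x y * bb x y ^ 2 * ccDot x y x' y'
    - aaDot x y x' y' * cc x y ^ 3 - 3 * aa x y * cc x y ^ 2 * ccDot x y x' y') * qq x y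
    - 2 * hIm x y * qqDot x y x' y'

/-! ### Derivatives of the invariants along a curve of states -/

section Curve

variable {p x y : ℝ → ℝ} {t p' x' y' : ℝ}

theorem hasDerivAt_aa (hx : HasDerivAt x x' t) (hy : HasDerivAt y y' t) :
    HasDerivAt (fun s => aa (x s) (y s)) (aaDot (x t) (y t) x' y') t := by
  refine (((hx.pow 2).add hx).sub (hy.pow 2)).congr_deriv ?_
  simp [aaDot]
  ring

theorem hasDerivAt_bb (hx : HasDerivAt x x' t) (hy : HasDerivAt y y' t) :
    HasDerivAt (fun s => bb (x s) (y s)) (bbDot (x t) (y t) x' y') t := by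
  refine (hy.mul ((hx.const_mul 2).add_const 1)).congr_deriv ?_
  simp [bbDot]
  ring

theorem hasDerivAt_cc (hx : HasDerivAt x x' t) (hy : HasDerivAt y y' t) :
    HasDerivAt (fun s => cc (x s) (y s)) (ccDot (x t) (y t) x' y') t := by
  refine ((((hx.pow 2).add hx).const_mul 3).add (hy.pow 2)).congr_deriv ?_
  simp [ccDot]
  ring

theorem hasDerivAt_qq' (hx : HasDerivAt x x' t) (hy : HasDerivAt y y' t) :
    HasDerivAt (fun s => qq (x s) (y s)) (qqDot (x t) (y t) x' y') t := by
  refine (hasDerivAt_qq hx hy).congr_deriv ?_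
  simp only [qqDot, aa, bb, aaDot, bbDot]
  ring

theorem hasDerivAt_shapeRatio (hx : HasDerivAt x x' t) (hy : HasDerivAt y y' t) (h0 : 0 < y t) :
    HasDerivAt (fun s => shapeRatio (x s) (y s))
      (ratioNum (x t) (y t) x' y' / qq (x t) (y t) ^ 2) t := by
  refine ((((hasDerivAt_bb hx hy).pow 2).add ((hasDerivAt_cc hx hy).pow 2)).div
    (hasDerivAt_qq' hx hy) (qq_pos h0).ne').congr_deriv ?_
  simp [ratioNum]

theorem hasDerivAt_hIm_div (hx : HasDerivAt x x' t) (hy : HasDerivAt y y' t) (h0 : 0 < y t) :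
    HasDerivAt (fun s => hIm (x s) (y s) / qq (x s) (y s) ^ 2)
      (hNum (x t) (y t) x' y' / qq (x t) (y t) ^ 3) t := by
  have ha := hasDerivAt_aa hx hy
  have hb := hasDerivAt_bb hx hy
  have hc := hasDerivAt_cc hx hy
  have h2 := (qq_pos (x := x t) h0).ne'
  refine ((((((hb.pow 3).sub ((hb.const_mul 3).mul (hc.pow 2))).mul hb).add
    (((((hb.pow 2).const_mul 3).mul hc).sub (hc.pow 3)).mul ha))).div
    ((hasDerivAt_qq' hx hy).pow 2) (pow_ne_zero 2 h2)).congr_deriv ?_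
  simp only [hNum, hIm, Pi.pow_apply, Pi.mul_apply, Pi.add_apply, Pi.sub_apply]
  field_simp
  ring

theorem differentiableAt_hRe_div (hx : HasDerivAt x x' t) (hy : HasDerivAt y y' t) (h0 : 0 < y t) :
    DifferentiableAt ℝ (fun s => hRe (x s) (y s) / qq (x s) (y s) ^ 2) t := by
  have ha := (hasDerivAt_aa hx hy).differentiableAt
  have hb := (hasDerivAt_bb hx hy).differentiableAt
  have hc := (hasDerivAt_cc hx hy).differentiableAt
  have hq := (hasDerivAt_qq' hx hy).differentiableAt
  have h2 := (qq_pos (x := x t) h0).ne'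
  unfold hRe
  exact DifferentiableAt.fun_div (by fun_prop) (by fun_prop) (pow_ne_zero 2 h2)

/-- At p = 0 the factors 1 ± p² are stationary. The coefficient 48 + 816 M is the derivative of
120(1 − M)² + 288(M² + M) in M, and the term 2p · `hRe` contributes through p'. -/
theorem hasDerivAt_curvInvariant (hp : HasDerivAt p p' t) (hx : HasDerivAt x x' t)
    (hy : HasDerivAt y y' t) (h0 : 0 < y t) (h1 : p t = 0) :
    HasDerivAt (fun s => curvInvariant (p s) (x s) (y s))
      ((48 + 816 * shapeRatio (x t) (y t)) * (ratioNum (x t) (y t) x' y' / qq (x t) (y t) ^ 2)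
        + 1152 * p' * (hRe (x t) (y t) / qq (x t) (y t) ^ 2)
        + 576 * (hNum (x t) (y t) x' y' / qq (x t) (y t) ^ 3)) t := by
  have hM := hasDerivAt_shapeRatio hx hy h0
  have hH := hasDerivAt_hIm_div hx hy h0
  have hR := (differentiableAt_hRe_div hx hy h0).hasDerivAt
  have hP := (hp.pow 2).const_add 1
  have h := (((hP.mul (hM.const_sub 1)).pow 2).const_mul 120).const_add 84 |>.add
    ((((hP.pow 2).mul ((hM.pow 2).add hM)).add ((hP.const_mul 2).mul
      (((hp.const_mul 2).mul hR).add (((hp.pow 2).const_sub 1).mul hH)))).const_mul 288)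
  have e : (fun s => curvInvariant (p s) (x s) (y s)) =ᶠ[𝓝 t] _ :=
    (hy.continuousAt.eventually (lt_mem_nhds h0)).mono fun s hs => curvInvariant_eq (p s) hs
  refine (h.congr_of_eventuallyEq e).congr_deriv ?_
  simp only [Pi.pow_apply, Pi.mul_apply, Pi.add_apply, h1]
  push_cast
  ring

end Curve

theorem contDiffOn_stateInvariants : ContDiffOn ℝ ∞ stateInvariants {c : ℝ × ℝ × ℝ | 0 < c.2.2} := by
  have hq : ∀ c ∈ {c : ℝ × ℝ × ℝ | 0 < c.2.2}, qq c.2.1 c.2.2 ≠ 0 := fun c hc => (qq_pos hc).ne'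
  have hqs : ContDiffOn ℝ ∞ (fun c : ℝ × ℝ × ℝ => qq c.2.1 c.2.2) {c | 0 < c.2.2} := by
    unfold qq
    fun_prop
  have ha : ContDiffOn ℝ ∞ (fun c : ℝ × ℝ × ℝ => aa c.2.1 c.2.2) {c | 0 < c.2.2} := by
    unfold aa
    fun_prop
  have hb : ContDiffOn ℝ ∞ (fun c : ℝ × ℝ × ℝ => bb c.2.1 c.2.2) {c | 0 < c.2.2} := by
    unfold bb
    fun_prop
  have hc : ContDiffOn ℝ ∞ (fun c : ℝ × ℝ × ℝ => cc c.2.1 c.2.2) {c | 0 < c.2.2} := by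
    unfold cc
    fun_prop
  have hM : ContDiffOn ℝ ∞ (fun c : ℝ × ℝ × ℝ => shapeRatio c.2.1 c.2.2) {c | 0 < c.2.2} :=
    ((hb.pow 2).add (hc.pow 2)).div hqs hq
  have hR : ContDiffOn ℝ ∞ (fun c : ℝ × ℝ × ℝ => hRe c.2.1 c.2.2 / qq c.2.1 c.2.2 ^ 2)
      {c | 0 < c.2.2} := by
    unfold hRe
    exact ContDiffOn.div (by fun_prop) (hqs.pow 2) fun c hc => pow_ne_zero 2 (hq c hc)
  have hI : ContDiffOn ℝ ∞ (fun c : ℝ × ℝ × ℝ => hIm c.2.1 c.2.2 / qq c.2.1 c.2.2 ^ 2)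
      {c | 0 < c.2.2} := by
    unfold hIm
    exact ContDiffOn.div (by fun_prop) (hqs.pow 2) fun c hc => pow_ne_zero 2 (hq c hc)
  refine contDiffOn_fst.prodMk (hM.prodMk ?_)
  refine ContDiffOn.congr ?_ fun c hc => curvInvariant_eq c.1 hc
  fun_prop

theorem contDiffAt_stateInvariants {c : ℝ × ℝ × ℝ} (h : 0 < c.2.2) :
    ContDiffAt ℝ ∞ stateInvariants c :=
  contDiffOn_stateInvariants.contDiffAt (isOpen_halfSpace.mem_nhds h)

theorem fderiv_stateInvariants {x y : ℝ} (h0 : 0 < y) (v : ℝ × ℝ × ℝ) :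
    fderiv ℝ stateInvariants (0, x, y) v = (v.1, ratioNum x y v.2.1 v.2.2 / qq x y ^ 2,
      (48 + 816 * shapeRatio x y) * (ratioNum x y v.2.1 v.2.2 / qq x y ^ 2)
        + 1152 * v.1 * (hRe x y / qq x y ^ 2) + 576 * (hNum x y v.2.1 v.2.2 / qq x y ^ 3)) := by
  have hp : HasDerivAt (fun s : ℝ => s * v.1) v.1 0 := by simpa using (hasDerivAt_id (0 : ℝ)).mul_const v.1
  have hx : HasDerivAt (fun s : ℝ => x + s * v.2.1) v.2.1 0 := by
    simpa using ((hasDerivAt_id (0 : ℝ)).mul_const v.2.1).const_add x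
  have hy : HasDerivAt (fun s : ℝ => y + s * v.2.2) v.2.2 0 := by
    simpa using ((hasDerivAt_id (0 : ℝ)).mul_const v.2.2).const_add y
  have h1 := hp.prodMk ((hasDerivAt_shapeRatio hx hy (by simpa using h0)).prodMk
    (hasDerivAt_curvInvariant hp hx hy (by simpa using h0) (by simp)))
  have h2 := (((contDiffAt_stateInvariants (c := (0, x, y)) h0).differentiableAt
    (by simp)).hasFDerivAt.congr_fderiv rfl)
  have h3 : HasFDerivAt stateInvariants (fderiv ℝ stateInvariants (0, x, y))
      ((fun s : ℝ => (s * v.1, x + s * v.2.1, y + s * v.2.2)) 0) := by simpa using h2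
  have h4 := h3.comp_hasDerivAt 0 (hp.prodMk (hx.prodMk hy))
  have h5 := h4.unique h1
  simpa using h5

theorem ratioNum_hNum_linear {e : ℝ} (u v : ℝ) : ratioNum e 1 u v = u * ratioNum e 1 1 0 + v * ratioNum e 1 0 1
    ∧ hNum e 1 u v = u * hNum e 1 1 0 + v * hNum e 1 0 1 := by
  simp only [ratioNum, hNum, qqDot, aaDot, bbDot, ccDot]
  constructor <;> ring

/-- After e² is taken out, all coefficients are positive. The Jacobian degenerates at e = 0, the
round state, so the rigid members are sought at x > 0. -/
theorem jacobian_pos {e : ℝ} (he : 0 < e) :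
    0 < ratioNum e 1 1 0 * hNum e 1 0 1 - ratioNum e 1 0 1 * hNum e 1 1 0 := by
  have : ratioNum e 1 1 0 * hNum e 1 0 1 - ratioNum e 1 0 1 * hNum e 1 1 0
      = e ^ 2 * (256 + 1280 * e + 2688 * e ^ 2 + 3584 * e ^ 3 + 3584 * e ^ 4 + 2560 * e ^ 5
        + 1152 * e ^ 6 + 256 * e ^ 7) := by
    simp only [ratioNum, hNum, hIm, qqDot, aaDot, bbDot, ccDot, aa, bb, cc, qq]
    ring
  rw [this]
  positivity

/-- Once denominators are cleared, the derivative of the curvature norm along the flow is −e³ times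
a polynomial with positive coefficients. -/
theorem fderiv_stateInvariants_stateField_neg {e : ℝ} (he : 0 < e) :
    (fderiv ℝ stateInvariants (0, e, 1) (stateField (0, e, 1))).2.2 < 0 := by
  have hq := qq_pos (x := e) one_pos
  rw [fderiv_stateInvariants one_pos]
  have key : qq e 1 ^ 4 * ((48 + 816 * shapeRatio e 1)
      * (ratioNum e 1 (stateField (0, e, 1)).2.1 (stateField (0, e, 1)).2.2 / qq e 1 ^ 2)
        + 1152 * (stateField (0, e, 1)).1 * (hRe e 1 / qq e 1 ^ 2)
        + 576 * (hNum e 1 (stateField (0, e, 1)).2.1 (stateField (0, e, 1)).2.2 / qq e 1 ^ 3))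
      = -(e ^ 3 * (245760 + 1720320 * e + 5529600 * e ^ 2 + 11304960 * e ^ 3 + 16711680 * e ^ 4
        + 18800640 * e ^ 5 + 16343040 * e ^ 6 + 10813440 * e ^ 7 + 5160960 * e ^ 8
        + 1597440 * e ^ 9 + 245760 * e ^ 10)) := by
    simp only [stateField, pDot, xDot, yDot, shapeRatio, ratioNum, hNum, hRe, hIm, qqDot, aaDot,
      bbDot, ccDot]
    field_simp
    simp only [aa, bb, cc, qq]
    ring
  have h4 : 0 < qq e 1 ^ 4 := by positivity
  refine neg_of_mul_neg_right (a := qq e 1 ^ 4) ?_ h4.le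
  rw [key]
  have : 0 < e ^ 3 * (245760 + 1720320 * e + 5529600 * e ^ 2 + 11304960 * e ^ 3 + 16711680 * e ^ 4
        + 18800640 * e ^ 5 + 16343040 * e ^ 6 + 10813440 * e ^ 7 + 5160960 * e ^ 8
        + 1597440 * e ^ 9 + 245760 * e ^ 10) := by positivity
  linarith

/-- The first invariant is p itself. For p-component zero, what remains is triangular in the
numerators for M and `hIm`/q², whose 2×2 determinant is positive. -/
theorem fderiv_stateInvariants_injective {e : ℝ} (he : 0 < e) :
    Function.Injective (fderiv ℝ stateInvariants (0, e, 1)) := by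
  have hq := (qq_pos (x := e) one_pos).ne'
  rw [injective_iff_map_eq_zero]
  intro v hv
  rw [fderiv_stateInvariants one_pos] at hv
  simp only [Prod.mk_eq_zero] at hv
  obtain ⟨h1, h2, h3⟩ := hv
  rw [h2, h1] at h3
  have h4 : ratioNum e 1 v.2.1 v.2.2 = 0 := by simpa [hq] using h2
  have h5 : hNum e 1 v.2.1 v.2.2 = 0 := by simpa [hq] using h3
  rw [(ratioNum_hNum_linear _ _).1] at h4
  rw [(ratioNum_hNum_linear _ _).2] at h5
  have hJ := (jacobian_pos he).ne'
  have h6 : (ratioNum e 1 1 0 * hNum e 1 0 1 - ratioNum e 1 0 1 * hNum e 1 1 0) * v.2.1 = 0 := by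
    linear_combination hNum e 1 0 1 * h4 - ratioNum e 1 0 1 * h5
  have h7 : (ratioNum e 1 1 0 * hNum e 1 0 1 - ratioNum e 1 0 1 * hNum e 1 1 0) * v.2.2 = 0 := by
    linear_combination ratioNum e 1 1 0 * h5 - hNum e 1 1 0 * h4
  exact Prod.ext h1 (Prod.ext ((mul_eq_zero.1 h6).resolve_left hJ)
    ((mul_eq_zero.1 h7).resolve_left hJ))

/-- Near `(0, e, 1)` the invariants are coordinates, and the norm of the curvature decreases along
solutions. -/
theorem exists_isOpen_injOn_stateInvariants {e : ℝ} (he : 0 < e) : ∃ W : Set (ℝ × ℝ × ℝ), IsOpen W ∧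
    (0, e, 1) ∈ W ∧ W ⊆ {c | 0 < c.2.2} ∧ InjOn stateInvariants W ∧
    ∀ c ∈ W, (fderiv ℝ stateInvariants c (stateField c)).2.2 < 0 := by
  have hc := contDiffAt_stateInvariants (c := (0, e, 1)) one_pos
  have h1 := hc.hasStrictFDerivAt (by simp)
  let L : (ℝ × ℝ × ℝ) ≃L[ℝ] (ℝ × ℝ × ℝ) :=
    (LinearEquiv.ofInjectiveEndo (fderiv ℝ stateInvariants (0, e, 1)).toLinearMap
      (fderiv_stateInvariants_injective he)).toContinuousLinearEquiv
  have h2 : HasStrictFDerivAt stateInvariants (L : (ℝ × ℝ × ℝ) →L[ℝ] (ℝ × ℝ × ℝ)) (0, e, 1) := by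
    have hL : (L : (ℝ × ℝ × ℝ) →L[ℝ] (ℝ × ℝ × ℝ)) = fderiv ℝ stateInvariants (0, e, 1) :=
      ContinuousLinearMap.ext fun v => rfl
    rw [hL]
    exact h1
  have h3 : ContinuousOn (fun c => (fderiv ℝ stateInvariants c (stateField c)).2.2)
      {c : ℝ × ℝ × ℝ | 0 < c.2.2} := by
    have := (contDiffOn_stateInvariants.fderiv_of_isOpen (m := ∞) isOpen_halfSpace
      (by simp)).clm_apply contDiffOn_stateField
    exact this.snd.snd.continuousOn
  refine ⟨(h2.toOpenPartialHomeomorph stateInvariants).source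
    ∩ ({c | 0 < c.2.2} ∩ (fun c => (fderiv ℝ stateInvariants c (stateField c)).2.2) ⁻¹' Iio 0),
    (OpenPartialHomeomorph.open_source _).inter (h3.isOpen_inter_preimage isOpen_halfSpace isOpen_Iio),
    ⟨h2.mem_toOpenPartialHomeomorph_source, one_pos (α := ℝ), fderiv_stateInvariants_stateField_neg he⟩,
    fun c hc => hc.2.1, ?_, fun c hc => hc.2.2⟩
  exact (OpenPartialHomeomorph.injOn (h2.toOpenPartialHomeomorph stateInvariants)).mono
    inter_subset_left

end Nondegenerate

end


noncomputable section

/-! ### The two-parameter family -/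

theorem IsSolution.deriv_stateInvariant {c : ℝ → ℝ × ℝ × ℝ} {J : Set ℝ} (hc : IsSolution c J)
    {t : ℝ} (ht : t ∈ J) : _root_.deriv (fun s => stateInvariant (c s)) t
      = (fderiv ℝ stateInvariants (c t) (stateField (c t))).2.2 := by
  have h := ((contDiffAt_stateInvariants (hc.pos t ht)).differentiableAt
    (by simp)).hasFDerivAt.comp_hasDerivAt t (hc.deriv t ht)
  exact (hasDerivAt_triple (c := fun s => stateInvariants (c s)) h).2.2.deriv

/-- Two solutions that vanish in the first coordinate at `t₀` and meet at nearby times agree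
at `t₀`. -/
theorem IsSolution.eq_of_meet {c c' : ℝ → ℝ × ℝ × ℝ} {t₀ δ : ℝ}
    (hc : IsSolution c (Ioo (t₀ - δ) (t₀ + δ))) (hc' : IsSolution c' (Ioo (t₀ - δ) (t₀ + δ)))
    (h₀ : (c t₀).1 = 0) (h₀' : (c' t₀).1 = 0) {t t' : ℝ}
    (ht : t ∈ Ioo (t₀ - δ / 4) (t₀ + δ / 4)) (ht' : t' ∈ Ioo (t₀ - δ / 4) (t₀ + δ / 4))
    (h : c t = c' t') : t = t' ∧ c t₀ = c' t₀ := by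
  obtain ⟨h1, h2⟩ := ht
  obtain ⟨h1', h2'⟩ := ht'
  have hδ : 0 < δ := by linarith
  have hK : Ioo (t₀ - δ / 2) (t₀ + δ / 2) ⊆ Ioo (t₀ - δ) (t₀ + δ) :=
    Ioo_subset_Ioo (by linarith) (by linarith)
  -- Times within δ/4 of t₀ differ by less than δ/2, so the translate of the half-size interval
  -- stays in the domain of c'.
  have hK' : Ioo (t₀ - δ / 2) (t₀ + δ / 2)
      ⊆ (fun s => s + (t' - t)) ⁻¹' Ioo (t₀ - δ) (t₀ + δ) := fun s hs =>
    ⟨by linarith [hs.1], by linarith [hs.2]⟩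
  have he := (hc.mono isOpen_Ioo hK).eqOn ((hc'.comp_add (t' - t)).mono isOpen_Ioo hK')
    isPreconnected_Ioo (t₀ := t) ⟨by linarith, by linarith⟩ (by simpa using h)
  have he₀ : c t₀ = c' (t₀ + (t' - t)) := he ⟨by linarith, by linarith⟩
  -- p vanishes along c' at both times and is strictly decreasing there, so the translation is
  -- trivial.
  have hm : t₀ + (t' - t) = t₀ := by
    refine (hc'.strictAntiOn (convex_Ioo _ _)).injOn ⟨by linarith, by linarith⟩
      ⟨by linarith, by linarith⟩ ?_
    rw [h₀', ← h₀, he₀]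
  refine ⟨by linarith, ?_⟩
  rw [he₀, hm]

theorem coeffs_solutionForm (c : ℝ → ℝ × ℝ × ℝ) (t : ℝ) :
    coeffs (solutionForm c) t = ![-9 * stateCoeffs (c t) 0, -27 * stateCoeffs (c t) 4,
      -27 * stateCoeffs (c t) 1, -27 * stateCoeffs (c t) 3, -27 * stateCoeffs (c t) 2] :=
  coeffs_tubeForm _ t

theorem continuousOn_coeffs_solutionForm {X : Type*} [TopologicalSpace X] {S : Set (X × ℝ)}
    {c : X → ℝ → ℝ × ℝ × ℝ} (hc : ContinuousOn (fun z : X × ℝ => c z.1 z.2) S)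
    (hpos : ∀ z ∈ S, 0 < (c z.1 z.2).2.2) :
    ContinuousOn (fun z : X × ℝ => coeffs (solutionForm (c z.1)) z.2) S := by
  have h := continuousOn_pi.1 (contDiffOn_stateCoeffs.continuousOn.comp hc hpos)
  simp only [coeffs_solutionForm]
  refine continuousOn_pi.2 fun i => ?_
  fin_cases i
  exacts [(h 0).const_mul _, (h 4).const_mul _, (h 1).const_mul _, (h 3).const_mul _,
    (h 2).const_mul _]

theorem mainTheorem5 :
    ∃ (a b : ℝ) (B : Set (ℝ × ℝ)) (φ : ℝ × ℝ → TubeForm),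
      Real.pi / 4 ∈ Ioo a b ∧ IsOpen B ∧ IsConnected B ∧ (0 : ℝ × ℝ) ∈ B ∧
      -- every member is a `G`-invariant nearly parallel structure on `J × G/H`, `J = (a, b)`,
      -- with `t` the arc length
      (∀ s ∈ B, IsNearlyParallel tubeModel 4 (φ s) (tubeOver (Ioo a b)) ∧
        IsGInvariant (φ s) (Ioo a b) ∧ IsArcLength (φ s) (Ioo a b)) ∧
      -- the members depend continuously on the parameter
      ContinuousOn (fun x : (ℝ × ℝ) × ℝ => coeffs (φ x.1) x.2) (B ×ˢ Ioo a b) ∧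
      -- the member at `0` is the round-sphere solution
      (∀ t ∈ Ioo a b, coeffs (φ 0) t = roundCoeffs t) ∧
      -- the initial data at `t = π / 4` form an injectively immersed surface
      InjOn (fun s => coeffs (φ s) (Real.pi / 4)) B ∧
      ContDiffOn ℝ ∞ (fun s => coeffs (φ s) (Real.pi / 4)) B ∧
      (∀ s ∈ B, Function.Injective (fderiv ℝ (fun s => coeffs (φ s) (Real.pi / 4)) s)) ∧
      -- which is transverse to the round-sphere solution
      deriv roundCoeffs (Real.pi / 4) ∉
        Set.range (fderiv ℝ (fun s => coeffs (φ s) (Real.pi / 4)) 0) ∧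
      -- an open two-parameter family of pairwise non-equivalent, not locally homogeneous members
      ∃ U ⊆ B, IsOpen U ∧ U.Nonempty ∧
        (∀ s ∈ U, ¬ LocallyHomogeneous tubeModel (φ s) (tubeOver (Ioo a b))) ∧
        (∀ s ∈ U, ∀ s' ∈ U, s ≠ s' →
          ¬ LocallyEquivalent tubeModel (φ s) (φ s') (tubeOver (Ioo a b))) := by
  obtain ⟨δ, ρ, c, hδ, hρ, hc, hcont, hround⟩ := exists_solution_family
  set τ := Real.pi / 4 with hτ
  have hτJ : τ ∈ Ioo (τ - δ) (τ + δ) := ⟨by linarith, by linarith⟩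
  -- The point (0, ρ/2, 1) is the initial state of the parameter (ρ/2, 0): inside the family but
  -- away from the round state, where the invariants degenerate.
  obtain ⟨W, hWo, hWe, -, hWinj, hWneg⟩ :=
    exists_isOpen_injOn_stateInvariants (e := ρ / 2) (by linarith)
  have hs₀ : ((ρ / 2, 0) : ℝ × ℝ) ∈ Metric.ball (0 : ℝ × ℝ) ρ := by
    rw [mem_ball_zero_iff, Prod.norm_def]
    simp only [Real.norm_eq_abs, abs_zero, abs_of_pos (half_pos hρ)]
    exact max_lt (by linarith) hρ
  obtain ⟨ε, hε, hεW⟩ : ∃ ε > 0, ∀ s ∈ Metric.ball ((ρ / 2, 0) : ℝ × ℝ) ε,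
      ∀ t ∈ Ioo (τ - ε) (τ + ε), c s t ∈ W := by
    have h1 := (hcont.isOpen_inter_preimage (Metric.isOpen_ball.prod isOpen_Ioo) hWo).mem_nhds
      (x := (((ρ / 2, 0) : ℝ × ℝ), τ)) ⟨⟨hs₀, hτJ⟩, by
        simpa [(hc _ hs₀).2] using hWe⟩
    obtain ⟨ε, hε, h2⟩ := Metric.mem_nhds_iff.1 h1
    refine ⟨ε, hε, fun s hs t ht => (h2 (?_ : (s, t) ∈ _)).2⟩
    rw [← ball_prod_same]
    exact ⟨hs, by rwa [Real.ball_eq_Ioo]⟩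
  -- One interval has to serve three purposes: states near (ρ/2, 0) stay in W (ε),
  -- `IsSolution.eq_of_meet` applies (δ/4), and J lies in (0, π/2), where the round coefficients are
  -- known (τ = π/4).
  obtain ⟨η, hη, hη1, hη2, hη3⟩ : ∃ η > 0, η ≤ ε ∧ η ≤ δ / 4 ∧ η ≤ τ :=
    ⟨min ε (min (δ / 4) τ), lt_min hε (lt_min (by linarith) (by positivity)), min_le_left _ _,
      (min_le_right _ _).trans (min_le_left _ _), (min_le_right _ _).trans (min_le_right _ _)⟩
  have hJδ : Ioo (τ - η) (τ + η) ⊆ Ioo (τ - δ) (τ + δ) :=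
    Ioo_subset_Ioo (by linarith) (by linarith)
  have hJδ4 : Ioo (τ - η) (τ + η) ⊆ Ioo (τ - δ / 4) (τ + δ / 4) :=
    Ioo_subset_Ioo (by linarith) (by linarith)
  have hJε : Ioo (τ - η) (τ + η) ⊆ Ioo (τ - ε) (τ + ε) :=
    Ioo_subset_Ioo (by linarith) (by linarith)
  have hsol : ∀ s ∈ Metric.ball (0 : ℝ × ℝ) ρ, IsSolution (c s) (Ioo (τ - η) (τ + η)) :=
    fun s hs => (hc s hs).1.mono isOpen_Ioo hJδ
  have hpos : ∀ s ∈ Metric.ball (0 : ℝ × ℝ) ρ, 0 < 1 + s.2 := fun s hs => by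
    simpa [(hc s hs).2] using (hc s hs).1.pos τ hτJ
  have hini : EqOn (fun s => coeffs (solutionForm (c s)) τ) initialCoeffs
      (Metric.ball (0 : ℝ × ℝ) ρ) := fun s hs => by
    simp only [coeffs_solutionForm, (hc s hs).2]
    rfl
  have hfd : ∀ s ∈ Metric.ball (0 : ℝ × ℝ) ρ,
      fderiv ℝ (fun s => coeffs (solutionForm (c s)) τ) s = fderiv ℝ initialCoeffs s :=
    fun s hs => (Filter.eventuallyEq_of_mem (Metric.isOpen_ball.mem_nhds hs) hini).fderiv_eq
  have h0 : (0 : ℝ × ℝ) ∈ Metric.ball (0 : ℝ × ℝ) ρ := Metric.mem_ball_self hρ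
  -- a local equivalence between members of the family preserves the state
  have key : ∀ s ∈ Metric.ball ((ρ / 2, 0) : ℝ × ℝ) ε ∩ Metric.ball 0 ρ,
      ∀ s' ∈ Metric.ball ((ρ / 2, 0) : ℝ × ℝ) ε ∩ Metric.ball 0 ρ,
      ∀ ψ : OpenPartialHomeomorph Tube Tube, IsLocalIso tubeModel (solutionForm (c s))
        (solutionForm (c s')) (tubeOver (Ioo (τ - η) (τ + η))) ψ → ∀ p ∈ ψ.source,
      p.1 = (ψ p).1 ∧ c s τ = c s' τ := by
    intro s hs s' hs' ψ hψ p hp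
    have hneg : ∀ s ∈ Metric.ball ((ρ / 2, 0) : ℝ × ℝ) ε ∩ Metric.ball 0 ρ,
        ∀ t ∈ Ioo (τ - η) (τ + η), deriv (fun r => stateInvariant (c s r)) t < 0 := by
      intro s hs t ht
      rw [(hsol s hs.2).deriv_stateInvariant ht]
      exact hWneg _ (hεW s hs.1 t (hJε ht))
    have hJ : p.1 ∈ Ioo (τ - η) (τ + η) := (hψ.source_subset hp).1
    have hJ' : (ψ p).1 ∈ Ioo (τ - η) (τ + η) := (hψ.target_subset (ψ.map_source hp)).1
    have h := hWinj (hεW s hs.1 _ (hJε hJ)) (hεW s' hs'.1 _ (hJε hJ'))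
      (stateInvariants_eq (hsol s hs.2) (hsol s' hs'.2) hψ (hneg s hs) (hneg s' hs') hp)
    exact (hc s hs.2).1.eq_of_meet (hc s' hs'.2).1 (by rw [(hc s hs.2).2])
      (by rw [(hc s' hs'.2).2]) (hJδ4 hJ) (hJδ4 hJ') h
  refine ⟨τ - η, τ + η, Metric.ball 0 ρ, fun s => solutionForm (c s),
    ⟨by linarith, by linarith⟩, Metric.isOpen_ball, Metric.isConnected_ball hρ, h0,
    fun s hs => ⟨(hsol s hs).isNearlyParallel, isGInvariant_tubeForm _ _, (hsol s hs).isArcLength⟩,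
    continuousOn_coeffs_solutionForm (hcont.mono (prod_mono_right hJδ))
      fun z hz => (hsol z.1 hz.1).pos z.2 hz.2, fun t ht => ?_, fun s hs s' hs' h => ?_,
    ContDiffOn.congr (fun s hs => (contDiffAt_initialCoeffs (hpos s hs)).contDiffWithinAt) hini,
    fun s hs => ?_, ?_, Metric.ball (ρ / 2, 0) ε ∩ Metric.ball 0 ρ, inter_subset_right,
    Metric.isOpen_ball.inter Metric.isOpen_ball, ⟨_, Metric.mem_ball_self hε, hs₀⟩,
    fun s hs hhom => ?_, ?_⟩
  · have h1 : t ∈ Ioo 0 (Real.pi / 2) := ⟨by linarith [ht.1], by linarith [ht.2]⟩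
    rw [← coeffs_roundSolution h1, coeffs_solutionForm, coeffs_solutionForm, hround t (hJδ ht)]
  · have h1 := (hini hs).symm.trans (h.trans (hini hs'))
    rw [← initialInverse_initialCoeffs (hpos s hs), h1, initialInverse_initialCoeffs (hpos s' hs')]
  · rw [hfd s hs]
    exact injective_fderiv_initialCoeffs (hpos s hs)
  · rw [hfd 0 h0]
    exact transverse_initialCoeffs
  -- A local automorphism preserves t, so it cannot carry the orbit at τ to the one at τ + η/2.
  · obtain ⟨ψ, hψ, hp, hq⟩ := hhom (τ, 1) ⟨⟨by linarith, by linarith⟩, mem_univ _⟩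
      (τ + η / 2, 1) ⟨⟨by linarith, by linarith⟩, mem_univ _⟩
    have h := (key s hs s hs ψ hψ _ hp).1
    rw [hq] at h
    change τ = τ + η / 2 at h
    linarith
  · rintro s hs s' hs' hne ⟨ψ, ⟨p, hp⟩, hψ⟩
    have h := (key s hs s' hs' ψ hψ p hp).2
    rw [(hc s hs.2).2, (hc s' hs'.2).2] at h
    simp only [Prod.mk.injEq, true_and, add_right_inj] at h
    exact hne (Prod.ext h.1 h.2)

end
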